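/- Let $W$ be a complex vector space of dimension $6$, let $\mathbb G\subset\mathbb P(\wedge^3W)$ be the Grassmannian of planes of $\mathbb P(W)=\mathbb P^5$, and let $u=[\wedge^3U]\in\mathbb G$ be the point given by a $3$-dimensional subspace $U\subset W$. For $0\le i\le 3$ let $W^i_u\subset\wedge^3W$ be the image of $\wedge^iU\otimes\wedge^{3-i}W$. Let $A\subset\wedge^3W$ be a Lagrangian subspace for the wedge pairing $\wedge^3W\times\wedge^3W\to\wedge^6W\cong\mathbb C$, with $\wedge^3U\subset A$, and assume that the scheme $F_A:=\mathbb P(A)\cdot\mathbb G$ (scheme-theoretic intersection in $\mathbb P(\wedge^3W)$) is finite and smooth at $u$. Let $P_u=\mathbb P(U)\cong\mathbb P^2$ and let $P_u^\perp\cong\mathbb P^2$ be the net of hyperplanes of $\mathbb P(W)$ through $P_u$. The Segre embedding $s:P_u\times P_u^\perp\to\mathbb P(W^1_u/W^2_u)=\mathbb P^8$ sends $([x],H)$, where $H=U+\langle h_2,h_3\rangle$, to the class of $x\wedge h_2\wedge h_3$. Let $u_1,u_2,u_3$ be any basis of $U$, with corresponding coordinates $(x_1:x_2:x_3)$ on $P_u$,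 and let $e_1,e_2,e_3\in W$ be any vectors inducing a basis of $W/U$; let $(y_1:y_2:y_3)$ be the coordinates on $P_u^\perp$ such that the hyperplane with coordinates $y$ contains $U$ and has an equation taking the values $y_j$ on $e_j$. Put $T_{ij}=u_i\wedge e_{j+1}\wedge e_{j+2}$ (indices mod $3$) and choose $a_{ij}\in A$ with $a_{ij}-T_{ij}\in W^2_u$ (such elements exist, and are unique modulo $\wedge^3U$). Let $V_A\subset P_u\times P_u^\perp$ be defined by $f=0$, where $$f=\sum_{i,j,k,l}\,(T_{ij}\wedge a_{kl})\;x_iy_jx_ky_l .$$ Then: 1. $f$ is a nonzero form of bidegree $(2,2)$, so that $V_A$ is a hypersurface of bidegree $(2,2)$. 2. The singular scheme $\operatorname{Sing}V_A$ (the scheme of points of $V_A$ at which every tangent vector to $P_u\times P_u^\perp$ is tangent to $V_A$) is the closed subscheme of $P_u\times P_u^\perp$ defined by the six partial derivatives $\partial f/\partial x_i$, $\partial f/\partial y_i$, $i=1,2,3$. 3. The tangential projection $\mathbb P(W^1_u)\dashrightarrow\mathbb P(W^1_u/W^2_u)$, restricted to $F_A-\{u\}$, factors through $s$ and induces an isomorphism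 of schemes $F_A-\{u\}\;\cong\;\operatorname{Sing}V_A$. -/

import Mathlib

open CategoryTheory Module
open scoped TensorProduct

noncomputable section

namespace Morin

universe v

/-! Schemes over `ℂ` are represented by their functors of points on commutative `ℂ`-algebras;
closed and open subschemes are subfunctors, and an isomorphism of schemes is an isomorphism of
functors of points.  `Module.Grassmannian.functor ℂ V k` is the Grassmannian of linear subspaces of
*codimension* `k` in `V`: its `R`-points are the submodules of `R ⊗ V` whose quotient is projective
of constant rank `k`.  The exterior algebra of `R ⊗ W` is taken to be `R ⊗ ⋀ W`. -/

section BaseChange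

theorem ker_baseChange_mkQ {R S : Type} [CommRing R] [CommRing S] [Algebra R S]
    {M P : Type v} [AddCommGroup M] [Module R M] [AddCommGroup P] [Module S P]
    (c : S ⊗[R] M ≃ₗ[S] P) (φ : M → P)
    (hc : ∀ x, c (1 ⊗ₜ[R] x) = φ x) (N : Submodule R M) :
    LinearMap.ker (N.mkQ.baseChange S ∘ₗ c.symm.toLinearMap) =
      Submodule.span S (φ '' (N : Set M)) := by
  have hex : Function.Exact (N.subtype.lTensor S) (N.mkQ.lTensor S) :=
    lTensor_exact S (LinearMap.exact_subtype_mkQ N) (Submodule.mkQ_surjective N)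
  have hmem : ∀ z : S ⊗[R] M, c z ∈ LinearMap.ker (N.mkQ.baseChange S ∘ₗ c.symm.toLinearMap) ↔
      N.mkQ.lTensor S z = 0 := by
    intro z
    rw [LinearMap.mem_ker, LinearMap.comp_apply,
      LinearEquiv.coe_coe, LinearEquiv.symm_apply_apply, LinearMap.baseChange_eq_ltensor]
  apply le_antisymm
  · intro z hz
    obtain ⟨z, rfl⟩ := c.surjective z
    obtain ⟨t, rfl⟩ := (hex _).1 ((hmem z).1 hz)
    clear hz
    induction t using TensorProduct.induction_on with
    | zero => simp
    | tmul s n =>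
      have h1 : (s ⊗ₜ[R] (n : M)) = s • ((1 : S) ⊗ₜ[R] (n : M)) := by
        rw [TensorProduct.smul_tmul', smul_eq_mul, mul_one]
      rw [LinearMap.lTensor_tmul, Submodule.subtype_apply, h1, map_smul, hc]
      exact Submodule.smul_mem _ _ (Submodule.subset_span ⟨_, n.2, rfl⟩)
    | add x y hx hy => rw [map_add, map_add]; exact add_mem hx hy
  · rw [Submodule.span_le]
    rintro _ ⟨n, hn, rfl⟩
    rw [SetLike.mem_coe, ← hc, hmem, LinearMap.lTensor_tmul, Submodule.mkQ_apply,
      (Submodule.Quotient.mk_eq_zero _).2 hn, TensorProduct.tmul_zero]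

variable {V : Type v} [AddCommGroup V] [Module ℂ V]
variable {R S : Type} [CommRing R] [Algebra ℂ R] [CommRing S] [Algebra ℂ S]

theorem cancelBaseChange_one_tmul [Algebra R S] [IsScalarTower ℂ R S] (g : R →ₗ[ℂ] S)
    (hg : ∀ r, g r = algebraMap R S r) (x : R ⊗[ℂ] V) :
    TensorProduct.AlgebraTensorModule.cancelBaseChange ℂ R S S V (1 ⊗ₜ[R] x) =
      g.rTensor V x := by
  induction x using TensorProduct.induction_on with
  | zero => simp
  | tmul r m =>
    rw [TensorProduct.AlgebraTensorModule.cancelBaseChange_tmul,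
      LinearMap.rTensor_tmul, Algebra.smul_def, mul_one, hg]
  | add x y hx hy => rw [TensorProduct.tmul_add, map_add, hx, hy, map_add]

/-- The submodule attached to the pullback of a point of a Grassmannian along `R → S` is spanned by
the image of the original submodule. -/
theorem toSubmodule_map {k : ℕ} (f : R →ₐ[ℂ] S) (N : Grassmannian R (R ⊗[ℂ] V) k) :
    (Grassmannian.map f N).toSubmodule =
      Submodule.span S (f.toLinearMap.rTensor V '' (N.toSubmodule : Set (R ⊗[ℂ] V))) := by
  let : Algebra R S := f.toAlgebra
  let : IsScalarTower ℂ R S :=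
    IsScalarTower.of_algebraMap_eq' <| IsScalarTower.algebraMap_eq ℂ R S
  rw [Grassmannian.map_toSubmodule]
  exact ker_baseChange_mkQ (TensorProduct.AlgebraTensorModule.cancelBaseChange ℂ R S S V) _
    (cancelBaseChange_one_tmul f.toLinearMap fun _ => rfl) N.toSubmodule

end BaseChange

section Exterior

variable {W : Type v} [AddCommGroup W] [Module ℂ W]

/-- `A ⊆ ⋀³ W` is Lagrangian for the wedge pairing `⋀³ W × ⋀³ W → ⋀⁶ W`: it equals its own
orthogonal. -/
def IsLagrangian (A : Submodule ℂ (ExteriorAlgebra ℂ W)) : Prop :=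
  A ≤ ⋀[ℂ]^3 W ∧ ∀ a ∈ ⋀[ℂ]^3 W, a ∈ A ↔ ∀ b ∈ A, a * b = 0

/-- The image of `⋀ⁱ U × ⋀³⁻ⁱ W → ⋀³ W`, for `i ≤ 3`. -/
def filt (U : Submodule ℂ W) (i : ℕ) : Submodule ℂ (ExteriorAlgebra ℂ W) :=
  U.map (ExteriorAlgebra.ι ℂ) ^ i * ⋀[ℂ]^(3 - i) W

variable (R : Type) [CommRing R] [Algebra ℂ R]

/-- The submodule `⋀ⁿ N` of `⋀ⁿ (R ⊗ W)` spanned by the products of `n` elements of `N`. -/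
def wedgePow (n : ℕ) (N : Submodule R (R ⊗[ℂ] W)) : Submodule R (R ⊗[ℂ] ExteriorAlgebra ℂ W) :=
  N.map ((ExteriorAlgebra.ι ℂ).baseChange R) ^ n

variable {R} {S : Type} [CommRing S] [Algebra ℂ S]

theorem wedgePow_map_le {k n : ℕ} (f : R →ₐ[ℂ] S) (N : Grassmannian R (R ⊗[ℂ] W) k)
    (A : Submodule ℂ (ExteriorAlgebra ℂ W))
    (h : wedgePow R n N.toSubmodule ≤ A.baseChange R) :
    wedgePow S n (Grassmannian.map f N).toSubmodule ≤ A.baseChange S := by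
  let g : R ⊗[ℂ] ExteriorAlgebra ℂ W →ₐ[ℂ] S ⊗[ℂ] ExteriorAlgebra ℂ W :=
    Algebra.TensorProduct.map f (AlgHom.id ℂ _)
  have hg : ∀ x : R ⊗[ℂ] W, (ExteriorAlgebra.ι ℂ).baseChange S (f.toLinearMap.rTensor W x) =
      g ((ExteriorAlgebra.ι ℂ).baseChange R x) := by
    intro x
    induction x using TensorProduct.induction_on with
    | zero => simp
    | tmul r m => simp [g]
    | add x y hx hy => simp only [map_add, hx, hy]
  have hA : ∀ a ∈ A.baseChange R, g a ∈ A.baseChange S := by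
    rintro _ ⟨t, rfl⟩
    induction t using TensorProduct.induction_on with
    | zero => simp
    | tmul r m =>
      simp only [LinearMap.baseChange_tmul, g, Algebra.TensorProduct.map_tmul]
      exact Submodule.tmul_mem_baseChange_of_mem _ m.2
    | add x y hx hy => rw [map_add, map_add]; exact add_mem hx hy
  unfold wedgePow at *
  rw [toSubmodule_map, Submodule.map_span, Submodule.span_pow, Submodule.span_le]
  have hset : ((ExteriorAlgebra.ι ℂ).baseChange S '' (f.toLinearMap.rTensor W ''
      (N.toSubmodule : Set (R ⊗[ℂ] W)))) =
      g '' (N.toSubmodule.map ((ExteriorAlgebra.ι ℂ).baseChange R) : Set _) := by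
    ext z; constructor
    · rintro ⟨_, ⟨n, hn, rfl⟩, rfl⟩
      exact ⟨_, ⟨n, hn, rfl⟩, (hg n).symm⟩
    · rintro ⟨_, ⟨n, hn, rfl⟩, rfl⟩
      exact ⟨_, ⟨n, hn, rfl⟩, hg n⟩
  rw [hset, ← Set.image_pow]
  rintro _ ⟨z, hz, rfl⟩
  exact hA z (h (Submodule.pow_subset_pow _ hz))

end Exterior

section Schemes

/-- The Grassmannian of linear subspaces of codimension `k` in `V`. -/
abbrev Gr (V : Type v) [AddCommGroup V] [Module ℂ V] (k : ℕ) : CommAlgCat.{0} ℂ ⥤ Type v :=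
  Grassmannian.functor (R := ℂ) (M := V) k

variable {W : Type v} [AddCommGroup W] [Module ℂ W]

/-- The scheme `F_A = ℙ(A) · 𝔾`, where `𝔾` is the Grassmannian of three-dimensional subspaces of the
six-dimensional space `W`: it consists of the `Λ` with `⋀³ Λ ⊆ A`. -/
def schemeF (A : Submodule ℂ (ExteriorAlgebra ℂ W)) :
    Subfunctor (Gr W 3) where
  obj R := {Λ | wedgePow R 3 Λ.toSubmodule ≤ A.baseChange R}
  map f _ hΛ := wedgePow_map_le f.hom _ A hΛ

/-- The open subscheme `F_A - {u}`, where `u` is the point `U` of `𝔾`: those points of `F_A` which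
are different from `u` over every field-valued point of the base. -/
def schemeFMinus (A : Submodule ℂ (ExteriorAlgebra ℂ W)) (U : Submodule ℂ W) :
    Subfunctor (Gr W 3) where
  obj R := {Λ | Λ ∈ (schemeF A).obj R ∧ ∀ (K : CommAlgCat.{0} ℂ) (f : R ⟶ K), IsField K →
    ((Gr W 3).map f Λ).toSubmodule ≠ U.baseChange K}
  map f Λ hΛ := ⟨(schemeF A).map f hΛ.1, fun K g hK => by
    have h := hΛ.2 K (f ≫ g) hK
    rw [Functor.map_comp] at h
    exact h⟩

/-- `F_A` is finite: being a projective scheme over `ℂ`, this means that it has finitely many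
complex points. -/
def FiniteF (A : Submodule ℂ (ExteriorAlgebra ℂ W)) : Prop :=
  ((schemeF A).obj (CommAlgCat.of ℂ ℂ)).Finite

/-- The Zariski tangent space of `F_A` at `u` is zero: the only `ℂ[ε]`-point of `F_A` over `u` is the
constant one.  When `u` is a point of `F_A` and `F_A` is finite, this says that `F_A` is smooth
at `u`. -/
def TangentZeroAt (A : Submodule ℂ (ExteriorAlgebra ℂ W)) (U : Submodule ℂ W) : Prop :=
  ∀ Λ ∈ (schemeF A).obj (CommAlgCat.of ℂ (DualNumber ℂ)),
    (Grassmannian.map (TrivSqZeroExt.fstHom ℂ ℂ ℂ) Λ).toSubmodule = U.baseChange ℂ →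
      Λ.toSubmodule = U.baseChange (DualNumber ℂ)

/-- `ℙ² × ℙ² = P_u × P_u^⊥`: pairs of a line in `U` and a hyperplane of `W / U`, that is, a
hyperplane of `W` containing `U`. -/
abbrev planeProd (U : Submodule ℂ W) : CommAlgCat.{0} ℂ ⥤ Type v :=
  FunctorToTypes.prod (Gr U 2) (Gr (W ⧸ U) 1)

variable {U : Submodule ℂ W} (u : Basis (Fin 3) ℂ U) (e : Basis (Fin 3) ℂ (W ⧸ U))

/-- `(x₁ : x₂ : x₃) × (y₁ : y₂ : y₃)` are homogeneous coordinates of the `R`-point `p` of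
`P_u × P_u^⊥`: the line is generated by `∑ xᵢ uᵢ`, and the hyperplane has the equation `y`, whose
coefficients with respect to `e` are the `yⱼ`. -/
def IsCoord {R : CommAlgCat.{0} ℂ} (p : (planeProd U).obj R) (x y : Fin 3 → R) : Prop :=
  p.1.toSubmodule = Submodule.span R {∑ i, x i ⊗ₜ[ℂ] u i} ∧
    Ideal.span (Set.range y) = ⊤ ∧
    p.2.toSubmodule = LinearMap.ker ((e.baseChange R).constr R y)

/-- The closed subscheme of `P_u × P_u^⊥` cut out by a set of bihomogeneous forms.  Points have
homogeneous coordinates only locally, hence the quantification over `R → S`. -/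
def zeroScheme (s : Set (MvPolynomial (Fin 3 ⊕ Fin 3) ℂ)) : Subfunctor (planeProd U) where
  obj R := {p | ∀ (S : CommAlgCat.{0} ℂ) (f : R ⟶ S) (x y : Fin 3 → S),
    IsCoord u e ((planeProd U).map f p) x y → ∀ g ∈ s, MvPolynomial.aeval (Sum.elim x y) g = 0}
  map f p hp S g x y h := hp S (f ≫ g) x y (by rw [Functor.map_comp]; exact h)

/-- The dual number `x + ε v`. -/
def addEps {R : Type} [CommRing R] (x v : R) : DualNumber R :=
  TrivSqZeroExt.inl x + TrivSqZeroExt.inr v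

/-- The singular scheme of the hypersurface `f = 0` in `P_u × P_u^⊥`: the points all of whose
first order deformations `(x + ε v, y + ε w)` satisfy `f = 0`, that is, the points of the
hypersurface at which every tangent vector of `P_u × P_u^⊥` is tangent to the hypersurface. -/
def singScheme (f : MvPolynomial (Fin 3 ⊕ Fin 3) ℂ) : Subfunctor (planeProd U) where
  obj R := {p | ∀ (S : CommAlgCat.{0} ℂ) (h : R ⟶ S) (x y : Fin 3 → S),
    IsCoord u e ((planeProd U).map h p) x y → ∀ v w : Fin 3 → S,
      MvPolynomial.aeval
        (Sum.elim (fun i => addEps (x i) (v i)) fun j => addEps (y j) (w j)) f = 0}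
  map f p hp S g x y h := hp S (f ≫ g) x y (by rw [Functor.map_comp]; exact h)

/-- A vector of `W` lifting the basis vector `eⱼ` of `W / U`. -/
def liftVec (j : Fin 3) : W := Function.surjInv U.mkQ_surjective (e j)

/-- The trivector `uᵢ ∧ e_{j+1} ∧ e_{j+2}` (indices mod 3).  The hyperplane with coefficients `y`
corresponds to the bivector `∑ⱼ yⱼ e_{j+1} ∧ e_{j+2}` of `⋀² (W / U)`. -/
def segreVec (i j : Fin 3) : ExteriorAlgebra ℂ W :=
  ExteriorAlgebra.ι ℂ (u i : W) * ExteriorAlgebra.ι ℂ (liftVec e (j + 1)) *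
    ExteriorAlgebra.ι ℂ (liftVec e (j + 2))

/-- An element `a = a₁ + a₂ + a₃` of `A` with first component `a₁ = uᵢ ∧ e_{j+1} ∧ e_{j+2}`, where
`a₂ + a₃` lies in the image of `⋀² U × W`. -/
def segreLift (A : Submodule ℂ (ExteriorAlgebra ℂ W)) (i j : Fin 3) : ExteriorAlgebra ℂ W :=
  Classical.epsilon fun a => a ∈ A ∧ a - segreVec u e i j ∈ filt U 2

/-- The identification `⋀⁶ W → ℂ` given by a volume form, extended by zero to the other degrees. -/
def topForm (vol : W [⋀^Fin 6]→ₗ[ℂ] ℂ) : ExteriorAlgebra ℂ W →ₗ[ℂ] ℂ :=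
  ExteriorAlgebra.liftAlternating (Pi.single 6 vol)

/-- The equation `v_A` of `V_A` in the coordinates `(x, y)`: the form `a₁ ∧ a = a₁ ∧ a₂`, where
`a = a₁ + a₂ + a₃ ∈ A` has first component `a₁ = ∑ xᵢ yⱼ uᵢ ∧ e_{j+1} ∧ e_{j+2}`. -/
def verraForm (A : Submodule ℂ (ExteriorAlgebra ℂ W)) (vol : W [⋀^Fin 6]→ₗ[ℂ] ℂ) :
    MvPolynomial (Fin 3 ⊕ Fin 3) ℂ :=
  ∑ i, ∑ j, ∑ k, ∑ l,
    MvPolynomial.C (topForm vol (segreVec u e i j * segreLift u e A k l)) *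
      (MvPolynomial.X (Sum.inl i) * MvPolynomial.X (Sum.inr j) *
        (MvPolynomial.X (Sum.inl k) * MvPolynomial.X (Sum.inr l)))

/-- `f` is bihomogeneous of bidegree `d` in the `x` and the `y` variables. -/
def IsBihomogeneous (f : MvPolynomial (Fin 3 ⊕ Fin 3) ℂ) (d : ℕ × ℕ) : Prop :=
  MvPolynomial.IsWeightedHomogeneous (Sum.elim (fun _ => ((1, 0) : ℕ × ℕ)) fun _ => (0, 1)) f d

/-- `p = (ℓ, H)` is the tangential projection of `Λ` from `u`: the class of `⋀³ Λ` modulo the image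
of `⋀² U × W` is the Segre image `ℓ ∧ ⋀² H` of `p`. -/
def IsTangentialProjection {R : CommAlgCat.{0} ℂ} (Λ : (Gr W 3).obj R)
    (p : (planeProd U).obj R) : Prop :=
  wedgePow R 3 Λ.toSubmodule ⊔ (filt U 2).baseChange R =
    wedgePow R 1 (p.1.toSubmodule.map (U.subtype.baseChange R)) *
      wedgePow R 2 (p.2.toSubmodule.comap (U.mkQ.baseChange R)) ⊔ (filt U 2).baseChange R

end Schemes

end Morin

end

noncomputable section

namespace Morin

universe v

open scoped Matrix

/-! Let `E` be the complement of `U` spanned by the lifts of the `eⱼ`, so that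
`⋀³ W = ⋀³ U ⊕ (U ⊗ ⋀² E) ⊕ (⋀² U ⊗ E) ⊕ ⋀³ E`.  Since `F_A` has zero tangent space at `u`, the
subspace `A` meets `⋀² U ∧ W` only in `⋀³ U`.  Being Lagrangian, `A` is then the sum of `⋀³ U` and
the graph of a homomorphism `G : U ⊗ ⋀² E → ⋀² U ⊗ E`, symmetric for the wedge pairing, and up to a
scalar `f` is the quadratic form of `G` restricted to the tensors `x ⊗ y`.  So `(x, y)` is a
singular point of `f` exactly when the `3 × 3` matrix `G (x ⊗ y)` is annihilated by `x` on the left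
and by `y` on the right.

If `Λ` is a point of `F_A - {u}`, then `ℓ = Λ ∩ U` is a line and the image `H` of `Λ` in `E` is a
plane: `⋀³ Λ` has no component in `⋀³ E`, and if `H` were a line or zero, then `Λ` would have to be
`U`.  For `x ∈ ℓ` and `m + h, m' + h' ∈ Λ`, the equations of `F_A` read
`(x × m) ⊗ h' - (x × m') ⊗ h = G (x ⊗ h × h')`, and contracting with `x` and with `h × h'` shows
that `(ℓ, H)` is a singular point.  Conversely, at a singular point these equations determine
`x × m`, and hence `m` modulo `ℓ`, as a function of `h ∈ H`, which reconstructs `Λ`.  The same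
computation works over every ring, because lines and planes in `R³` can be described by relations
between cross products instead of generators.

Since `F_A` has finitely many points, so does the singular scheme of `f`, which therefore cannot be
all of `ℙ² × ℙ²`: this is why `f ≠ 0`. -/

section Tensors

variable {R m n : Type*} [CommRing R]

/-- The Segre map: the pair `(x, y)` goes to the tensor with coefficients `xᵢ yⱼ`. -/
def segre : (m → R) →ₗ[R] (n → R) →ₗ[R] (m × n → R) :=
  LinearMap.mk₂ R (fun x y ij => x ij.1 * y ij.2) (fun _ _ _ => funext fun _ => add_mul _ _ _)
    (fun _ _ _ => funext fun _ => mul_assoc _ _ _) (fun _ _ _ => funext fun _ => mul_add _ _ _)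
    (fun _ _ _ => funext fun _ => mul_left_comm _ _ _)

theorem segre_apply (x : m → R) (y : n → R) (ij : m × n) : segre x y ij = x ij.1 * y ij.2 :=
  rfl

variable {𝒜 : Type*} [Ring 𝒜] [Algebra R 𝒜] [Fintype m] [Fintype n]

theorem linearCombination_mul_linearCombination (p : m → 𝒜) (q : n → 𝒜) (a : m → R) (b : n → R) :
    Fintype.linearCombination R p a * Fintype.linearCombination R q b =
      Fintype.linearCombination R (fun ij : m × n => p ij.1 * q ij.2) (segre a b) := by
  simp only [Fintype.linearCombination_apply, Finset.sum_mul_sum, smul_mul_smul_comm,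
    Fintype.sum_prod_type, segre_apply]

theorem linearCombination_mul_linearCombination_of_dual [DecidableEq m] {p q : m → 𝒜} {c : 𝒜}
    (h : ∀ i j, p i * q j = if i = j then c else 0) (a b : m → R) :
    Fintype.linearCombination R p a * Fintype.linearCombination R q b = (a ⬝ᵥ b) • c := by
  simp only [Fintype.linearCombination_apply, Finset.sum_mul_sum, smul_mul_smul_comm, h, smul_ite,
    smul_zero, Finset.sum_ite_eq, Finset.mem_univ, if_true, dotProduct, Finset.sum_smul]

theorem linearCombination_mem {M : Type*} [AddCommGroup M] [Module R M] {N : Submodule R M}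
    {p : m → M} (hp : ∀ i, p i ∈ N) (a : m → R) : Fintype.linearCombination R p a ∈ N := by
  rw [Fintype.linearCombination_apply]
  exact Submodule.sum_mem _ fun i _ => N.smul_mem _ (hp i)

end Tensors

section Anticommuting

/-- A family of elements of a ring which have square zero and anticommute with each other, like
vectors in an exterior algebra. -/
structure IsAnticommuting {ι 𝒜 : Type*} [Ring 𝒜] (p : ι → 𝒜) : Prop where
  mul_self : ∀ i, p i * p i = 0
  mul_swap : ∀ i j, p j * p i = -(p i * p j)

/-- The product of the three members of a family. -/
def topWedge {𝒜 : Type*} [Ring 𝒜] (p : Fin 3 → 𝒜) : 𝒜 := p 0 * p 1 * p 2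

/-- The products of two members of a family of three, ordered so as to be dual to the third one:
`pᵢ * coWedge p i = topWedge p`. -/
def coWedge {𝒜 : Type*} [Ring 𝒜] (p : Fin 3 → 𝒜) (k : Fin 3) : 𝒜 := p (k + 1) * p (k + 2)

namespace IsAnticommuting

variable {ι 𝒜 : Type*} [Ring 𝒜]

theorem comp {κ : Type*} {p : ι → 𝒜} (h : IsAnticommuting p) (σ : κ → ι) :
    IsAnticommuting (p ∘ σ) :=
  ⟨fun i => h.mul_self (σ i), fun i j => h.mul_swap (σ i) (σ j)⟩

theorem map {ℬ : Type*} [Ring ℬ] {p : ι → 𝒜} (h : IsAnticommuting p) (φ : 𝒜 →+* ℬ) :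
    IsAnticommuting (φ ∘ p) where
  mul_self i := by rw [Function.comp_apply, ← map_mul, h.mul_self, map_zero]
  mul_swap i j := by simp only [Function.comp_apply, ← map_mul, h.mul_swap i j, map_neg]

theorem swap_of_mem_span {R : Type*} [CommRing R] [Algebra R 𝒜] {p : ι → 𝒜}
    (h : IsAnticommuting p) {x y : 𝒜} (hx : x ∈ Submodule.span R (Set.range p))
    (hy : y ∈ Submodule.span R (Set.range p)) : y * x = -(x * y) := by
  induction hx, hy using Submodule.span_induction₂ with
  | mem_mem x y hx hy =>
    obtain ⟨⟨i, rfl⟩, j, rfl⟩ := And.intro hx hy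
    exact h.mul_swap i j
  | zero_left y => simp
  | zero_right x => simp
  | add_left x y z _ _ _ hx hy => rw [mul_add, hx, hy, add_mul, neg_add]
  | add_right x y z _ _ _ hx hy => rw [add_mul, hx, hy, mul_add, neg_add]
  | smul_left r x y _ _ hxy => rw [mul_smul_comm, hxy, smul_mul_assoc, smul_neg]
  | smul_right r x y _ _ hxy => rw [smul_mul_assoc, hxy, mul_smul_comm, smul_neg]

end IsAnticommuting

theorem commute_mul_of_swap {𝒜 : Type*} [Ring 𝒜] {x y z : 𝒜} (hx : z * x = -(x * z))
    (hy : z * y = -(y * z)) : Commute z (x * y) := by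
  rw [Commute, SemiconjBy, ← mul_assoc, hx, neg_mul, mul_assoc, hy, mul_neg, neg_neg, mul_assoc]

section Span

variable {R 𝒜 : Type*} [CommRing R] [Ring 𝒜] [Algebra R 𝒜]

theorem coWedge_mem_pow {N : Submodule R 𝒜} {p : Fin 3 → 𝒜} (hp : ∀ i, p i ∈ N) (k : Fin 3) :
    coWedge p k ∈ N ^ 2 :=
  sq N ▸ Submodule.mul_mem_mul (hp _) (hp _)

theorem topWedge_mem_pow {N : Submodule R 𝒜} {p : Fin 3 → 𝒜} (hp : ∀ i, p i ∈ N) :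
    topWedge p ∈ N ^ 3 := by
  rw [pow_succ, sq]
  exact Submodule.mul_mem_mul (Submodule.mul_mem_mul (hp 0) (hp 1)) (hp 2)

end Span

namespace IsAnticommuting

variable {R 𝒜 : Type*} [CommRing R] [Ring 𝒜] [Algebra R 𝒜] {p q : Fin 3 → 𝒜}

theorem left (h : IsAnticommuting (Sum.elim p q)) : IsAnticommuting p := h.comp Sum.inl

theorem right (h : IsAnticommuting (Sum.elim p q)) : IsAnticommuting q := h.comp Sum.inr

theorem mul_coWedge (h : IsAnticommuting p) (i k : Fin 3) :
    p i * coWedge p k = if i = k then topWedge p else 0 := by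
  have hcomm : ∀ i j k, Commute (p k) (p i * p j) := fun i j k =>
    commute_mul_of_swap (h.mul_swap i k) (h.mul_swap j k)
  by_cases hik : i = k
  · subst hik
    rw [if_pos rfl]
    fin_cases i
    · exact (mul_assoc _ _ _).symm
    · exact (mul_assoc _ _ _).symm.trans ((hcomm 1 2 0).eq.symm.trans (mul_assoc _ _ _).symm)
    · exact (hcomm 0 1 2).eq
  · rw [if_neg hik]
    obtain rfl | rfl : i = k + 1 ∨ i = k + 2 := by omega
    · rw [coWedge, ← mul_assoc, h.mul_self, zero_mul]
    · rw [coWedge, (hcomm _ _ _).eq, mul_assoc, h.mul_self, mul_zero]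

theorem commute_coWedge (h : IsAnticommuting (Sum.elim p q)) (i k : Fin 3) :
    Commute (q i) (coWedge p k) :=
  commute_mul_of_swap (h.mul_swap (.inl _) (.inr i)) (h.mul_swap (.inl _) (.inr i))

theorem swap (h : IsAnticommuting (Sum.elim p q)) : IsAnticommuting (Sum.elim q p) := by
  exact Sum.elim_swap (f := p) (g := q) ▸ h.comp Sum.swap

theorem coWedge_mul (h : IsAnticommuting p) (i k : Fin 3) :
    coWedge p k * p i = if i = k then topWedge p else 0 := by
  rw [← h.mul_coWedge, coWedge, (commute_mul_of_swap (h.mul_swap _ i) (h.mul_swap _ i)).eq]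

theorem linearCombination_mul_linearCombination (h : IsAnticommuting p) (a b : Fin 3 → R) :
    Fintype.linearCombination R p a * Fintype.linearCombination R p b =
      Fintype.linearCombination R (coWedge p) (a ⨯₃ b) := by
  simp only [Fintype.linearCombination_apply, Fin.sum_univ_three, mul_add, add_mul,
    smul_mul_smul_comm, h.mul_self, smul_zero, coWedge, cross_apply]
  rw [h.mul_swap 0 1, h.mul_swap 1 2, h.mul_swap 2 0]
  simp only [Matrix.cons_val, zero_add, Fin.reduceAdd]
  module

theorem linearCombination_mul_coWedge (h : IsAnticommuting p) (a b : Fin 3 → R) :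
    Fintype.linearCombination R p a * Fintype.linearCombination R (coWedge p) b =
      (a ⬝ᵥ b) • topWedge p :=
  linearCombination_mul_linearCombination_of_dual h.mul_coWedge a b

theorem span_sq_le (h : IsAnticommuting p) :
    Submodule.span R (Set.range p) ^ 2 ≤ Submodule.span R (Set.range (coWedge p)) := by
  simp only [sq, Submodule.mul_le, ← Fintype.range_linearCombination]
  rintro _ ⟨a, rfl⟩ _ ⟨b, rfl⟩
  exact ⟨_, (h.linearCombination_mul_linearCombination a b).symm⟩

theorem span_pow_three_le (h : IsAnticommuting p) :
    Submodule.span R (Set.range p) ^ 3 ≤ Submodule.span R {topWedge p} := by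
  rw [pow_succ']
  refine (mul_le_mul_right h.span_sq_le _).trans ?_
  simp only [Submodule.mul_le, ← Fintype.range_linearCombination]
  rintro _ ⟨a, rfl⟩ _ ⟨b, rfl⟩
  rw [h.linearCombination_mul_coWedge]
  exact Submodule.smul_mem _ _ (Submodule.mem_span_singleton_self _)

theorem span_pow_four_eq_bot (h : IsAnticommuting p) :
    Submodule.span R (Set.range p) ^ 4 = ⊥ := by
  have htop : ∀ i, p i * topWedge p = 0 := fun i => by
    rw [← (h.mul_coWedge i i).trans (if_pos rfl), ← mul_assoc, h.mul_self, zero_mul]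
  rw [pow_succ', eq_bot_iff]
  refine (mul_le_mul_right h.span_pow_three_le _).trans ?_
  rw [Submodule.span_mul_span, Submodule.span_le, Set.mul_subset_iff]
  rintro _ ⟨i, rfl⟩ _ rfl
  exact htop i

theorem commute_span (h : IsAnticommuting (Sum.elim p q)) :
    Commute (Submodule.span R (Set.range p)) (Submodule.span R (Set.range q)) := by
  have hle : ∀ {p q : Fin 3 → 𝒜}, IsAnticommuting (Sum.elim p q) →
      Submodule.span R (Set.range p) * Submodule.span R (Set.range q) ≤
        Submodule.span R (Set.range q) * Submodule.span R (Set.range p) := by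
    intro p q h
    rw [Submodule.span_mul_span, Submodule.span_le, Set.mul_subset_iff]
    rintro _ ⟨i, rfl⟩ _ ⟨j, rfl⟩
    rw [show p i * q j = -(q j * p i) from h.mul_swap (.inr j) (.inl i)]
    exact neg_mem (Submodule.mul_mem_mul (Submodule.subset_span ⟨j, rfl⟩)
      (Submodule.subset_span ⟨i, rfl⟩))
  exact (hle h).antisymm (hle h.swap)

theorem mul_eq_zero_of_mem (h : IsAnticommuting (Sum.elim p q)) {a b c d : ℕ}
    (hdeg : 4 ≤ a + c ∨ 4 ≤ b + d) {x y : 𝒜}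
    (hx : x ∈ Submodule.span R (Set.range p) ^ a * Submodule.span R (Set.range q) ^ b)
    (hy : y ∈ Submodule.span R (Set.range p) ^ c * Submodule.span R (Set.range q) ^ d) :
    x * y = 0 := by
  have hp : ∀ n, 4 ≤ n → Submodule.span R (Set.range p) ^ n = ⊥ := fun n hn =>
    pow_eq_zero_of_le hn h.left.span_pow_four_eq_bot
  have hq : ∀ n, 4 ≤ n → Submodule.span R (Set.range q) ^ n = ⊥ := fun n hn =>
    pow_eq_zero_of_le hn h.right.span_pow_four_eq_bot
  rw [← Submodule.mem_bot R]
  convert Submodule.mul_mem_mul hx hy using 1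
  rw [((h.commute_span (R := R)).symm.pow_pow b c).mul_mul_mul_comm, ← pow_add, ← pow_add]
  obtain hdeg | hdeg := hdeg
  · rw [hp _ hdeg, Submodule.bot_mul]
  · rw [hq _ hdeg, Submodule.mul_bot]

end IsAnticommuting
end Anticommuting

section Trivectors

variable (R : Type*) {𝒜 : Type*} [CommRing R] [Ring 𝒜] [Algebra R 𝒜]

/-- For `p` and `q` bases of `U` and of a complement `E`, the element of
`⋀³ (U ⊕ E) = ⋀³ U ⊕ (⋀² U ⊗ E) ⊕ (U ⊗ ⋀² E) ⊕ ⋀³ E` with the given coordinates. Those of the middle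
summands refer to `coWedge p k * q l` and `p i * coWedge q j`. -/
def trivector (p q : Fin 3 → 𝒜) :
    (R × (Fin 3 × Fin 3 → R) × (Fin 3 × Fin 3 → R) × R) →ₗ[R] 𝒜 :=
  (LinearMap.toSpanSingleton R 𝒜 (topWedge p)).coprod <|
    (Fintype.linearCombination R fun kl : Fin 3 × Fin 3 => coWedge p kl.1 * q kl.2).coprod <|
      (Fintype.linearCombination R fun ij : Fin 3 × Fin 3 => p ij.1 * coWedge q ij.2).coprod <|
        LinearMap.toSpanSingleton R 𝒜 (topWedge q)

variable {R} {p q : Fin 3 → 𝒜}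

theorem trivector_apply (s₀ : R) (s t : Fin 3 × Fin 3 → R) (t₀ : R) :
    trivector R p q (s₀, s, t, t₀) = s₀ • topWedge p +
      (Fintype.linearCombination R (fun kl : Fin 3 × Fin 3 => coWedge p kl.1 * q kl.2) s +
        (Fintype.linearCombination R (fun ij : Fin 3 × Fin 3 => p ij.1 * coWedge q ij.2) t +
          t₀ • topWedge q)) :=
  rfl

/-- The coefficients in `⋀² U ⊗ E` of the product of three vectors of `U ⊕ E`. -/
def wedge21 (w₁ w₂ w₃ : (Fin 3 → R) × (Fin 3 → R)) : Fin 3 × Fin 3 → R :=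
  segre (w₁.1 ⨯₃ w₂.1) w₃.2 + segre (w₂.1 ⨯₃ w₃.1) w₁.2 + segre (w₃.1 ⨯₃ w₁.1) w₂.2

/-- The coefficients in `U ⊗ ⋀² E` of the product of three vectors of `U ⊕ E`. -/
def wedge12 (w₁ w₂ w₃ : (Fin 3 → R) × (Fin 3 → R)) : Fin 3 × Fin 3 → R :=
  segre w₁.1 (w₂.2 ⨯₃ w₃.2) + segre w₂.1 (w₃.2 ⨯₃ w₁.2) + segre w₃.1 (w₁.2 ⨯₃ w₂.2)

namespace IsAnticommuting

theorem mul_mul_eq_trivector (h : IsAnticommuting (Sum.elim p q))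
    (w₁ w₂ w₃ : (Fin 3 → R) × (Fin 3 → R)) :
    (Fintype.linearCombination R p w₁.1 + Fintype.linearCombination R q w₁.2) *
        (Fintype.linearCombination R p w₂.1 + Fintype.linearCombination R q w₂.2) *
        (Fintype.linearCombination R p w₃.1 + Fintype.linearCombination R q w₃.2) =
      trivector R p q (w₁.1 ⬝ᵥ w₂.1 ⨯₃ w₃.1, wedge21 w₁ w₂ w₃, wedge12 w₁ w₂ w₃,
        w₁.2 ⬝ᵥ w₂.2 ⨯₃ w₃.2) := by
  simp only [trivector_apply, wedge21, wedge12, map_add, ← h.left.linearCombination_mul_coWedge,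
    ← h.right.linearCombination_mul_coWedge, ← Morin.linearCombination_mul_linearCombination,
    ← h.left.linearCombination_mul_linearCombination,
    ← h.right.linearCombination_mul_linearCombination]
  set N := Submodule.span R (Set.range (Sum.elim p q))
  have hP : ∀ a : Fin 3 → R, Fintype.linearCombination R p a ∈ N :=
    linearCombination_mem fun i => Submodule.subset_span (Set.mem_range_self (Sum.inl i))
  have hQ : ∀ b : Fin 3 → R, Fintype.linearCombination R q b ∈ N :=
    linearCombination_mem fun i => Submodule.subset_span (Set.mem_range_self (Sum.inr i))
  have hcomm : ∀ {x y z : 𝒜}, x ∈ N → y ∈ N → z ∈ N → x * (y * z) = y * (z * x) :=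
    fun hx hy hz => (commute_mul_of_swap (h.swap_of_mem_span hy hx)
      (h.swap_of_mem_span hz hx)).eq.trans (mul_assoc _ _ _)
  have hBAA := hcomm (hQ w₁.2) (hP w₂.1) (hP w₃.1)
  have hABA := hcomm (hP w₃.1) (hP w₁.1) (hQ w₂.2)
  have hBAB := hcomm (hQ w₁.2) (hP w₂.1) (hQ w₃.2)
  have hBBA := hcomm (hP w₃.1) (hQ w₁.2) (hQ w₂.2)
  simp only [add_mul, mul_add, mul_assoc, hBAA, hABA, hBAB, hBBA]
  abel

theorem mul_coWedge_mul_coWedge_mul (h : IsAnticommuting (Sum.elim p q))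
    (ij kl : Fin 3 × Fin 3) :
    p ij.1 * coWedge q ij.2 * (coWedge p kl.1 * q kl.2) =
      if ij = kl then topWedge p * topWedge q else 0 := by
  have hcomm : Commute (coWedge q ij.2) (coWedge p kl.1) :=
    (h.commute_coWedge _ _).mul_left (h.commute_coWedge _ _)
  rw [hcomm.mul_mul_mul_comm, h.left.mul_coWedge, h.right.coWedge_mul,
    ite_zero_mul_ite_zero]
  simp only [Prod.ext_iff, eq_comm (a := kl.2)]

theorem coWedge_mul_mul_mul_coWedge (h : IsAnticommuting (Sum.elim p q))
    (kl ij : Fin 3 × Fin 3) :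
    coWedge p kl.1 * q kl.2 * (p ij.1 * coWedge q ij.2) =
      if kl = ij then -(topWedge p * topWedge q) else 0 := by
  have hswap : q kl.2 * p ij.1 = -(p ij.1 * q kl.2) := h.mul_swap (.inl _) (.inr _)
  have hreorder : coWedge p kl.1 * q kl.2 * (p ij.1 * coWedge q ij.2) =
      -(coWedge p kl.1 * p ij.1 * (q kl.2 * coWedge q ij.2)) := by
    rw [mul_assoc, ← mul_assoc (q _), hswap, neg_mul, mul_neg]
    simp only [mul_assoc]
  rw [hreorder, h.left.coWedge_mul, h.right.mul_coWedge,
    ite_zero_mul_ite_zero, neg_ite, neg_zero]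
  simp only [Prod.ext_iff, eq_comm (a := ij.1)]

theorem topWedge_mul_topWedge (h : IsAnticommuting (Sum.elim p q)) :
    topWedge q * topWedge p = -(topWedge p * topWedge q) := by
  have hp : topWedge p = p 0 * coWedge p 0 := mul_assoc _ _ _
  have hq : topWedge q = q 0 * coWedge q 0 := mul_assoc _ _ _
  have hcomm : Commute (coWedge q 0) (topWedge p) :=
    ((h.swap.commute_coWedge _ _).mul_left (h.swap.commute_coWedge _ _)).mul_left
      (h.swap.commute_coWedge _ _) |>.symm
  have hswap : q 0 * topWedge p = -(topWedge p * q 0) := by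
    rw [hp, ← mul_assoc, show q 0 * p 0 = -(p 0 * q 0) from h.mul_swap (.inl 0) (.inr 0), neg_mul,
      mul_assoc, (h.commute_coWedge 0 0).eq, mul_assoc]
  rw [hq, mul_assoc, hcomm.eq, ← mul_assoc, hswap, neg_mul, mul_assoc]

theorem trivector_mul_trivector (h : IsAnticommuting (Sum.elim p q)) (s₀ s₀' t₀ t₀' : R)
    (s t s' t' : Fin 3 × Fin 3 → R) :
    trivector R p q (s₀, s, t, t₀) * trivector R p q (s₀', s', t', t₀') =
      (s₀ * t₀' - s ⬝ᵥ t' + t ⬝ᵥ s' - t₀ * s₀') • (topWedge p * topWedge q) := by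
  set P : Submodule R 𝒜 := Submodule.span R (Set.range p)
  set Q : Submodule R 𝒜 := Submodule.span R (Set.range q)
  have hp : ∀ i, p i ∈ P := fun i => Submodule.subset_span ⟨i, rfl⟩
  have hq : ∀ i, q i ∈ Q := fun i => Submodule.subset_span ⟨i, rfl⟩
  have h30 : ∀ c : R, c • topWedge p ∈ P ^ 3 * Q ^ 0 := fun c => by
    rw [pow_zero, mul_one]
    exact Submodule.smul_mem _ _ (topWedge_mem_pow hp)
  have h21 : ∀ s, Fintype.linearCombination R
      (fun kl : Fin 3 × Fin 3 => coWedge p kl.1 * q kl.2) s ∈ P ^ 2 * Q ^ 1 :=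
    linearCombination_mem fun kl =>
      Submodule.mul_mem_mul (coWedge_mem_pow hp _) ((pow_one Q).symm ▸ hq _)
  have h12 : ∀ t, Fintype.linearCombination R
      (fun ij : Fin 3 × Fin 3 => p ij.1 * coWedge q ij.2) t ∈ P ^ 1 * Q ^ 2 :=
    linearCombination_mem fun ij =>
      Submodule.mul_mem_mul ((pow_one P).symm ▸ hp _) (coWedge_mem_pow hq _)
  have h03 : ∀ c : R, c • topWedge q ∈ P ^ 0 * Q ^ 3 := fun c => by
    rw [pow_zero, one_mul]
    exact Submodule.smul_mem _ _ (topWedge_mem_pow hq)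
  simp only [trivector_apply, add_mul, mul_add,
    linearCombination_mul_linearCombination_of_dual h.mul_coWedge_mul_coWedge_mul,
    linearCombination_mul_linearCombination_of_dual h.coWedge_mul_mul_mul_coWedge]
  rw [h.mul_eq_zero_of_mem (by decide) (h30 _) (h30 _),
    h.mul_eq_zero_of_mem (by decide) (h30 _) (h21 _),
    h.mul_eq_zero_of_mem (by decide) (h30 _) (h12 _),
    h.mul_eq_zero_of_mem (by decide) (h21 _) (h30 _),
    h.mul_eq_zero_of_mem (by decide) (h21 _) (h21 _),
    h.mul_eq_zero_of_mem (by decide) (h21 _) (h03 _),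
    h.mul_eq_zero_of_mem (by decide) (h12 _) (h30 _),
    h.mul_eq_zero_of_mem (by decide) (h12 _) (h12 _),
    h.mul_eq_zero_of_mem (by decide) (h12 _) (h03 _),
    h.mul_eq_zero_of_mem (by decide) (h03 _) (h21 _),
    h.mul_eq_zero_of_mem (by decide) (h03 _) (h12 _),
    h.mul_eq_zero_of_mem (by decide) (h03 _) (h03 _)]
  simp only [smul_mul_smul_comm, h.topWedge_mul_topWedge]
  module

theorem trivector_mul_trivector_eq_zero_iff (h : IsAnticommuting (Sum.elim p q))
    (hne : ∀ r : R, r • (topWedge p * topWedge q) = 0 → r = 0) {s₀ s₀' t₀ t₀' : R}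
    {s t s' t' : Fin 3 × Fin 3 → R} :
    trivector R p q (s₀, s, t, t₀) * trivector R p q (s₀', s', t', t₀') = 0 ↔
      s₀ * t₀' - s ⬝ᵥ t' + t ⬝ᵥ s' - t₀ * s₀' = 0 := by
  rw [h.trivector_mul_trivector]
  exact ⟨hne _, fun hzero => by rw [hzero, zero_smul]⟩

theorem trivector_injective (h : IsAnticommuting (Sum.elim p q))
    (hne : ∀ r : R, r • (topWedge p * topWedge q) = 0 → r = 0) :
    Function.Injective (trivector R p q) := by
  rw [injective_iff_map_eq_zero]
  rintro ⟨s₀, s, t, t₀⟩ hzero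
  have hpair : ∀ (s₀' t₀' : R) (s' t' : Fin 3 × Fin 3 → R),
      s₀ * t₀' - s ⬝ᵥ t' + t ⬝ᵥ s' - t₀ * s₀' = 0 := fun s₀' t₀' s' t' =>
    (h.trivector_mul_trivector_eq_zero_iff hne).1 (by rw [hzero, zero_mul])
  have hs₀ : s₀ = 0 := by simpa using hpair 0 1 0 0
  have hs : s = 0 := dotProduct_eq_zero _ fun t' => by simpa using hpair 0 0 0 t'
  have ht : t = 0 := dotProduct_eq_zero _ fun s' => by simpa using hpair 0 0 s' 0
  have ht₀ : t₀ = 0 := by simpa using hpair 1 0 0 0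
  rw [hs₀, hs, ht, ht₀]
  rfl

end IsAnticommuting

theorem map_trivector {ℬ : Type*} [Ring ℬ] [Algebra R ℬ] {S : Type*} [CommRing S] [Algebra R S]
    [Algebra S ℬ] [IsScalarTower R S ℬ] (φ : 𝒜 →ₐ[R] ℬ) (s₀ : R) (s t : Fin 3 × Fin 3 → R)
    (t₀ : R) :
    φ (trivector R p q (s₀, s, t, t₀)) = trivector S (φ ∘ p) (φ ∘ q)
      (algebraMap R S s₀, algebraMap R S ∘ s, algebraMap R S ∘ t, algebraMap R S t₀) := by
  simp only [trivector_apply, Fintype.linearCombination_apply, map_add, map_sum, map_smul, map_mul,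
    topWedge, coWedge, Function.comp_apply, algebraMap_smul]

end Trivectors

section AdaptedBasis

theorem mul_mul_le_iff {R 𝒜 : Type*} [CommSemiring R] [Semiring 𝒜] [Algebra R 𝒜]
    {L M N T : Submodule R 𝒜} :
    L * M * N ≤ T ↔ ∀ x ∈ L, ∀ y ∈ M, ∀ z ∈ N, x * y * z ∈ T := by
  refine ⟨fun h x hx y hy z hz =>
    h (Submodule.mul_mem_mul (Submodule.mul_mem_mul hx hy) hz), fun h => ?_⟩
  refine Submodule.mul_le.2 fun m hm z hz => ?_
  have hLM : L * M ≤ T.comap (LinearMap.mulRight R z) :=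
    Submodule.mul_le.2 fun x hx y hy => h x hx y hy z hz
  exact hLM hm

variable {W : Type v} [AddCommGroup W] [Module ℂ W] {U : Submodule ℂ W}
variable (u : Basis (Fin 3) ℂ U) (e : Basis (Fin 3) ℂ (W ⧸ U))

/-- The basis vectors `uᵢ` of `U`, in the exterior algebra of `W`. -/
def uVec (i : Fin 3) : ExteriorAlgebra ℂ W := ExteriorAlgebra.ι ℂ (u i : W)

/-- The lifts of the basis vectors `eⱼ` of `W / U`, in the exterior algebra of `W`. -/
def eVec (j : Fin 3) : ExteriorAlgebra ℂ W := ExteriorAlgebra.ι ℂ (liftVec e j)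

/-- The basis of `W` formed by the `uᵢ` and the lifts of the `eⱼ`. -/
def adaptedBasis : Basis (Fin 3 ⊕ Fin 3) ℂ W := u.sumQuot e

theorem coe_adaptedBasis :
    ⇑(adaptedBasis u e) = Sum.elim (fun i => (u i : W)) (liftVec e) := by
  ext (i | j)
  · simp [adaptedBasis]
  · simp [adaptedBasis, Basis.sumQuot, liftVec]

theorem ι_comp_adaptedBasis :
    ExteriorAlgebra.ι ℂ ∘ adaptedBasis u e = Sum.elim (uVec u) (eVec e) := by
  rw [coe_adaptedBasis, Sum.comp_elim]
  rfl

theorem isAnticommuting_uVec_eVec : IsAnticommuting (Sum.elim (uVec u) (eVec e)) where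
  mul_self x := by
    rw [← ι_comp_adaptedBasis]
    exact ExteriorAlgebra.ι_sq_zero _
  mul_swap x y := by
    rw [← ι_comp_adaptedBasis]
    exact eq_neg_of_add_eq_zero_left (ExteriorAlgebra.ι_add_mul_swap _ _)

theorem ι_eq_linearCombination (w : W) : ExteriorAlgebra.ι ℂ w =
    Fintype.linearCombination ℂ (uVec u) (fun i => (adaptedBasis u e).repr w (Sum.inl i)) +
      Fintype.linearCombination ℂ (eVec e) fun j => (adaptedBasis u e).repr w (Sum.inr j) := by
  conv_lhs => rw [← (adaptedBasis u e).sum_repr w]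
  have hι : ∀ x, ExteriorAlgebra.ι ℂ (adaptedBasis u e x) = Sum.elim (uVec u) (eVec e) x :=
    congr_fun (ι_comp_adaptedBasis u e)
  simp only [map_add, map_sum, map_smul, Fintype.sum_sum_type, hι, Sum.elim_inl, Sum.elim_inr,
    Fintype.linearCombination_apply]

theorem ι_coe_eq_linearCombination (x : U) :
    ExteriorAlgebra.ι ℂ (x : W) = Fintype.linearCombination ℂ (uVec u) (u.repr x) := by
  conv_lhs => rw [← u.sum_repr x]
  simp only [Submodule.coe_sum, Submodule.coe_smul, map_sum, map_smul, uVec,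
    Fintype.linearCombination_apply]

theorem exteriorPower_three_eq_range :
    ⋀[ℂ]^3 W = LinearMap.range (trivector ℂ (uVec u) (eVec e)) := by
  rw [ExteriorAlgebra.exteriorPower, pow_succ, sq]
  apply le_antisymm
  · refine mul_mul_le_iff.2 ?_
    rintro _ ⟨w₁, rfl⟩ _ ⟨w₂, rfl⟩ _ ⟨w₃, rfl⟩
    simp only [ι_eq_linearCombination u e]
    exact ⟨_, ((isAnticommuting_uVec_eVec u e).mul_mul_eq_trivector (_, _) (_, _) (_, _)).symm⟩
  · have hp : ∀ i, uVec u i ∈ LinearMap.range (ExteriorAlgebra.ι ℂ (M := W)) := fun i => ⟨_, rfl⟩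
    have hq : ∀ j, eVec e j ∈ LinearMap.range (ExteriorAlgebra.ι ℂ (M := W)) := fun j => ⟨_, rfl⟩
    have hprod : ∀ {x y z : ExteriorAlgebra ℂ W}, x ∈ LinearMap.range (ExteriorAlgebra.ι ℂ) →
        y ∈ LinearMap.range (ExteriorAlgebra.ι ℂ) → z ∈ LinearMap.range (ExteriorAlgebra.ι ℂ) →
        x * y * z ∈ LinearMap.range (ExteriorAlgebra.ι ℂ (M := W)) *
          LinearMap.range (ExteriorAlgebra.ι ℂ) * LinearMap.range (ExteriorAlgebra.ι ℂ) :=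
      fun hx hy hz => Submodule.mul_mem_mul (Submodule.mul_mem_mul hx hy) hz
    rintro _ ⟨⟨s₀, s, t, t₀⟩, rfl⟩
    rw [trivector_apply]
    refine add_mem (Submodule.smul_mem _ _ (hprod (hp 0) (hp 1) (hp 2)))
      (add_mem (linearCombination_mem (fun kl => hprod (hp _) (hp _) (hq _)) _)
      (add_mem (linearCombination_mem (fun ij => ?_) _)
      (Submodule.smul_mem _ _ (hprod (hq 0) (hq 1) (hq 2)))))
    rw [coWedge, ← mul_assoc]
    exact hprod (hp _) (hq _) (hq _)

theorem mem_filt_two_iff {x : ExteriorAlgebra ℂ W} :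
    x ∈ filt U 2 ↔ ∃ (s₀ : ℂ) (s : Fin 3 × Fin 3 → ℂ),
      x = trivector ℂ (uVec u) (eVec e) (s₀, s, 0, 0) := by
  have hfilt : filt U 2 = U.map (ExteriorAlgebra.ι ℂ) * U.map (ExteriorAlgebra.ι ℂ) *
      LinearMap.range (ExteriorAlgebra.ι ℂ) := by
    rw [filt, sq, ExteriorAlgebra.exteriorPower, show 3 - 2 = 1 from rfl, pow_one]
  constructor
  · let F := LinearMap.range (trivector ℂ (uVec u) (eVec e) ∘ₗ
      LinearMap.prodMap LinearMap.id (LinearMap.inl ℂ (Fin 3 × Fin 3 → ℂ) _))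
    suffices hle : filt U 2 ≤ F by
      intro hx
      obtain ⟨⟨s₀, s⟩, rfl⟩ := hle hx
      exact ⟨s₀, s, rfl⟩
    rw [hfilt]
    refine mul_mul_le_iff.2 ?_
    rintro _ ⟨x, hx, rfl⟩ _ ⟨y, hy, rfl⟩ _ ⟨z, rfl⟩
    have hι : ∀ v : U, ExteriorAlgebra.ι ℂ (v : W) =
        Fintype.linearCombination ℂ (uVec u) (u.repr v) +
          Fintype.linearCombination ℂ (eVec e) 0 := fun v => by
      rw [map_zero, add_zero, ι_coe_eq_linearCombination u]
    rw [hι ⟨x, hx⟩, hι ⟨y, hy⟩, ι_eq_linearCombination u e z,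
      (isAnticommuting_uVec_eVec u e).mul_mul_eq_trivector (_, 0) (_, 0) (_, _)]
    simp only [wedge12, map_zero, LinearMap.zero_apply, zero_dotProduct, add_zero]
    exact ⟨(_, _), rfl⟩
  · rintro ⟨s₀, s, rfl⟩
    have hp : ∀ i, uVec u i ∈ U.map (ExteriorAlgebra.ι ℂ) := fun i => ⟨u i, (u i).2, rfl⟩
    have hprod : ∀ i j (w : W), uVec u i * uVec u j * ExteriorAlgebra.ι ℂ w ∈ filt U 2 :=
      fun i j w => hfilt ▸ Submodule.mul_mem_mul (Submodule.mul_mem_mul (hp i) (hp j)) ⟨w, rfl⟩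
    rw [trivector_apply, map_zero, zero_smul, add_zero, add_zero]
    exact add_mem (Submodule.smul_mem _ _ (hprod 0 1 _))
      (linearCombination_mem (fun kl => hprod _ _ _) _)

theorem topWedge_mul_topWedge_eq_ιMulti : topWedge (uVec u) * topWedge (eVec e) =
    ExteriorAlgebra.ιMulti ℂ 6 ((adaptedBasis u e).reindex finSumFinEquiv) := by
  have hι : ∀ x : Fin 3 ⊕ Fin 3, ExteriorAlgebra.ι ℂ
      ((adaptedBasis u e).reindex finSumFinEquiv (finSumFinEquiv x)) =
      Sum.elim (uVec u) (eVec e) x := fun x => by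
    rw [Basis.reindex_apply, Equiv.symm_apply_apply]
    exact congr_fun (ι_comp_adaptedBasis u e) x
  have hu : ∀ i, uVec u i = _ := fun i => (hι (Sum.inl i)).symm
  have he : ∀ j, eVec e j = _ := fun j => (hι (Sum.inr j)).symm
  simp only [topWedge, hu, he, ExteriorAlgebra.ιMulti_apply, List.ofFn_succ, List.ofFn_zero,
    List.prod_cons, List.prod_nil, mul_one, mul_assoc]
  rfl

theorem topForm_topWedge_mul_topWedge_ne_zero {vol : W [⋀^Fin 6]→ₗ[ℂ] ℂ} (hvol : vol ≠ 0) :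
    topForm vol (topWedge (uVec u) * topWedge (eVec e)) ≠ 0 := by
  rw [topWedge_mul_topWedge_eq_ιMulti, topForm, ExteriorAlgebra.liftAlternating_apply_ιMulti,
    Pi.single_eq_same]
  exact (AlternatingMap.map_basis_ne_zero_iff _ vol).2 hvol

theorem topWedge_mul_topWedge_ne_zero : topWedge (uVec u) * topWedge (eVec e) ≠ 0 := by
  intro hzero
  have hdet : ((adaptedBasis u e).reindex finSumFinEquiv).det ≠ 0 := Basis.det_ne_zero _
  exact topForm_topWedge_mul_topWedge_ne_zero u e hdet (by rw [hzero, map_zero])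

end AdaptedBasis

section LagrangianGraph

variable {W : Type v} [AddCommGroup W] [Module ℂ W] {U : Submodule ℂ W}
variable (u : Basis (Fin 3) ℂ U) (e : Basis (Fin 3) ℂ (W ⧸ U))
variable (A : Submodule ℂ (ExteriorAlgebra ℂ W))

/-- `A` meets `⋀² U ⊗ W` only in `⋀³ U`. -/
def IsTransversal : Prop :=
  ∀ s, trivector ℂ (uVec u) (eVec e) (0, s, 0, 0) ∈ A → s = 0

/-- `A` is the sum of `⋀³ U` and the graph of the matrix `G`, regarded as a homomorphism
`U ⊗ ⋀² E → ⋀² U ⊗ E` where `E` is the complement of `U` spanned by the lifts of the `eⱼ`. -/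
structure IsGraphOf (G : Matrix (Fin 3 × Fin 3) (Fin 3 × Fin 3) ℂ) : Prop where
  le_exteriorPower : A ≤ ⋀[ℂ]^3 W
  trivector_mem_iff : ∀ s₀ s t t₀,
    trivector ℂ (uVec u) (eVec e) (s₀, s, t, t₀) ∈ A ↔ t₀ = 0 ∧ s = G *ᵥ t

variable {A}

theorem eq_zero_of_smul_topWedge_mul_topWedge (r : ℂ)
    (hr : r • (topWedge (uVec u) * topWedge (eVec e)) = 0) : r = 0 :=
  (smul_eq_zero.1 hr).resolve_right (topWedge_mul_topWedge_ne_zero u e)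

theorem topWedge_uVec_mem (huA : U.map (ExteriorAlgebra.ι ℂ) ^ 3 ≤ A) : topWedge (uVec u) ∈ A :=
  huA (topWedge_mem_pow fun i => ⟨u i, (u i).2, rfl⟩)

theorem topWedge_eq_trivector {R 𝒜 : Type*} [CommRing R] [Ring 𝒜] [Algebra R 𝒜]
    (p q : Fin 3 → 𝒜) : topWedge p = trivector R p q (1, 0, 0, 0) := by
  simp only [trivector_apply, map_zero, zero_smul, one_smul, add_zero]

theorem IsLagrangian.trivector_mem_iff (hA : IsLagrangian A) {s₀ t₀ : ℂ}
    {s t : Fin 3 × Fin 3 → ℂ} : trivector ℂ (uVec u) (eVec e) (s₀, s, t, t₀) ∈ A ↔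
      ∀ s₀' s' t' t₀', trivector ℂ (uVec u) (eVec e) (s₀', s', t', t₀') ∈ A →
        s₀ * t₀' - s ⬝ᵥ t' + t ⬝ᵥ s' - t₀ * s₀' = 0 := by
  have hpair := fun s₀' s' t' t₀' =>
    (isAnticommuting_uVec_eVec u e).trivector_mul_trivector_eq_zero_iff
      (eq_zero_of_smul_topWedge_mul_topWedge u e) (s₀ := s₀) (s := s) (t := t) (t₀ := t₀)
      (s₀' := s₀') (s' := s') (t' := t') (t₀' := t₀')
  have hrange := exteriorPower_three_eq_range u e
  rw [hA.2 _ (hrange ▸ LinearMap.mem_range_self _ _)]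
  constructor
  · exact fun h s₀' s' t' t₀' hmem => (hpair _ _ _ _).1 (h _ hmem)
  · intro h b hb
    obtain ⟨⟨s₀', s', t', t₀'⟩, rfl⟩ := hrange ▸ hA.1 hb
    exact (hpair _ _ _ _).2 (h _ _ _ _ hb)

theorem IsLagrangian.eq_zero_of_trivector_mem (hA : IsLagrangian A)
    (huA : U.map (ExteriorAlgebra.ι ℂ) ^ 3 ≤ A) {s₀ t₀ : ℂ} {s t : Fin 3 × Fin 3 → ℂ}
    (h : trivector ℂ (uVec u) (eVec e) (s₀, s, t, t₀) ∈ A) : t₀ = 0 := by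
  simpa using (hA.trivector_mem_iff u e).1 h 1 0 0 0
    (topWedge_eq_trivector (R := ℂ) (uVec u) (eVec e) ▸ topWedge_uVec_mem u huA)

theorem trivector_mem_iff_of_topWedge_mem {R 𝒜 : Type*} [CommRing R] [Ring 𝒜] [Algebra R 𝒜]
    {p q : Fin 3 → 𝒜} {N : Submodule R 𝒜} (hp : topWedge p ∈ N) {s₀ t₀ : R}
    {s t : Fin 3 × Fin 3 → R} :
    trivector R p q (s₀, s, t, t₀) ∈ N ↔ trivector R p q (0, s, t, t₀) ∈ N := by
  have hsum : trivector R p q (s₀, s, t, t₀) =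
      s₀ • topWedge p + trivector R p q (0, s, t, t₀) := by
    simp only [trivector_apply, zero_smul, zero_add]
  rw [hsum, N.add_mem_iff_right (N.smul_mem _ hp)]

/-- The coordinates `(t, s)` of the elements of `A` in `(U ⊗ ⋀² E) ⊕ (⋀² U ⊗ E)`. -/
def middlePart (A : Submodule ℂ (ExteriorAlgebra ℂ W)) :
    Submodule ℂ ((Fin 3 × Fin 3 → ℂ) × (Fin 3 × Fin 3 → ℂ)) :=
  A.comap (trivector ℂ (uVec u) (eVec e) ∘ₗ LinearMap.inr _ _ _ ∘ₗ
    (LinearMap.snd _ _ _).prod (LinearMap.inl _ _ _ ∘ₗ LinearMap.fst _ _ _))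

theorem mem_middlePart {s t : Fin 3 × Fin 3 → ℂ} :
    (t, s) ∈ middlePart u e A ↔ trivector ℂ (uVec u) (eVec e) (0, s, t, 0) ∈ A :=
  Iff.rfl

theorem IsLagrangian.map_fst_middlePart (hA : IsLagrangian A)
    (huA : U.map (ExteriorAlgebra.ι ℂ) ^ 3 ≤ A) (hT : IsTransversal u e A) :
    (middlePart u e A).map (LinearMap.fst ℂ _ _) = ⊤ := by
  by_contra hlt
  obtain ⟨φ, hφ, hker⟩ := Submodule.exists_le_ker_of_lt_top _ (lt_top_iff_ne_top.2 hlt)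
  obtain ⟨s', rfl⟩ := (dotProductEquiv ℂ _).surjective φ
  refine hφ ((LinearEquiv.map_eq_zero_iff _).2 (hT s' ((hA.trivector_mem_iff u e).2 ?_)))
  intro s₀ s t t₀ hmem
  obtain rfl := hA.eq_zero_of_trivector_mem u e huA hmem
  rw [trivector_mem_iff_of_topWedge_mem (topWedge_uVec_mem u huA)] at hmem
  have horth : s' ⬝ᵥ t = 0 := hker ⟨(t, s), hmem, rfl⟩
  simp [horth]

theorem IsLagrangian.exists_middlePart_eq_graph (hA : IsLagrangian A)
    (huA : U.map (ExteriorAlgebra.ι ℂ) ^ 3 ≤ A) (hT : IsTransversal u e A) :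
    ∃ φ, middlePart u e A = LinearMap.graph φ := by
  refine Submodule.exists_eq_graph ⟨?_, ?_⟩
  · have hinj : Function.Injective (LinearMap.fst ℂ _ _ ∘ₗ (middlePart u e A).subtype) := by
      rw [injective_iff_map_eq_zero]
      rintro ⟨⟨t, s⟩, hmem⟩ rfl
      simp only [hT s hmem]
      rfl
    exact hinj
  · intro t
    obtain ⟨x, hx, rfl⟩ : t ∈ (middlePart u e A).map (LinearMap.fst ℂ _ _) :=
      hA.map_fst_middlePart u e huA hT ▸ Submodule.mem_top
    exact ⟨⟨x, hx⟩, rfl⟩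

theorem IsLagrangian.exists_isGraphOf (hA : IsLagrangian A)
    (huA : U.map (ExteriorAlgebra.ι ℂ) ^ 3 ≤ A) (hT : IsTransversal u e A) :
    ∃ G, IsGraphOf u e A G := by
  obtain ⟨φ, hφ⟩ := hA.exists_middlePart_eq_graph u e huA hT
  have hiff : ∀ s₀ s t, trivector ℂ (uVec u) (eVec e) (s₀, s, t, 0) ∈ A ↔ s = φ t := by
    intro s₀ s t
    rw [trivector_mem_iff_of_topWedge_mem (topWedge_uVec_mem u huA), ← mem_middlePart, hφ,
      LinearMap.mem_graph_iff]
  refine ⟨LinearMap.toMatrix' φ, hA.1, fun s₀ s t t₀ => ?_⟩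
  rw [LinearMap.toMatrix'_mulVec]
  constructor
  · intro hmem
    obtain rfl := hA.eq_zero_of_trivector_mem u e huA hmem
    exact ⟨rfl, (hiff _ _ _).1 hmem⟩
  · rintro ⟨rfl, hs⟩
    exact (hiff _ _ _).2 hs

variable {u e} {G : Matrix (Fin 3 × Fin 3) (Fin 3 × Fin 3) ℂ}

theorem IsGraphOf.isSymm (hG : IsGraphOf u e A G) (hA : IsLagrangian A) : G.IsSymm := by
  have hmem : ∀ t, trivector ℂ (uVec u) (eVec e) (0, G *ᵥ t, t, 0) ∈ A := fun t =>
    (hG.trivector_mem_iff _ _ _ _).2 ⟨rfl, rfl⟩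
  have hpair : ∀ t t', (G *ᵥ t) ⬝ᵥ t' = t ⬝ᵥ G *ᵥ t' := fun t t' => by
    have := (hA.trivector_mem_iff u e).1 (hmem t) _ _ _ _ (hmem t')
    linear_combination -this
  refine Matrix.ext fun i j => ?_
  simpa using (hpair (Pi.single j 1) (Pi.single i 1)).symm

end LagrangianGraph

section BiquadraticForm

/-- The biquadratic form `κ z G z`, where `zᵢⱼ = xᵢ yⱼ`. -/
def biquadratic (κ : ℂ) (G : Matrix (Fin 3 × Fin 3) (Fin 3 × Fin 3) ℂ) :
    MvPolynomial (Fin 3 ⊕ Fin 3) ℂ :=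
  let z := segre (fun i => MvPolynomial.X (Sum.inl i)) fun j => MvPolynomial.X (Sum.inr j)
  MvPolynomial.C κ * (z ⬝ᵥ G.map MvPolynomial.C *ᵥ z)

theorem biquadratic_eq_sum (κ : ℂ) (G : Matrix (Fin 3 × Fin 3) (Fin 3 × Fin 3) ℂ) :
    biquadratic κ G = ∑ i, ∑ j, ∑ k, ∑ l, MvPolynomial.C (κ * G (i, j) (k, l)) *
      (MvPolynomial.X (Sum.inl i) * MvPolynomial.X (Sum.inr j) *
        (MvPolynomial.X (Sum.inl k) * MvPolynomial.X (Sum.inr l))) := by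
  simp only [biquadratic, Matrix.mulVec, dotProduct, Fintype.sum_prod_type, Finset.mul_sum,
    segre_apply, Matrix.map_apply, map_mul]
  refine Finset.sum_congr rfl fun i _ => Finset.sum_congr rfl fun j _ =>
    Finset.sum_congr rfl fun k _ => Finset.sum_congr rfl fun l _ => ?_
  ring

variable {W : Type v} [AddCommGroup W] [Module ℂ W] {U : Submodule ℂ W}
variable {u : Basis (Fin 3) ℂ U} {e : Basis (Fin 3) ℂ (W ⧸ U)}
variable {A : Submodule ℂ (ExteriorAlgebra ℂ W)} {G : Matrix (Fin 3 × Fin 3) (Fin 3 × Fin 3) ℂ}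

variable (u e) in
theorem segreVec_eq_trivector (i j : Fin 3) :
    segreVec u e i j = trivector ℂ (uVec u) (eVec e) (0, 0, Pi.single (i, j) 1, 0) := by
  rw [trivector_apply, Fintype.linearCombination_apply_single, map_zero]
  simp only [zero_smul, one_smul, zero_add, add_zero]
  exact mul_assoc _ _ _

theorem IsGraphOf.segreLift_eq_trivector (hG : IsGraphOf u e A G) (i j : Fin 3) :
    ∃ c, segreLift u e A i j = trivector ℂ (uVec u) (eVec e)
      (c, G *ᵥ Pi.single (i, j) 1, Pi.single (i, j) 1, 0) := by
  have hex : ∃ a, a ∈ A ∧ a - segreVec u e i j ∈ filt U 2 := by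
    refine ⟨trivector ℂ (uVec u) (eVec e) (0, G *ᵥ Pi.single (i, j) 1, Pi.single (i, j) 1, 0),
      (hG.trivector_mem_iff _ _ _ _).2 ⟨rfl, rfl⟩,
      (mem_filt_two_iff u e).2 ⟨0, G *ᵥ Pi.single (i, j) 1, ?_⟩⟩
    rw [segreVec_eq_trivector, ← map_sub, Prod.mk_sub_mk, Prod.mk_sub_mk, Prod.mk_sub_mk,
      sub_self, sub_self, sub_zero]
  obtain ⟨hmem, hdiff⟩ : segreLift u e A i j ∈ A ∧
      segreLift u e A i j - segreVec u e i j ∈ filt U 2 :=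
    Classical.epsilon_spec hex
  obtain ⟨c, s, hs⟩ := (mem_filt_two_iff u e).1 hdiff
  rw [sub_eq_iff_eq_add, segreVec_eq_trivector, ← map_add, Prod.mk_add_mk, Prod.mk_add_mk,
    Prod.mk_add_mk, add_zero, add_zero, zero_add, zero_add] at hs
  obtain ⟨-, rfl⟩ := (hG.trivector_mem_iff _ _ _ _).1 (hs ▸ hmem)
  exact ⟨c, hs⟩

theorem IsGraphOf.verraForm_eq_biquadratic (hG : IsGraphOf u e A G) (vol : W [⋀^Fin 6]→ₗ[ℂ] ℂ) :
    verraForm u e A vol = biquadratic (topForm vol (topWedge (uVec u) * topWedge (eVec e))) G := by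
  rw [biquadratic_eq_sum, verraForm]
  refine Finset.sum_congr rfl fun i _ => Finset.sum_congr rfl fun j _ =>
    Finset.sum_congr rfl fun k _ => Finset.sum_congr rfl fun l _ => ?_
  obtain ⟨c, hc⟩ := hG.segreLift_eq_trivector k l
  rw [hc, segreVec_eq_trivector, (isAnticommuting_uVec_eVec u e).trivector_mul_trivector, map_smul]
  simp only [mul_zero, zero_dotProduct, sub_zero, zero_add, single_one_dotProduct,
    Matrix.mulVec_single_one, Matrix.col_apply, smul_eq_mul, mul_comm]

theorem isBihomogeneous_biquadratic (κ : ℂ) (G : Matrix (Fin 3 × Fin 3) (Fin 3 × Fin 3) ℂ) :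
    IsBihomogeneous (biquadratic κ G) (2, 2) := by
  rw [biquadratic_eq_sum]
  refine .sum _ _ _ fun i _ => .sum _ _ _ fun j _ => .sum _ _ _ fun k _ => .sum _ _ _ fun l _ => ?_
  have hX := MvPolynomial.isWeightedHomogeneous_X ℂ
    (Sum.elim (fun _ : Fin 3 => ((1, 0) : ℕ × ℕ)) fun _ : Fin 3 => (0, 1))
  exact (MvPolynomial.isWeightedHomogeneous_C _ _).mul
    (((hX (.inl i)).mul (hX (.inr j))).mul ((hX (.inl k)).mul (hX (.inr l))))

end BiquadraticForm

section Contraction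

variable {S : Type*} [CommRing S]

/-- The contraction of `G` with the tensor `x ⊗ y`, as a `3 × 3` matrix. -/
def contr (G : Matrix (Fin 3 × Fin 3) (Fin 3 × Fin 3) S) (x y : Fin 3 → S) :
    Matrix (Fin 3) (Fin 3) S :=
  Matrix.of fun k l => (G *ᵥ segre x y) (k, l)

theorem segre_dotProduct_mulVec_segre (G : Matrix (Fin 3 × Fin 3) (Fin 3 × Fin 3) S)
    (a b x y : Fin 3 → S) :
    segre a b ⬝ᵥ G *ᵥ segre x y = a ⬝ᵥ contr G x y *ᵥ b := by
  rw [contr]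
  generalize G *ᵥ segre x y = T
  simp only [dotProduct, Matrix.mulVec, Matrix.of_apply, segre_apply, Fintype.sum_prod_type,
    Finset.mul_sum, mul_assoc, mul_comm (b _)]

/-- Both contractions of `contr G x y` vanish: for symmetric `G`, the point `(x, y)` is singular on
the hypersurface given by the biquadratic form of `G`. -/
structure IsSingularAt (G : Matrix (Fin 3 × Fin 3) (Fin 3 × Fin 3) S) (x y : Fin 3 → S) : Prop where
  vecMul_eq_zero : x ᵥ* contr G x y = 0
  mulVec_eq_zero : contr G x y *ᵥ y = 0

theorem contr_smul_smul (G : Matrix (Fin 3 × Fin 3) (Fin 3 × Fin 3) S) (r s : S)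
    (x y : Fin 3 → S) : contr G (r • x) (s • y) = (r * s) • contr G x y := by
  ext k l
  simp only [contr, map_smul, LinearMap.smul_apply, Matrix.mulVec_smul, smul_smul, mul_comm s,
    Matrix.of_apply, Matrix.smul_apply, Pi.smul_apply]

end Contraction

section SingularPoints

open MvPolynomial

variable {S : Type} [CommRing S]

theorem addEps_eq_zero_iff {a b : S} : addEps a b = 0 ↔ a = 0 ∧ b = 0 := by
  simp [addEps, TrivSqZeroExt.ext_iff]

theorem addEps_mul (a b c d : S) : addEps a b * addEps c d = addEps (a * c) (a * d + b * c) := by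
  ext <;> simp [addEps, mul_comm b c]

theorem sum_addEps {ι : Type*} (s : Finset ι) (a b : ι → S) :
    ∑ i ∈ s, addEps (a i) (b i) = addEps (∑ i ∈ s, a i) (∑ i ∈ s, b i) := by
  simp only [addEps, Finset.sum_add_distrib, TrivSqZeroExt.inl_sum, TrivSqZeroExt.inr_sum]

theorem segre_addEps {m n : Type*} (x v : m → S) (y w : n → S) :
    segre (fun i => addEps (x i) (v i)) (fun j => addEps (y j) (w j)) =
      fun ij => addEps (segre x y ij) ((segre x w + segre v y) ij) :=
  funext fun _ => addEps_mul _ _ _ _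

theorem addEps_dotProduct_addEps {n : Type*} [Fintype n] (a b c d : n → S) :
    (fun i => addEps (a i) (b i)) ⬝ᵥ (fun i => addEps (c i) (d i)) =
      addEps (a ⬝ᵥ c) (a ⬝ᵥ d + b ⬝ᵥ c) := by
  simp only [dotProduct, addEps_mul, sum_addEps, Finset.sum_add_distrib]

theorem map_algebraMap_mulVec_addEps {m n : Type*} [Fintype n] (M : Matrix m n S) (z z' : n → S) :
    M.map (algebraMap S (DualNumber S)) *ᵥ (fun j => addEps (z j) (z' j)) =
      fun i => addEps ((M *ᵥ z) i) ((M *ᵥ z') i) := by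
  funext i
  have hrow : M.map (algebraMap S (DualNumber S)) i = fun j => addEps (M i j) 0 := by
    ext j <;> simp [addEps, TrivSqZeroExt.algebraMap_eq_inl]
  rw [Matrix.mulVec, hrow, addEps_dotProduct_addEps, ← Pi.zero_def, zero_dotProduct, add_zero]
  rfl

theorem addEps_dotProduct_mulVec_addEps {n : Type*} [Fintype n] {M : Matrix n n S} (hM : M.IsSymm)
    (z z' : n → S) : (fun i => addEps (z i) (z' i)) ⬝ᵥ
        M.map (algebraMap S (DualNumber S)) *ᵥ (fun i => addEps (z i) (z' i)) =
      addEps (z ⬝ᵥ M *ᵥ z) (2 * z' ⬝ᵥ M *ᵥ z) := by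
  have hswap : z ⬝ᵥ M *ᵥ z' = z' ⬝ᵥ M *ᵥ z := by
    rw [Matrix.dotProduct_mulVec, ← Matrix.mulVec_transpose, hM.eq, dotProduct_comm]
  rw [map_algebraMap_mulVec_addEps, addEps_dotProduct_addEps, hswap, two_mul]

variable [Algebra ℂ S]

theorem aeval_biquadratic (κ : ℂ) (G : Matrix (Fin 3 × Fin 3) (Fin 3 × Fin 3) ℂ)
    (x y : Fin 3 → S) : aeval (Sum.elim x y) (biquadratic κ G) =
      κ • (segre x y ⬝ᵥ G.map (algebraMap ℂ S) *ᵥ segre x y) := by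
  simp only [biquadratic, dotProduct, Matrix.mulVec, segre_apply, Matrix.map_apply, map_mul,
    map_sum, aeval_C, aeval_X, Sum.elim_inl, Sum.elim_inr, Algebra.smul_def]

theorem aeval_addEps_biquadratic {κ : ℂ} {G : Matrix (Fin 3 × Fin 3) (Fin 3 × Fin 3) ℂ}
    (hG : G.IsSymm) (x y v w : Fin 3 → S) :
    aeval (Sum.elim (fun i => addEps (x i) (v i)) fun j => addEps (y j) (w j))
        (biquadratic κ G) =
      κ • addEps (x ⬝ᵥ contr (G.map (algebraMap ℂ S)) x y *ᵥ y)
        (2 * (x ⬝ᵥ contr (G.map (algebraMap ℂ S)) x y *ᵥ w +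
          v ⬝ᵥ contr (G.map (algebraMap ℂ S)) x y *ᵥ y)) := by
  have hmap : G.map (algebraMap ℂ (DualNumber S)) =
      (G.map (algebraMap ℂ S)).map (algebraMap S (DualNumber S)) := by
    rw [Matrix.map_map, ← RingHom.coe_comp, ← IsScalarTower.algebraMap_eq]
  rw [aeval_biquadratic, segre_addEps, hmap, addEps_dotProduct_mulVec_addEps (hG.map _),
    add_dotProduct]
  simp only [segre_dotProduct_mulVec_segre]

theorem isSingularAt_iff_forall_aeval_addEps {κ : ℂ} (hκ : κ ≠ 0)
    {G : Matrix (Fin 3 × Fin 3) (Fin 3 × Fin 3) ℂ} (hG : G.IsSymm) (x y : Fin 3 → S) :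
    IsSingularAt (G.map (algebraMap ℂ S)) x y ↔ ∀ v w : Fin 3 → S,
      aeval (Sum.elim (fun i => addEps (x i) (v i)) fun j => addEps (y j) (w j))
        (biquadratic κ G) = 0 := by
  have htwo : ∀ s : S, 2 * s = 0 ↔ s = 0 := fun s => by
    simpa only [Algebra.smul_def, map_ofNat] using
      smul_eq_zero_iff_right (M := S) (two_ne_zero' ℂ) (m := s)
  simp only [aeval_addEps_biquadratic hG, smul_eq_zero_iff_right hκ, addEps_eq_zero_iff, htwo,
    Matrix.dotProduct_mulVec x]
  constructor
  · rintro ⟨hx, hy⟩ v w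
    simp only [hx, hy, zero_dotProduct, dotProduct_zero, add_zero, and_self]
  · intro h
    exact ⟨dotProduct_eq_zero _ fun w => by simpa using (h 0 w).2,
      dotProduct_eq_zero _ fun v => by simpa [dotProduct_comm] using (h v 0).2⟩

theorem isHomogeneous_biquadratic (κ : ℂ) (G : Matrix (Fin 3 × Fin 3) (Fin 3 × Fin 3) ℂ) :
    (biquadratic κ G).IsHomogeneous 4 := by
  rw [biquadratic_eq_sum]
  refine .sum _ _ _ fun i _ => .sum _ _ _ fun j _ => .sum _ _ _ fun k _ => .sum _ _ _ fun l _ => ?_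
  have hX := isHomogeneous_X (σ := Fin 3 ⊕ Fin 3) ℂ
  exact (isHomogeneous_C _ _).mul (((hX _).mul (hX _)).mul ((hX _).mul (hX _)))

end SingularPoints

section Jacobian

open MvPolynomial

variable {S : Type} [CommRing S] [Algebra ℂ S] {σ : Type*} [Fintype σ]

theorem aeval_addEps (f : MvPolynomial σ ℂ) (z v : σ → S) :
    aeval (fun i => addEps (z i) (v i)) f =
      addEps (aeval z f) (v ⬝ᵥ fun i => aeval z (pderiv i f)) := by
  classical
  induction f using MvPolynomial.induction_on with
  | C c => simp [addEps, TrivSqZeroExt.algebraMap_eq_inl', dotProduct]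
  | add p q hp hq =>
    rw [map_add, hp, hq]
    ext <;> simp [addEps, dotProduct, mul_add, Finset.sum_add_distrib]
  | mul_X p k hp =>
    have hleibniz : (fun i => aeval z (pderiv i (p * X k))) =
        Pi.single k (aeval z p) + z k • fun i => aeval z (pderiv i p) := by
      funext i
      obtain rfl | hik := eq_or_ne i k
      · simp
      · simp [pderiv_X_of_ne hik.symm, hik]
    rw [map_mul, hp, aeval_X, addEps_mul, hleibniz, dotProduct_add, dotProduct_smul,
      dotProduct_single, map_mul, aeval_X, smul_eq_mul]
    congr 1
    ring

omit [Fintype σ] in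
theorem forall_aeval_addEps_eq_zero_iff [Finite σ] {f : MvPolynomial σ ℂ} {n : ℕ}
    (hf : f.IsHomogeneous n) (hn : n ≠ 0) (z : σ → S) :
    (∀ v : σ → S, aeval (fun i => addEps (z i) (v i)) f = 0) ↔
      ∀ k, aeval z (pderiv k f) = 0 := by
  have := Fintype.ofFinite σ
  simp only [aeval_addEps, addEps_eq_zero_iff]
  constructor
  · exact fun h => congr_fun (dotProduct_eq_zero _ fun v => by rw [dotProduct_comm, (h v).2])
  · intro h v
    have heuler : n • aeval z f = 0 := by
      rw [← map_nsmul, ← hf.sum_X_mul_pderiv]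
      simp only [map_sum, map_mul, h, mul_zero, Finset.sum_const_zero]
    rw [← Nat.cast_smul_eq_nsmul ℂ, smul_eq_zero_iff_right (Nat.cast_ne_zero.2 hn)] at heuler
    simp only [heuler, h, true_and]
    exact dotProduct_zero v

variable {W : Type v} [AddCommGroup W] [Module ℂ W] {U : Submodule ℂ W}
variable (u : Basis (Fin 3) ℂ U) (e : Basis (Fin 3) ℂ (W ⧸ U))

theorem singScheme_eq_zeroScheme {f : MvPolynomial (Fin 3 ⊕ Fin 3) ℂ} {n : ℕ}
    (hf : f.IsHomogeneous n) (hn : n ≠ 0) :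
    singScheme u e f = zeroScheme u e (Set.range fun k => pderiv k f) := by
  have jacobian {T : Type} [CommRing T] [Algebra ℂ T] (x y : Fin 3 → T) :
      (∀ v w : Fin 3 → T,
        aeval (Sum.elim (fun i => addEps (x i) (v i)) fun j => addEps (y j) (w j)) f = 0) ↔
        ∀ g ∈ Set.range (fun k => pderiv k f), aeval (Sum.elim x y) g = 0 := by
    rw [Set.forall_mem_range, ← forall_aeval_addEps_eq_zero_iff hf hn]
    have helim (v w : Fin 3 → T) :
        (Sum.elim (fun i => addEps (x i) (v i)) fun j => addEps (y j) (w j)) =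
          fun k => addEps (Sum.elim x y k) (Sum.elim v w k) :=
      funext <| Sum.rec (fun _ => rfl) fun _ => rfl
    simp only [helim]
    exact ⟨fun h v => by simpa only [Sum.elim_comp_inl_inr] using h (v ∘ Sum.inl) (v ∘ Sum.inr),
      fun h v w => h (Sum.elim v w)⟩
  ext R p
  exact forall₅_congr fun _ _ x y _ => jacobian x y

end Jacobian

section QuotientRank

variable {R : Type*} [CommRing R] {M : Type*} [AddCommGroup M] [Module R M]

theorem grassmannian_eq_of_le {k : ℕ} {N N' : Grassmannian R M k}
    (h : N.toSubmodule ≤ N'.toSubmodule) : N = N' := by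
  have hbij : Function.Bijective (Submodule.factor h) :=
    bijective_of_surjective_of_rankAtStalk_eq (Submodule.factor_surjective h) fun m _ => by
      rw [N.rankAtStalk_eq, N'.rankAtStalk_eq]
  refine Grassmannian.ext (h.antisymm fun x hx => ?_)
  rw [← Submodule.Quotient.mk_eq_zero] at hx ⊢
  exact hbij.1 (by rwa [map_zero])

/-- `M / L` is an extension of `Q / π L` by `P / i⁻¹ L`, which splits as `Q / π L` is projective. -/
theorem exists_quotient_equiv_prod {P Q : Type*} [AddCommGroup P] [Module R P] [AddCommGroup Q]
    [Module R Q] {i : P →ₗ[R] M} {π : M →ₗ[R] Q} (hπ : Function.Surjective π)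
    (hex : Function.Exact i π) (L : Submodule R M) [Module.Projective R (Q ⧸ L.map π)] :
    Nonempty ((M ⧸ L) ≃ₗ[R] (P ⧸ L.comap i) × (Q ⧸ L.map π)) := by
  let f := (L.comap i).mapQ L i le_rfl
  let g := L.mapQ (L.map π) π (Submodule.le_comap_map _ _)
  have hf : Function.Injective f := by
    rw [← LinearMap.ker_eq_bot, Submodule.ker_mapQ, Submodule.mkQ_map_self]
  have hg : Function.Surjective g := by
    rw [← LinearMap.range_eq_top, Submodule.range_mapQ, LinearMap.range_eq_top.2 hπ,
      Submodule.map_top, Submodule.range_mkQ]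
  have hfg : Function.Exact f g := by
    rw [LinearMap.exact_iff, Submodule.ker_mapQ, Submodule.range_mapQ, Submodule.comap_map_eq,
      Submodule.map_sup, Submodule.mkQ_map_self, bot_sup_eq, hex.linearMap_ker_eq]
  obtain ⟨s, hs⟩ := g.exists_rightInverse_of_surjective (LinearMap.range_eq_top.2 hg)
  exact ⟨(hfg.splitSurjectiveEquiv hf ⟨s, hs⟩).1⟩

theorem exists_isCompl_of_projective_quotient (N : Submodule R M) [Module.Projective R (M ⧸ N)] :
    ∃ C, IsCompl N C := by
  obtain ⟨g, hg⟩ := N.mkQ.exists_rightInverse_of_surjective N.range_mkQ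
  have hproj : LinearMap.IsProj N (LinearMap.id - g ∘ₗ N.mkQ) :=
    { map_mem := fun x => by
        rw [LinearMap.sub_apply, LinearMap.id_apply, ← neg_sub, neg_mem_iff,
          ← Submodule.Quotient.eq]
        exact LinearMap.congr_fun hg (N.mkQ x)
      map_id := fun x hx => by
        rw [LinearMap.sub_apply, LinearMap.comp_apply, Submodule.mkQ_apply,
          (Submodule.Quotient.mk_eq_zero N).2 hx, map_zero, sub_zero, LinearMap.id_apply] }
  exact ⟨_, hproj.isCompl⟩

theorem projective_of_span_eq_top {F P : Type*} [AddCommGroup F] [Module R F]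
    [Module.Projective R F] [AddCommGroup P] [Module R P] (π : F →ₗ[R] P) {s : Set R}
    (hs : Ideal.span s = ⊤) (h : ∀ r ∈ s, ∃ σ : P →ₗ[R] F, π ∘ₗ σ = r • LinearMap.id) :
    Module.Projective R P := by
  obtain ⟨σ, hσ⟩ : LinearMap.id ∈ LinearMap.range (LinearMap.compRight R π (M := P)) :=
    Submodule.mem_of_span_top_of_smul_mem _ s hs _ fun r => h r r.2
  exact .of_split σ π hσ

theorem bijective_of_comp_eq_smul {N : Type*} [AddCommGroup N] [Module R N] {r : R}
    (hr : IsUnit r) {f : M →ₗ[R] N} {g : N →ₗ[R] M} (hgf : g ∘ₗ f = r • LinearMap.id)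
    (hfg : f ∘ₗ g = r • LinearMap.id) : Function.Bijective f := by
  obtain ⟨u, rfl⟩ := hr
  refine ⟨.of_comp (f := g) ?_, .of_comp (g := g) ?_⟩
  · rw [← LinearMap.coe_comp, hgf]
    exact (LinearEquiv.smulOfUnit u).injective
  · rw [← LinearMap.coe_comp, hfg]
    exact (LinearEquiv.smulOfUnit u).surjective

theorem rankAtStalk_eq_of_comp_eq_smul {N : Type*} [AddCommGroup N] [Module R N]
    {p : PrimeSpectrum R} {r : R} (hr : r ∉ p.asIdeal) {f : M →ₗ[R] N} {g : N →ₗ[R] M}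
    (hgf : g ∘ₗ f = r • LinearMap.id) (hfg : f ∘ₗ g = r • LinearMap.id) :
    rankAtStalk (R := R) M p = rankAtStalk (R := R) N p := by
  let S := Localization.AtPrime p.asIdeal
  have hunit : IsUnit (algebraMap R S r) :=
    IsLocalization.map_units S (⟨r, hr⟩ : p.asIdeal.primeCompl)
  have hbij : Function.Bijective (f.baseChange S) := by
    refine bijective_of_comp_eq_smul hunit (g := g.baseChange S) ?_ ?_
    · rw [← LinearMap.baseChange_comp, hgf, LinearMap.baseChange_smul, LinearMap.baseChange_id,
        algebraMap_smul]
    · rw [← LinearMap.baseChange_comp, hfg, LinearMap.baseChange_smul, LinearMap.baseChange_id,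
        algebraMap_smul]
  rw [rankAtStalk_eq_finrank_tensorProduct, rankAtStalk_eq_finrank_tensorProduct]
  exact (LinearEquiv.ofBijective _ hbij).finrank_eq

end QuotientRank

section LinesAndPlanes

variable {R : Type*} [CommRing R]

/-- A rank one direct summand of `R³`. -/
structure IsLine (ℓ : Submodule R (Fin 3 → R)) : Prop where
  cross_eq_zero : ∀ a ∈ ℓ, ∀ b ∈ ℓ, a ⨯₃ b = 0
  span_eq_top : Ideal.span {r | ∃ a ∈ ℓ, ∃ i, r = a i} = ⊤

/-- A rank two direct summand of `R³`. -/
structure IsPlane (H : Submodule R (Fin 3 → R)) : Prop where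
  triple_product_eq_zero : ∀ a ∈ H, ∀ b ∈ H, ∀ c ∈ H, a ⬝ᵥ b ⨯₃ c = 0
  span_eq_top : Ideal.span {r | ∃ a ∈ H, ∃ b ∈ H, ∃ i, r = (a ⨯₃ b) i} = ⊤

theorem exists_span_singleton_of_isLocalRing [IsLocalRing R] (N : Submodule R (Fin 3 → R))
    [Module.Projective R ((Fin 3 → R) ⧸ N)]
    (hN : ∀ p, rankAtStalk (R := R) ((Fin 3 → R) ⧸ N) p = 2) :
    ∃ x ξ : Fin 3 → R, x ⬝ᵥ ξ = 1 ∧ N = Submodule.span R {x} := by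
  obtain ⟨C, hC⟩ := exists_isCompl_of_projective_quotient N
  let π := N.projectionOnto C hC
  have : Module.Finite R N := .of_surjective π (Submodule.projectionOnto_surjective hC)
  have : Module.Projective R N := .of_split N.subtype π (Submodule.projectionOnto_comp_subtype hC)
  have : Module.Free R N := free_of_flat_of_isLocalRing
  have : Module.Free R ((Fin 3 → R) ⧸ N) := free_of_flat_of_isLocalRing
  have hrank : finrank R N = 1 := by
    have hquot := hN (IsLocalRing.closedPoint R)
    rw [rankAtStalk_eq_finrank_of_free] at hquot
    have hsum := (N.prodEquivOfIsCompl C hC).finrank_eq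
    have hC' := N.quotientEquivOfIsCompl C hC
    have : Module.Free R C := .of_equiv hC'
    have : Module.Finite R C := .equiv hC'
    rw [finrank_prod, ← hC'.finrank_eq, finrank_fin_fun] at hsum
    simp only [Pi.natCast_apply, Nat.cast_id] at hquot
    lia
  let b : Basis (Fin 1) R N := Module.finBasisOfFinrankEq R N hrank
  obtain ⟨ξ, hξ⟩ := (dotProductEquiv R (Fin 3)).surjective (b.coord 0 ∘ₗ π)
  have hξ' (v : Fin 3 → R) : ξ ⬝ᵥ v = b.repr (π v) 0 := LinearMap.congr_fun hξ v
  refine ⟨b 0, ξ, ?_, le_antisymm (fun n hn => ?_) ?_⟩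
  · rw [dotProduct_comm, hξ', Submodule.projectionOnto_apply_left, b.repr_self,
      Finsupp.single_eq_same]
  · refine Submodule.mem_span_singleton.2 ⟨b.repr ⟨n, hn⟩ 0, ?_⟩
    have hsum := congrArg Subtype.val (b.sum_repr ⟨n, hn⟩)
    rwa [Fin.sum_univ_one] at hsum
  · exact (Submodule.span_singleton_le_iff_mem _ _).2 (b 0).2

theorem exists_equation_of_isLocalRing [IsLocalRing R] (N : Submodule R (Fin 3 → R))
    [Module.Projective R ((Fin 3 → R) ⧸ N)]
    (hN : ∀ p, rankAtStalk (R := R) ((Fin 3 → R) ⧸ N) p = 1) :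
    ∃ y η : Fin 3 → R, y ⬝ᵥ η = 1 ∧ ∀ v, v ∈ N ↔ v ⬝ᵥ y = 0 := by
  have : Module.Free R ((Fin 3 → R) ⧸ N) := free_of_flat_of_isLocalRing
  have hrank : finrank R ((Fin 3 → R) ⧸ N) = 1 := by
    have hquot := hN (IsLocalRing.closedPoint R)
    rwa [rankAtStalk_eq_finrank_of_free] at hquot
  let b : Basis (Fin 1) R _ := Module.finBasisOfFinrankEq R ((Fin 3 → R) ⧸ N) hrank
  obtain ⟨y, hy⟩ := (dotProductEquiv R (Fin 3)).surjective (b.coord 0 ∘ₗ N.mkQ)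
  obtain ⟨η, hη⟩ := N.mkQ_surjective (b 0)
  have hy' (v : Fin 3 → R) : y ⬝ᵥ v = b.repr (N.mkQ v) 0 := LinearMap.congr_fun hy v
  refine ⟨y, η, ?_, fun v => ?_⟩
  · rw [hy', hη, b.repr_self, Finsupp.single_eq_same]
  · rw [← Submodule.Quotient.mk_eq_zero, ← Submodule.mkQ_apply, dotProduct_comm, hy',
      ← b.repr.map_eq_zero_iff, Finsupp.ext_iff, Fin.forall_fin_one]
    rfl

theorem cross_apply_smul (a b v : Fin 3 → R) (i : Fin 3) :
    (a ⨯₃ b) i • v = (a ⨯₃ b ⬝ᵥ v) • Pi.single i 1 + (v ⨯₃ b) i • a + (a ⨯₃ v) i • b := by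
  have hcross := cross_cross_eq_smul_sub_smul' (a ⨯₃ b) v (Pi.single i 1)
  rw [cross_cross_eq_smul_sub_smul, triple_product_permutation a, triple_product_permutation v,
    triple_product_permutation b, triple_product_permutation v,
    dotProduct_comm v] at hcross
  rw [← cross_anticomm b v]
  simp only [dotProduct_single_one, single_one_dotProduct, Pi.neg_apply, neg_smul] at hcross ⊢
  rw [eq_sub_iff_add_eq] at hcross
  rw [← hcross]
  abel

namespace IsPlane

variable {H : Submodule R (Fin 3 → R)} (h : IsPlane H)
include h

theorem cross_dotProduct_eq_zero {a b v : Fin 3 → R} (ha : a ∈ H) (hb : b ∈ H) (hv : v ∈ H) :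
    a ⨯₃ b ⬝ᵥ v = 0 := by
  rw [dotProduct_comm, h.triple_product_eq_zero v hv a ha b hb]

theorem exists_comp_eq_smul {a b : Fin 3 → R} (ha : a ∈ H) (hb : b ∈ H) (i : Fin 3) :
    ∃ φ : ((Fin 3 → R) ⧸ H) →ₗ[R] R,
      φ ∘ₗ LinearMap.toSpanSingleton R _ (H.mkQ (Pi.single i 1)) = (a ⨯₃ b) i • LinearMap.id ∧
      LinearMap.toSpanSingleton R _ (H.mkQ (Pi.single i 1)) ∘ₗ φ =
        (a ⨯₃ b) i • LinearMap.id := by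
  refine ⟨H.liftQ (dotProductEquiv R _ (a ⨯₃ b)) fun v hv =>
    h.cross_dotProduct_eq_zero ha hb hv, ?_, ?_⟩
  · ext
    change a ⨯₃ b ⬝ᵥ (1 : R) • Pi.single i 1 = (a ⨯₃ b) i * 1
    rw [one_smul, dotProduct_single_one, mul_one]
  · refine Submodule.linearMap_qext _ (LinearMap.ext fun v => ?_)
    refine ((Submodule.Quotient.eq H).2 ?_).symm
    change (a ⨯₃ b) i • v - (a ⨯₃ b ⬝ᵥ v) • Pi.single i 1 ∈ H
    rw [cross_apply_smul, add_assoc, add_sub_cancel_left]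
    exact add_mem (H.smul_mem _ ha) (H.smul_mem _ hb)

theorem projective : Module.Projective R ((Fin 3 → R) ⧸ H) := by
  refine projective_of_span_eq_top H.mkQ h.span_eq_top ?_
  rintro _ ⟨a, ha, b, hb, i, rfl⟩
  obtain ⟨φ, -, hφ⟩ := h.exists_comp_eq_smul ha hb i
  refine ⟨LinearMap.toSpanSingleton R _ (Pi.single i 1) ∘ₗ φ, ?_⟩
  rw [← LinearMap.comp_assoc, LinearMap.comp_toSpanSingleton, hφ]

theorem rankAtStalk_eq (p : PrimeSpectrum R) :
    rankAtStalk (R := R) ((Fin 3 → R) ⧸ H) p = 1 := by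
  obtain ⟨_, ⟨a, ha, b, hb, i, rfl⟩, hi⟩ :
      ∃ r ∈ {r | ∃ a ∈ H, ∃ b ∈ H, ∃ i, r = (a ⨯₃ b) i}, r ∉ p.asIdeal := by
    by_contra! hle
    exact p.isPrime.ne_top (top_le_iff.1 (h.span_eq_top ▸ Ideal.span_le.2 hle))
  have : Nontrivial R := p.nontrivial
  obtain ⟨φ, hφ, hφ'⟩ := h.exists_comp_eq_smul ha hb i
  rw [rankAtStalk_eq_of_comp_eq_smul hi hφ' hφ, rankAtStalk_self, Pi.one_apply]

end IsPlane

end LinesAndPlanes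

section CrossProducts

variable {R : Type*} [CommRing R]

theorem smul_add_smul_add_smul_eq_zero {a b c : Fin 3 → R} (h : a ⬝ᵥ b ⨯₃ c = 0) (j : Fin 3) :
    (b ⨯₃ c) j • a + (c ⨯₃ a) j • b + (a ⨯₃ b) j • c = 0 := by
  rw [cross_apply_smul b c a, dotProduct_comm, h, ← cross_anticomm c a, ← cross_anticomm a b]
  simp only [Pi.neg_apply]
  module

theorem cross_single_cross_cross_single (y : Fin 3 → R) (n : Fin 3) :
    (y ⨯₃ Pi.single (n + 1) 1) ⨯₃ (y ⨯₃ Pi.single (n + 2) 1) = y n • y := by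
  rw [cross_cross_eq_smul_sub_smul', dot_self_cross, zero_smul, sub_zero, dotProduct_single_one]
  fin_cases n <;> simp [cross_apply]

theorem eq_zero_of_forall_apply_smul_eq_zero {ι M : Type*} [Fintype ι] [AddCommGroup M]
    [Module R M] {y η : ι → R} (hy : y ⬝ᵥ η = 1) {m : M} (hm : ∀ i, y i • m = 0) : m = 0 := by
  rw [← one_smul R m, ← hy, dotProduct, Finset.sum_smul]
  exact Finset.sum_eq_zero fun i _ => by rw [mul_comm, mul_smul, hm, smul_zero]

theorem cross_eq_zero_iff {a b : Fin 3 → R} : a ⨯₃ b = 0 ↔ ∀ i, a i • b = b i • a := by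
  refine ⟨fun h i => ?_, fun h => ?_⟩
  · have hcross := cross_cross_eq_smul_sub_smul' (Pi.single i 1) a b
    rw [h, map_zero, single_one_dotProduct, dotProduct_single_one, eq_comm, sub_eq_zero] at hcross
    exact hcross.symm
  · have hmul (i j : Fin 3) : a i * b j = b i * a j := congrFun (h i) j
    ext i
    fin_cases i
    · exact sub_eq_zero.2 ((hmul 1 2).trans (mul_comm _ _))
    · exact sub_eq_zero.2 ((hmul 2 0).trans (mul_comm _ _))
    · exact sub_eq_zero.2 ((hmul 0 1).trans (mul_comm _ _))

namespace IsLine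

variable {ℓ : Submodule R (Fin 3 → R)} (h : IsLine ℓ)
include h

theorem mem_of_cross_eq_zero {v : Fin 3 → R} (hv : ∀ a ∈ ℓ, a ⨯₃ v = 0) : v ∈ ℓ := by
  refine Submodule.mem_of_span_top_of_smul_mem _ _ h.span_eq_top _ ?_
  rintro ⟨_, a, ha, i, rfl⟩
  simpa only [cross_eq_zero_iff.1 (hv a ha) i] using ℓ.smul_mem _ ha

end IsLine

namespace IsPlane

variable {H : Submodule R (Fin 3 → R)} (h : IsPlane H)
include h

theorem eq_zero_of_pow_smul_eq_zero {M : Type*} [AddCommGroup M] [Module R M] {m : M} (n : ℕ)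
    (hm : ∀ a ∈ H, ∀ b ∈ H, ∀ i, (a ⨯₃ b) i ^ n • m = 0) : m = 0 := by
  refine (Submodule.mem_bot R).1
    (Submodule.mem_of_span_eq_top_of_smul_pow_mem ⊥ _ h.span_eq_top m ?_)
  rintro ⟨_, a, ha, b, hb, i, rfl⟩
  exact ⟨n, (Submodule.mem_bot R).2 (hm a ha b hb i)⟩

theorem mem_of_cross_dotProduct_eq_zero {v : Fin 3 → R}
    (hv : ∀ a ∈ H, ∀ b ∈ H, a ⨯₃ b ⬝ᵥ v = 0) : v ∈ H := by
  refine Submodule.mem_of_span_top_of_smul_mem _ _ h.span_eq_top _ ?_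
  rintro ⟨_, a, ha, b, hb, i, rfl⟩
  rw [cross_apply_smul, hv a ha b hb, zero_smul, zero_add]
  exact add_mem (H.smul_mem _ ha) (H.smul_mem _ hb)

theorem cross_cross_eq_zero {a b c d : Fin 3 → R} (ha : a ∈ H) (hb : b ∈ H) (hc : c ∈ H)
    (hd : d ∈ H) : (a ⨯₃ b) ⨯₃ (c ⨯₃ d) = 0 := by
  rw [cross_cross_eq_smul_sub_smul, h.triple_product_eq_zero a ha c hc d hd,
    h.triple_product_eq_zero b hb c hc d hd, zero_smul, zero_smul, sub_zero]

end IsPlane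

theorem triple_product_smul_eq_zero {y a b c : Fin 3 → R} (ha : a ⬝ᵥ y = 0) (hb : b ⬝ᵥ y = 0)
    (hc : c ⬝ᵥ y = 0) : (a ⬝ᵥ b ⨯₃ c) • y = 0 := by
  let A := Matrix.of ![a, b, c]
  have hA : A *ᵥ y = 0 := by
    ext i
    fin_cases i
    exacts [ha, hb, hc]
  have hdet : a ⬝ᵥ b ⨯₃ c = A.det := triple_product_eq_det a b c
  rw [hdet, ← Matrix.one_mulVec y, ← Matrix.smul_mulVec,
    ← Matrix.adjugate_mul, ← Matrix.mulVec_mulVec, hA, Matrix.mulVec_zero]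

theorem cross_eq_smul_of_dotProduct_eq_zero {y η a b : Fin 3 → R} (hy : y ⬝ᵥ η = 1)
    (ha : a ⬝ᵥ y = 0) (hb : b ⬝ᵥ y = 0) : a ⨯₃ b = (a ⨯₃ b ⬝ᵥ η) • y := by
  have hcross : (a ⨯₃ b) ⨯₃ y = 0 := by
    rw [cross_cross_eq_smul_sub_smul, ha, hb, zero_smul, zero_smul, sub_zero]
  have hη := cross_cross_eq_smul_sub_smul' η (a ⨯₃ b) y
  rwa [hcross, map_zero, dotProduct_comm, hy, one_smul, eq_comm, sub_eq_zero] at hη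

end CrossProducts

section Graph

variable {R : Type*} [CommRing R] {G : Matrix (Fin 3 × Fin 3) (Fin 3 × Fin 3) R}
  {L L' : Submodule R ((Fin 3 → R) × (Fin 3 → R))}

/-- The triple products of elements of `L ⊆ U ⊕ E` have no component in `⋀³ E`, and their components
in `⋀² U ⊗ E` are the images under `G` of their components in `U ⊗ ⋀² E`. -/
def InGraph (G : Matrix (Fin 3 × Fin 3) (Fin 3 × Fin 3) R)
    (L : Submodule R ((Fin 3 → R) × (Fin 3 → R))) : Prop :=
  ∀ w₁ ∈ L, ∀ w₂ ∈ L, ∀ w₃ ∈ L,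
    w₁.2 ⬝ᵥ w₂.2 ⨯₃ w₃.2 = 0 ∧ wedge21 w₁ w₂ w₃ = G *ᵥ wedge12 w₁ w₂ w₃

theorem wedge12_mk_zero (x : Fin 3 → R) (w w' : (Fin 3 → R) × (Fin 3 → R)) :
    wedge12 (x, 0) w w' = segre x (w.2 ⨯₃ w'.2) := by
  simp only [wedge12, map_zero, LinearMap.zero_apply, add_zero]

theorem wedge21_mk_zero (x : Fin 3 → R) (w w' : (Fin 3 → R) × (Fin 3 → R)) :
    wedge21 (x, 0) w w' = segre (x ⨯₃ w.1) w'.2 + segre (w'.1 ⨯₃ x) w.2 := by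
  simp only [wedge21, map_zero, add_zero]

theorem wedge21_mk_zero_eq_mulVec_iff {x : Fin 3 → R} {w w' : (Fin 3 → R) × (Fin 3 → R)} :
    wedge21 (x, 0) w w' = G *ᵥ wedge12 (x, 0) w w' ↔
      Matrix.vecMulVec (x ⨯₃ w.1) w'.2 + Matrix.vecMulVec (w'.1 ⨯₃ x) w.2 =
        contr G x (w.2 ⨯₃ w'.2) := by
  rw [wedge12_mk_zero, wedge21_mk_zero, funext_iff, Prod.forall, ← Matrix.ext_iff]
  rfl

theorem cyclic_smul_eq {w₁ w₂ w₃ : (Fin 3 → R) × (Fin 3 → R)} (h : w₁.2 ⬝ᵥ w₂.2 ⨯₃ w₃.2 = 0)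
    (j : Fin 3) :
    (w₂.2 ⨯₃ w₃.2) j • w₁ + (w₃.2 ⨯₃ w₁.2) j • w₂ + (w₁.2 ⨯₃ w₂.2) j • w₃ =
      ((w₂.2 ⨯₃ w₃.2) j • w₁.1 + (w₃.2 ⨯₃ w₁.2) j • w₂.1 + (w₁.2 ⨯₃ w₂.2) j • w₃.1, 0) :=
  Prod.ext rfl (smul_add_smul_add_smul_eq_zero h j)

theorem cyclic_smul_mem {w₁ w₂ w₃ : (Fin 3 → R) × (Fin 3 → R)} (hw₁ : w₁ ∈ L) (hw₂ : w₂ ∈ L)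
    (hw₃ : w₃ ∈ L) (h : w₁.2 ⬝ᵥ w₂.2 ⨯₃ w₃.2 = 0) (j : Fin 3) :
    (w₂.2 ⨯₃ w₃.2) j • w₁.1 + (w₃.2 ⨯₃ w₁.2) j • w₂.1 + (w₁.2 ⨯₃ w₂.2) j • w₃.1 ∈
      L.comap (LinearMap.inl R _ _) := by
  rw [Submodule.mem_comap, LinearMap.inl_apply, ← cyclic_smul_eq h j]
  exact add_mem (add_mem (L.smul_mem _ hw₁) (L.smul_mem _ hw₂)) (L.smul_mem _ hw₃)

namespace InGraph

theorem eq_contr (hL : InGraph G L) {x : Fin 3 → R} {w w' : (Fin 3 → R) × (Fin 3 → R)}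
    (hx : (x, 0) ∈ L) (hw : w ∈ L) (hw' : w' ∈ L) :
    Matrix.vecMulVec (x ⨯₃ w.1) w'.2 + Matrix.vecMulVec (w'.1 ⨯₃ x) w.2 =
      contr G x (w.2 ⨯₃ w'.2) :=
  wedge21_mk_zero_eq_mulVec_iff.1 (hL _ hx _ hw _ hw').2

theorem isSingularAt (hL : InGraph G L) {x y η : Fin 3 → R} (hy : y ⬝ᵥ η = 1) (hx : (x, 0) ∈ L)
    (hH : ∀ v, v ⬝ᵥ y = 0 → ∃ m, (m, v) ∈ L) : IsSingularAt G x y := by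
  have hperp (i : Fin 3) : (y ⨯₃ Pi.single i 1) ⬝ᵥ y = 0 := by
    rw [dotProduct_comm, dot_self_cross]
  have hsmul (n : Fin 3) : y n • contr G x y = contr G x (y n • y) := by
    simpa only [one_smul, one_mul] using (contr_smul_smul G 1 (y n) x y).symm
  constructor <;> refine eq_zero_of_forall_apply_smul_eq_zero hy fun n => ?_ <;>
    obtain ⟨m, hm⟩ := hH _ (hperp (n + 1)) <;> obtain ⟨m', hm'⟩ := hH _ (hperp (n + 2))
  · rw [← Matrix.vecMul_smul, hsmul, ← cross_single_cross_cross_single, ← hL.eq_contr hx hm hm',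
      Matrix.vecMul_add, Matrix.vecMul_vecMulVec, Matrix.vecMul_vecMulVec, dot_self_cross,
      dot_cross_self, zero_smul, zero_smul, add_zero]
  · rw [← Matrix.smul_mulVec, hsmul, ← cross_single_cross_cross_single, ← hL.eq_contr hx hm hm',
      Matrix.add_mulVec, Matrix.vecMulVec_mulVec, Matrix.vecMulVec_mulVec, hperp, hperp,
      MulOpposite.op_zero, zero_smul, zero_smul, add_zero]

theorem segre_cross_eq_zero (hL : InGraph G L) {w : (Fin 3 → R) × (Fin 3 → R)} {x y : Fin 3 → R}
    (hw : w ∈ L) (hx : (x, 0) ∈ L) (hy : (y, 0) ∈ L) : segre (x ⨯₃ y) w.2 = 0 := by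
  have hgraph := (hL _ hx _ hy _ hw).2
  rwa [wedge12_mk_zero, wedge21_mk_zero, map_zero, map_zero, LinearMap.zero_apply, map_zero,
    Matrix.mulVec_zero, add_zero] at hgraph

end InGraph

theorem exists_cross_ne_zero {K : Type*} [Field K]
    {L : Submodule K ((Fin 3 → K) × (Fin 3 → K))} (hL : finrank K L = 3)
    (hcross : ∀ w ∈ L, ∀ w' ∈ L, w.2 ⨯₃ w'.2 = 0) {w : (Fin 3 → K) × (Fin 3 → K)} (hw : w ∈ L)
    (hne : w.2 ≠ 0) : ∃ x y, (x, 0) ∈ L ∧ (y, 0) ∈ L ∧ x ⨯₃ y ≠ 0 := by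
  let snd : L →ₗ[K] (Fin 3 → K) := LinearMap.snd K _ _ ∘ₗ L.subtype
  have hrange : LinearMap.range snd ≤ Submodule.span K {w.2} := by
    obtain ⟨l, hl⟩ := Function.ne_iff.1 hne
    rintro _ ⟨w', rfl⟩
    refine Submodule.mem_span_singleton.2 ⟨(w.2 l)⁻¹ * (w' : (Fin 3 → K) × (Fin 3 → K)).2 l, ?_⟩
    rw [mul_smul, ← cross_eq_zero_iff.1 (hcross w hw w' w'.2) l]
    exact inv_smul_smul₀ hl _
  have hker : 1 < finrank K (LinearMap.ker snd) := by
    have hsum := snd.finrank_range_add_finrank_ker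
    have hle := (Submodule.finrank_mono hrange).trans (finrank_span_singleton hne).le
    lia
  let fst : LinearMap.ker snd →ₗ[K] (Fin 3 → K) :=
    LinearMap.fst K _ _ ∘ₗ L.subtype ∘ₗ (LinearMap.ker snd).subtype
  have hmem (z : LinearMap.ker snd) : ((z : L) : (Fin 3 → K) × (Fin 3 → K)) = (fst z, 0) :=
    Prod.ext rfl z.2
  have hfst : LinearMap.ker fst = ⊥ := LinearMap.ker_eq_bot'.2 fun z hz =>
    Subtype.ext (Subtype.ext (by rw [hmem, hz]; rfl))
  have : Nontrivial (LinearMap.ker snd) := nontrivial_of_finrank_pos (R := K) (by lia)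
  obtain ⟨x, hx⟩ := exists_ne (0 : LinearMap.ker snd)
  obtain ⟨y, hxy⟩ := exists_linearIndependent_pair_of_one_lt_finrank (R := K)
    (M := LinearMap.ker snd) hker hx
  have hli : LinearIndependent K ![fst x, fst y] := by
    rw [← (List.ofFn_inj.1 rfl : fst ∘ ![x, y] = ![fst x, fst y])]
    exact hxy.map' fst hfst
  exact ⟨fst x, fst y, hmem x ▸ x.1.2, hmem y ▸ y.1.2,
    crossProduct_ne_zero_iff_linearIndependent.2 hli⟩

theorem InGraph.snd_eq_zero {K : Type*} [Field K] {G : Matrix (Fin 3 × Fin 3) (Fin 3 × Fin 3) K}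
    {L : Submodule K ((Fin 3 → K) × (Fin 3 → K))} (hL : InGraph G L) (hrank : finrank K L = 3)
    (hcross : ∀ w ∈ L, ∀ w' ∈ L, w.2 ⨯₃ w'.2 = 0) {w : (Fin 3 → K) × (Fin 3 → K)}
    (hw : w ∈ L) : w.2 = 0 := by
  by_contra hne
  obtain ⟨x, y, hx, hy, hxy⟩ := exists_cross_ne_zero hrank hcross hw hne
  obtain ⟨k, hk⟩ := Function.ne_iff.1 hxy
  obtain ⟨l, hl⟩ := Function.ne_iff.1 hne
  exact mul_ne_zero hk hl (congrFun (hL.segre_cross_eq_zero hw hx hy) (k, l))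

theorem cross_apply_smul_eq_zero {m : Type*} {a b : m → R} {h h' : Fin 3 → R}
    (hab : Matrix.vecMulVec a h' + Matrix.vecMulVec b h = 0) (j : Fin 3) :
    (h ⨯₃ h') j • a = 0 := by
  ext k
  have hrow : a k • h' + b k • h = 0 := congrFun hab k
  have hcross := congrFun (congrArg (fun v => h ⨯₃ v) hrow) j
  simp only [map_add, map_smul, cross_self, smul_zero, add_zero, map_zero] at hcross
  rw [Pi.smul_apply, smul_eq_mul, mul_comm]
  exact hcross

section Uniqueness

variable {ℓ H : Submodule R (Fin 3 → R)}

theorem InGraph.cross_apply_smul_mem (hℓ : IsLine ℓ) (hL : InGraph G L) (hL' : InGraph G L')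
    (hinl : L.comap (LinearMap.inl R _ _) = ℓ) (hinl' : L'.comap (LinearMap.inl R _ _) = ℓ)
    (hsnd : L.map (LinearMap.snd R _ _) ≤ L'.map (LinearMap.snd R _ _))
    {w w' : (Fin 3 → R) × (Fin 3 → R)} (hw : w ∈ L) (hw' : w' ∈ L) (j : Fin 3) :
    (w.2 ⨯₃ w'.2) j • w ∈ L' := by
  obtain ⟨v, hv, hvw⟩ := hsnd ⟨w, hw, rfl⟩
  obtain ⟨v', hv', hvw'⟩ := hsnd ⟨w', hw', rfl⟩
  have hdiff : (w.2 ⨯₃ w'.2) j • (w.1 - v.1) ∈ ℓ := by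
    refine hℓ.mem_of_cross_eq_zero fun x hx => ?_
    rw [map_smul]
    refine cross_apply_smul_eq_zero (b := (w'.1 - v'.1) ⨯₃ x) ?_ j
    have hcontr := hL.eq_contr (show (x, 0) ∈ L by rw [← hinl] at hx; exact hx) hw hw'
    have hcontr' := hL'.eq_contr (show (x, 0) ∈ L' by rw [← hinl'] at hx; exact hx) hv hv'
    simp only [LinearMap.snd_apply] at hvw hvw'
    rw [hvw, hvw', ← hcontr] at hcontr'
    rw [map_sub, map_sub, LinearMap.sub_apply, Matrix.sub_vecMulVec, Matrix.sub_vecMulVec,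
      sub_add_sub_comm, hcontr', sub_self]
  have hmem : ((w.2 ⨯₃ w'.2) j • (w.1 - v.1), 0) ∈ L' := by
    rw [← hinl'] at hdiff
    exact hdiff
  convert add_mem hmem (L'.smul_mem ((w.2 ⨯₃ w'.2) j) hv) using 1
  refine Prod.ext ?_ ?_
  · simp only [Prod.fst_add, Prod.smul_fst, smul_sub, sub_add_cancel]
  · rw [Prod.snd_add, Prod.smul_snd, Prod.smul_snd, zero_add, ← LinearMap.snd_apply (R := R) w,
      ← hvw,
      LinearMap.snd_apply]

theorem InGraph.le (hℓ : IsLine ℓ) (hH : IsPlane H) (hL : InGraph G L) (hL' : InGraph G L')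
    (hinl : L.comap (LinearMap.inl R _ _) = ℓ) (hinl' : L'.comap (LinearMap.inl R _ _) = ℓ)
    (hsnd : L.map (LinearMap.snd R _ _) = H) (hsnd' : L'.map (LinearMap.snd R _ _) = H) :
    L ≤ L' := by
  intro w hw
  refine Submodule.mem_of_span_eq_top_of_smul_pow_mem _ _ hH.span_eq_top _ ?_
  rintro ⟨_, b, hb, b', hb', j, rfl⟩
  rw [← hsnd] at hb hb'
  obtain ⟨v, hv, rfl⟩ := hb
  obtain ⟨v', hv', rfl⟩ := hb'
  have hsmul {w w'} (hw : w ∈ L) (hw' : w' ∈ L) : (w.2 ⨯₃ w'.2) j • w ∈ L' :=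
    cross_apply_smul_mem hℓ hL hL' hinl hinl' (hsnd.trans hsnd'.symm).le hw hw' j
  have hdet := (hL w hw v hv v' hv').1
  have hcyclic : (v.2 ⨯₃ v'.2) j • w + (v'.2 ⨯₃ w.2) j • v + (w.2 ⨯₃ v.2) j • v' ∈ L' := by
    rw [cyclic_smul_eq hdet]
    exact (hinl.trans hinl'.symm).le (cyclic_smul_mem hw hv hv' hdet j)
  refine ⟨2, ?_⟩
  have hmem := sub_mem (sub_mem (L'.smul_mem ((v.2 ⨯₃ v'.2) j) hcyclic)
    (L'.smul_mem ((v'.2 ⨯₃ w.2) j) (hsmul hv hv'))) (L'.smul_mem (-(w.2 ⨯₃ v.2) j) (hsmul hv' hv))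
  rw [← cross_anticomm v.2 v'.2] at hmem
  convert hmem using 1
  simp only [LinearMap.snd_apply, Pi.neg_apply]
  module

end Uniqueness

end Graph

section Reconstruction

variable {R : Type*} [CommRing R] {G : Matrix (Fin 3 × Fin 3) (Fin 3 × Fin 3) R}
  {ℓ H : Submodule R (Fin 3 → R)}

/-- The biquadratic form defined by `G` is singular along `ℓ ⊗ ⋀² H`. -/
structure IsSingular (G : Matrix (Fin 3 × Fin 3) (Fin 3 × Fin 3) R)
    (ℓ H : Submodule R (Fin 3 → R)) : Prop where
  vecMul_eq_zero : ∀ x ∈ ℓ, ∀ x' ∈ ℓ, ∀ h ∈ H, ∀ h' ∈ H, x' ᵥ* contr G x (h ⨯₃ h') = 0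
  mulVec_eq_zero : ∀ x ∈ ℓ, ∀ h ∈ H, ∀ h' ∈ H, ∀ g ∈ H, ∀ g' ∈ H,
    contr G x (h ⨯₃ h') *ᵥ (g ⨯₃ g') = 0

/-- The submodule of `U ⊕ E` reconstructed from a singular point `(ℓ, H)`. Its equations are those
which `InGraph.eq_contr` forces on a solution that meets `U` in `ℓ` and has image `H` in `E`. -/
def reconstruct (G : Matrix (Fin 3 × Fin 3) (Fin 3 × Fin 3) R) (ℓ H : Submodule R (Fin 3 → R)) :
    Submodule R ((Fin 3 → R) × (Fin 3 → R)) where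
  carrier := {w | w.2 ∈ H ∧ ∀ x ∈ ℓ, ∀ g ∈ H, ∀ g' ∈ H, ∀ k,
    (x ⨯₃ w.1) k • (g ⨯₃ g') = w.2 ⨯₃ contr G x (g ⨯₃ g') k}
  add_mem' := by
    rintro w w' ⟨hw, hcross⟩ ⟨hw', hcross'⟩
    refine ⟨add_mem hw hw', fun x hx g hg g' hg' k => ?_⟩
    rw [Prod.fst_add, Prod.snd_add, map_add, map_add, LinearMap.add_apply, Pi.add_apply, add_smul,
      hcross x hx g hg g' hg' k, hcross' x hx g hg g' hg' k]
  zero_mem' := by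
    refine ⟨H.zero_mem, fun x _ g _ g' _ k => ?_⟩
    rw [Prod.fst_zero, Prod.snd_zero, map_zero, map_zero, LinearMap.zero_apply, Pi.zero_apply,
      zero_smul]
  smul_mem' := by
    rintro c w ⟨hw, hcross⟩
    refine ⟨H.smul_mem c hw, fun x hx g hg g' hg' k => ?_⟩
    rw [Prod.smul_fst, Prod.smul_snd, map_smul, map_smul, LinearMap.smul_apply, Pi.smul_apply,
      smul_assoc, hcross x hx g hg g' hg' k]

theorem IsSingular.contr_mem (hs : IsSingular G ℓ H) (hH : IsPlane H) {x g g' : Fin 3 → R}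
    (hx : x ∈ ℓ) (hg : g ∈ H) (hg' : g' ∈ H) (k : Fin 3) : contr G x (g ⨯₃ g') k ∈ H :=
  hH.mem_of_cross_dotProduct_eq_zero fun a ha b hb => by
    rw [dotProduct_comm]
    exact congrFun (hs.mulVec_eq_zero x hx g hg g' hg' a ha b hb) k

theorem IsLine.apply_smul_comm (hℓ : IsLine ℓ) {x x' : Fin 3 → R} (hx : x ∈ ℓ) (hx' : x' ∈ ℓ)
    (i : Fin 3) : x i • x' = x' i • x :=
  cross_eq_zero_iff.1 (hℓ.cross_eq_zero x hx x' hx') i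

theorem IsPlane.cross_apply_smul_comm (hH : IsPlane H) {a b c d : Fin 3 → R} (ha : a ∈ H)
    (hb : b ∈ H) (hc : c ∈ H) (hd : d ∈ H) (i : Fin 3) :
    (a ⨯₃ b) i • (c ⨯₃ d) = (c ⨯₃ d) i • (a ⨯₃ b) :=
  cross_eq_zero_iff.1 (hH.cross_cross_eq_zero ha hb hc hd) i

theorem smul_contr_comm (hℓ : IsLine ℓ) (hH : IsPlane H) {x x' g g' h h' : Fin 3 → R}
    (hx : x ∈ ℓ) (hx' : x' ∈ ℓ) (hg : g ∈ H) (hg' : g' ∈ H) (hh : h ∈ H) (hh' : h' ∈ H)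
    (i j : Fin 3) :
    (x' i * (h ⨯₃ h') j) • contr G x (g ⨯₃ g') = (x i * (g ⨯₃ g') j) • contr G x' (h ⨯₃ h') := by
  rw [← contr_smul_smul, ← contr_smul_smul, hℓ.apply_smul_comm hx' hx,
    hH.cross_apply_smul_comm hh hh' hg hg']

theorem cross_apply_smul_contr (hH : IsPlane H) {g g' h h' : Fin 3 → R} (hg : g ∈ H)
    (hg' : g' ∈ H) (hh : h ∈ H) (hh' : h' ∈ H) (x : Fin 3 → R) (j : Fin 3) :
    (h ⨯₃ h') j • contr G x (g ⨯₃ g') = (g ⨯₃ g') j • contr G x (h ⨯₃ h') := by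
  have hsmul (a : R) (y : Fin 3 → R) : a • contr G x y = contr G x (a • y) := by
    simpa only [one_smul, one_mul] using (contr_smul_smul G 1 a x y).symm
  rw [hsmul, hsmul, hH.cross_apply_smul_comm hh hh' hg hg']

theorem comap_inl_reconstruct (hℓ : IsLine ℓ) (hH : IsPlane H) :
    (reconstruct G ℓ H).comap (LinearMap.inl R _ _) = ℓ := by
  ext m
  constructor
  · rintro ⟨-, hm⟩
    refine hℓ.mem_of_cross_eq_zero fun x hx => funext fun k => ?_
    refine hH.eq_zero_of_pow_smul_eq_zero 1 fun g hg g' hg' j => ?_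
    have hcross : (x ⨯₃ m) k • (g ⨯₃ g') = 0 :=
      (hm x hx g hg g' hg' k).trans (LinearMap.map_zero₂ _ _)
    rw [pow_one, smul_eq_mul, mul_comm]
    exact congrFun hcross j
  · intro hm
    refine ⟨H.zero_mem, fun x hx g _ g' _ k => ?_⟩
    simp only [LinearMap.coe_inl, hℓ.cross_eq_zero x hx m hm, map_zero, LinearMap.zero_apply,
      Pi.zero_apply, zero_smul]

theorem cross_mulVec_cross_single {B : Matrix (Fin 3) (Fin 3) R} {x : Fin 3 → R}
    (hx : x ᵥ* B = 0) (v : Fin 3 → R) (i : Fin 3) :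
    x ⨯₃ ((B *ᵥ v) ⨯₃ Pi.single i 1) = x i • (B *ᵥ v) := by
  rw [cross_cross_eq_smul_sub_smul', dotProduct_single_one, dotProduct_comm,
    Matrix.dotProduct_mulVec, hx, zero_dotProduct, zero_smul, sub_zero]

theorem mulVec_single_cross_apply (B : Matrix (Fin 3) (Fin 3) R) (h : Fin 3 → R) (j k : Fin 3) :
    (B *ᵥ (Pi.single j 1 ⨯₃ h)) k = (h ⨯₃ B k) j := by
  rw [← single_one_dotProduct j (h ⨯₃ B k), triple_product_permutation, triple_product_permutation]
  rfl

theorem mem_reconstruct_of_isSingular (hℓ : IsLine ℓ) (hH : IsPlane H) (hs : IsSingular G ℓ H)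
    {x g g' h : Fin 3 → R} (hx : x ∈ ℓ) (hg : g ∈ H) (hg' : g' ∈ H) (hh : h ∈ H) (i j : Fin 3) :
    ((contr G x (g ⨯₃ g') *ᵥ (Pi.single j 1 ⨯₃ h)) ⨯₃ Pi.single i 1,
      (x i * (g ⨯₃ g') j) • h) ∈ reconstruct G ℓ H := by
  refine ⟨H.smul_mem _ hh, fun x' hx' f hf f' hf' k => ?_⟩
  simp only
  have hprop : (x' i * (f ⨯₃ f') j) • contr G x (g ⨯₃ g') k =
      (x i * (g ⨯₃ g') j) • contr G x' (f ⨯₃ f') k :=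
    congrFun (smul_contr_comm hℓ hH hx hx' hg hg' hf hf' i j) k
  rw [cross_mulVec_cross_single (hs.vecMul_eq_zero x hx x' hx' g hg g' hg'), Pi.smul_apply,
    mulVec_single_cross_apply, smul_assoc,
    hH.cross_apply_smul_comm hh (hs.contr_mem hH hx hg hg' k) hf hf', map_smul,
    LinearMap.smul_apply, ← map_smul, ← map_smul, ← map_smul, ← hprop, smul_smul]

theorem map_snd_reconstruct (hℓ : IsLine ℓ) (hH : IsPlane H) (hs : IsSingular G ℓ H) :
    (reconstruct G ℓ H).map (LinearMap.snd R _ _) = H := by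
  refine le_antisymm (Submodule.map_le_iff_le_comap.2 fun w hw => hw.1) fun h hh => ?_
  refine Submodule.mem_of_span_top_of_smul_mem _ _ hℓ.span_eq_top _ ?_
  rintro ⟨_, x, hx, i, rfl⟩
  refine Submodule.mem_of_span_top_of_smul_mem _ _ hH.span_eq_top _ ?_
  rintro ⟨_, g, hg, g', hg', j, rfl⟩
  exact ⟨_, mem_reconstruct_of_isSingular hℓ hH hs hx hg hg' hh i j, by
    rw [LinearMap.snd_apply, mul_comm, mul_smul]⟩

theorem wedge21_mk_zero_reconstruct (hH : IsPlane H) (hs : IsSingular G ℓ H) {x : Fin 3 → R}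
    (hx : x ∈ ℓ) {w w' : (Fin 3 → R) × (Fin 3 → R)} (hw : w ∈ reconstruct G ℓ H)
    (hw' : w' ∈ reconstruct G ℓ H) : wedge21 (x, 0) w w' = G *ᵥ wedge12 (x, 0) w w' := by
  rw [wedge21_mk_zero_eq_mulVec_iff]
  refine funext fun k => sub_eq_zero.1 (hH.eq_zero_of_pow_smul_eq_zero 1 fun g hg g' hg' j => ?_)
  have hC := hs.contr_mem hH hx hg hg' k
  have hcross := congrFun (hw.2 x hx g hg g' hg' k) j
  have hcross' := congrFun (hw'.2 x hx g hg g' hg' k) j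
  have hcontr : (g ⨯₃ g') j • contr G x (w.2 ⨯₃ w'.2) k =
      (w.2 ⨯₃ w'.2) j • contr G x (g ⨯₃ g') k :=
    congrFun (cross_apply_smul_contr hH hw.1 hw'.1 hg hg' x j) k
  have hcyclic := smul_add_smul_add_smul_eq_zero
    (hH.triple_product_eq_zero w.2 hw.1 w'.2 hw'.1 _ hC) j
  rw [Pi.smul_apply, smul_eq_mul] at hcross hcross'
  rw [← cross_anticomm w.2, Pi.neg_apply, ← hcross, ← hcross'] at hcyclic
  rw [pow_one, smul_sub, hcontr, ← cross_anticomm x]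
  change (g ⨯₃ g') j • ((x ⨯₃ w.1) k • w'.2 + (-(x ⨯₃ w'.1)) k • w.2) - _ = 0
  rw [← neg_zero, ← hcyclic, Pi.neg_apply]
  module

theorem wedge12_linearCombination (u u' : (Fin 3 → R) × (Fin 3 → R)) (x₁ x₂ x₃ : Fin 3 → R)
    (α₁ α₂ α₃ β₁ β₂ β₃ : R) :
    wedge12 (α₁ • u + β₁ • u' + (x₁, 0)) (α₂ • u + β₂ • u' + (x₂, 0))
        (α₃ • u + β₃ • u' + (x₃, 0)) =
      wedge12 ((α₂ * β₃ - α₃ * β₂) • x₁ + (α₃ * β₁ - α₁ * β₃) • x₂ +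
        (α₁ * β₂ - α₂ * β₁) • x₃, 0) u u' := by
  rw [wedge12_mk_zero]
  simp only [wedge12, Prod.fst_add, Prod.snd_add, Prod.smul_fst, Prod.smul_snd, add_zero, map_add,
    map_smul, LinearMap.add_apply, LinearMap.smul_apply, cross_self, ← cross_anticomm u.2 u'.2,
    map_neg, map_zero]
  module

theorem wedge21_linearCombination (u u' : (Fin 3 → R) × (Fin 3 → R)) {x₁ x₂ x₃ : Fin 3 → R}
    (h₂₃ : x₂ ⨯₃ x₃ = 0) (h₃₁ : x₃ ⨯₃ x₁ = 0) (h₁₂ : x₁ ⨯₃ x₂ = 0) (α₁ α₂ α₃ β₁ β₂ β₃ : R) :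
    wedge21 (α₁ • u + β₁ • u' + (x₁, 0)) (α₂ • u + β₂ • u' + (x₂, 0))
        (α₃ • u + β₃ • u' + (x₃, 0)) =
      wedge21 ((α₂ * β₃ - α₃ * β₂) • x₁ + (α₃ * β₁ - α₁ * β₃) • x₂ +
        (α₁ * β₂ - α₂ * β₁) • x₃, 0) u u' := by
  rw [wedge21_mk_zero]
  simp only [wedge21, Prod.fst_add, Prod.snd_add, Prod.smul_fst, Prod.smul_snd, add_zero, map_add,
    map_smul, LinearMap.add_apply, LinearMap.smul_apply, cross_self, ← cross_anticomm u.1 u'.1,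
    ← cross_anticomm u.1 x₁, ← cross_anticomm u.1 x₂, ← cross_anticomm u.1 x₃,
    ← cross_anticomm x₁ u'.1, ← cross_anticomm x₂ u'.1, ← cross_anticomm x₃ u'.1,
    h₂₃, h₃₁, h₁₂, map_neg,
    map_zero, LinearMap.zero_apply, LinearMap.neg_apply]
  module

theorem wedge12_smul (r : R) (w₁ w₂ w₃ : (Fin 3 → R) × (Fin 3 → R)) :
    wedge12 (r • w₁) (r • w₂) (r • w₃) = r ^ 3 • wedge12 w₁ w₂ w₃ := by
  simp only [wedge12, Prod.smul_fst, Prod.smul_snd, map_smul, LinearMap.smul_apply]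
  module

theorem wedge21_smul (r : R) (w₁ w₂ w₃ : (Fin 3 → R) × (Fin 3 → R)) :
    wedge21 (r • w₁) (r • w₂) (r • w₃) = r ^ 3 • wedge21 w₁ w₂ w₃ := by
  simp only [wedge21, Prod.smul_fst, Prod.smul_snd, map_smul, LinearMap.smul_apply]
  module

theorem exists_smul_eq_smul_add_smul_add {L : Submodule R ((Fin 3 → R) × (Fin 3 → R))}
    (hinl : L.comap (LinearMap.inl R _ _) = ℓ) {w u u' : (Fin 3 → R) × (Fin 3 → R)} (hw : w ∈ L)
    (hu : u ∈ L) (hu' : u' ∈ L) (hdet : w.2 ⬝ᵥ u.2 ⨯₃ u'.2 = 0) (n : Fin 3) :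
    ∃ α β : R, ∃ x ∈ ℓ,
      (u.2 ⨯₃ u'.2) n • w = α • u + β • u' + (x, 0) := by
  have hmem := hinl.le (cyclic_smul_mem hw hu hu' hdet n)
  refine ⟨-(u'.2 ⨯₃ w.2) n, -(w.2 ⨯₃ u.2) n, _, hmem, ?_⟩
  rw [← cyclic_smul_eq hdet]
  module

theorem inGraph_reconstruct (hℓ : IsLine ℓ) (hH : IsPlane H) (hs : IsSingular G ℓ H) :
    InGraph G (reconstruct G ℓ H) := by
  intro w₁ hw₁ w₂ hw₂ w₃ hw₃
  refine ⟨hH.triple_product_eq_zero _ hw₁.1 _ hw₂.1 _ hw₃.1, sub_eq_zero.1 ?_⟩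
  refine hH.eq_zero_of_pow_smul_eq_zero 3 fun b hb b' hb' n => ?_
  rw [← map_snd_reconstruct hℓ hH hs] at hb hb'
  obtain ⟨u, hu, rfl⟩ := hb
  obtain ⟨u', hu', rfl⟩ := hb'
  have hdecomp {w} (hw : w ∈ reconstruct G ℓ H) :=
    exists_smul_eq_smul_add_smul_add (comap_inl_reconstruct hℓ hH) hw hu hu'
      (hH.triple_product_eq_zero _ hw.1 _ hu.1 _ hu'.1) n
  obtain ⟨α₁, β₁, x₁, hx₁, hsum₁⟩ := hdecomp hw₁
  obtain ⟨α₂, β₂, x₂, hx₂, hsum₂⟩ := hdecomp hw₂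
  obtain ⟨α₃, β₃, x₃, hx₃, hsum₃⟩ := hdecomp hw₃
  have hx := add_mem (add_mem (ℓ.smul_mem (α₂ * β₃ - α₃ * β₂) hx₁)
    (ℓ.smul_mem (α₃ * β₁ - α₁ * β₃) hx₂)) (ℓ.smul_mem (α₁ * β₂ - α₂ * β₁) hx₃)
  rw [LinearMap.snd_apply, LinearMap.snd_apply, smul_sub, ← Matrix.mulVec_smul, ← wedge21_smul,
    ← wedge12_smul, hsum₁, hsum₂, hsum₃, wedge12_linearCombination,
    wedge21_linearCombination u u' (hℓ.cross_eq_zero _ hx₂ _ hx₃) (hℓ.cross_eq_zero _ hx₃ _ hx₁)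
      (hℓ.cross_eq_zero _ hx₁ _ hx₂), wedge21_mk_zero_reconstruct hH hs hx hu hu', sub_self]

theorem InGraph.exists_mem_smul_wedge12 {L : Submodule R ((Fin 3 → R) × (Fin 3 → R))}
    (hL : InGraph G L) (hinl : L.comap (LinearMap.inl R _ _) = ℓ)
    (hsnd : L.map (LinearMap.snd R _ _) = H) (hH : IsPlane H)
    {w₁ w₂ w₃ : (Fin 3 → R) × (Fin 3 → R)} (hw₁ : w₁ ∈ L) (hw₂ : w₂ ∈ L) (hw₃ : w₃ ∈ L)
    {h h' : Fin 3 → R} (hh : h ∈ H) (hh' : h' ∈ H) (n : Fin 3) :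
    ∃ x ∈ ℓ, (h ⨯₃ h') n • wedge12 w₁ w₂ w₃ = segre x (h ⨯₃ h') := by
  have hmem {w} (hw : w ∈ L) : w.2 ∈ H := hsnd.le ⟨w, hw, rfl⟩
  have hx := hinl.le (cyclic_smul_mem hw₁ hw₂ hw₃ (hL w₁ hw₁ w₂ hw₂ w₃ hw₃).1 n)
  refine ⟨_, hx, ?_⟩
  have hcomm {w w'} (hw : w ∈ L) (hw' : w' ∈ L) :=
    hH.cross_apply_smul_comm hh hh' (hmem hw) (hmem hw') n
  simp only [wedge12, smul_add, map_add, map_smul, LinearMap.add_apply, LinearMap.smul_apply]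
  rw [← map_smul (segre w₁.1), ← map_smul (segre w₂.1), ← map_smul (segre w₃.1), hcomm hw₂ hw₃,
    hcomm hw₃ hw₁, hcomm hw₁ hw₂, map_smul, map_smul, map_smul]

end Reconstruction

section Coordinates

variable {V : Type v} [AddCommGroup V] [Module ℂ V] {R S : Type} [CommRing R] [Algebra ℂ R]
  [CommRing S] [Algebra ℂ S]

theorem map_toSubmodule_map {k : ℕ} {P Q : Type*} [AddCommGroup P] [Module R P] [AddCommGroup Q]
    [Module S Q] (c : (R ⊗[ℂ] V) ≃ₗ[R] P) (d : (S ⊗[ℂ] V) ≃ₗ[S] Q) (f : R →ₐ[ℂ] S) {φ : P → Q}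
    (h : ∀ z, d (f.toLinearMap.rTensor V z) = φ (c z)) (N : Grassmannian R (R ⊗[ℂ] V) k) :
    (Grassmannian.map f N).toSubmodule.map d.toLinearMap =
      Submodule.span S (φ '' (N.toSubmodule.map c.toLinearMap : Set P)) := by
  rw [toSubmodule_map, Submodule.map_span, Submodule.map_coe, Set.image_image, Set.image_image]
  exact congr_arg _ (Set.image_congr fun z _ => h z)

variable {ι : Type*} [Fintype ι] (b : Basis ι ℂ V)

/-- The coordinates on `R ⊗ V` given by a basis of `V`. -/
def tensorCoord (R : Type) [CommRing R] [Algebra ℂ R] : (R ⊗[ℂ] V) ≃ₗ[R] (ι → R) :=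
  (b.baseChange R).equivFun

theorem tensorCoord_tmul (r : R) (v : V) (i : ι) :
    tensorCoord b R (r ⊗ₜ v) i = algebraMap ℂ R (b.repr v i) * r := by
  rw [tensorCoord, Basis.equivFun_apply, Basis.baseChange_repr_tmul, Algebra.smul_def]

theorem tensorCoord_symm_apply (a : ι → R) :
    (tensorCoord b R).symm a = ∑ i, a i ⊗ₜ[ℂ] b i := by
  rw [tensorCoord, Basis.equivFun_symm_apply]
  refine Finset.sum_congr rfl fun i _ => ?_
  rw [Basis.baseChange_apply, TensorProduct.smul_tmul', smul_eq_mul, mul_one]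

theorem tensorCoord_rTensor (f : R →ₐ[ℂ] S) (z : R ⊗[ℂ] V) :
    tensorCoord b S (f.toLinearMap.rTensor V z) = f ∘ tensorCoord b R z := by
  ext i
  induction z using TensorProduct.induction_on with
  | zero => simp only [map_zero, Pi.zero_apply, Function.comp_apply]
  | tmul r m =>
    simp only [LinearMap.rTensor_tmul, AlgHom.toLinearMap_apply, Function.comp_apply,
      tensorCoord_tmul, map_mul, AlgHom.commutes]
  | add z w hz hw => simp only [map_add, Pi.add_apply, Function.comp_apply, hz, hw]

/-- The coordinate vectors of the elements of a submodule of `R ⊗ V`. -/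
def coordSubmodule (N : Submodule R (R ⊗[ℂ] V)) : Submodule R (ι → R) :=
  N.map (tensorCoord b R).toLinearMap

theorem mem_coordSubmodule {N : Submodule R (R ⊗[ℂ] V)} {a : ι → R} :
    a ∈ coordSubmodule b N ↔ (tensorCoord b R).symm a ∈ N :=
  Submodule.mem_map_equiv N (e := tensorCoord b R)

theorem coordSubmodule_injective : Function.Injective (coordSubmodule b (R := R)) :=
  Submodule.map_injective_of_injective (tensorCoord b R).injective

theorem coordSubmodule_le {N N' : Submodule R (R ⊗[ℂ] V)} :
    coordSubmodule b N ≤ coordSubmodule b N' ↔ N ≤ N' :=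
  Submodule.map_le_map_iff_of_injective (tensorCoord b R).injective N N'

/-- The coordinates on the quotient of `R ⊗ V` by a submodule. -/
def coordQuotientEquiv (N : Submodule R (R ⊗[ℂ] V)) :
    ((R ⊗[ℂ] V) ⧸ N) ≃ₗ[R] ((ι → R) ⧸ coordSubmodule b N) :=
  Submodule.Quotient.equiv N _ (tensorCoord b R) rfl

theorem coordSubmodule_map {k : ℕ} (f : R →ₐ[ℂ] S) (N : Grassmannian R (R ⊗[ℂ] V) k) :
    coordSubmodule b (Grassmannian.map f N).toSubmodule =
      Submodule.span S ((f ∘ ·) '' (coordSubmodule b N.toSubmodule : Set (ι → R))) :=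
  map_toSubmodule_map (tensorCoord b R) (tensorCoord b S) f (tensorCoord_rTensor b f) N

theorem comp_mem_coordSubmodule_map {k : ℕ} (f : R →ₐ[ℂ] S) (N : Grassmannian R (R ⊗[ℂ] V) k)
    {a : ι → R} (ha : a ∈ coordSubmodule b N.toSubmodule) :
    f ∘ a ∈ coordSubmodule b (Grassmannian.map f N).toSubmodule := by
  rw [coordSubmodule_map]
  exact Submodule.subset_span ⟨a, ha, rfl⟩

/-- The point of the Grassmannian given by a submodule of `R ⊗ V`, when the quotient is projective
in coordinates. -/
def grassmannianOfCoord (N : Submodule R (R ⊗[ℂ] V)) (k : ℕ)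
    (hp : Module.Projective R ((ι → R) ⧸ coordSubmodule b N))
    (hr : ∀ p, rankAtStalk (R := R) ((ι → R) ⧸ coordSubmodule b N) p = k) :
    Grassmannian R (R ⊗[ℂ] V) k where
  toSubmodule := N
  finite_quotient := Module.Finite.equiv (coordQuotientEquiv b N).symm
  projective_quotient := Module.Projective.of_equiv (coordQuotientEquiv b N).symm
  rankAtStalk_eq p := by rw [rankAtStalk_eq_of_equiv (coordQuotientEquiv b N), hr]

theorem projective_coordSubmodule {k : ℕ} (N : Grassmannian R (R ⊗[ℂ] V) k) :
    Module.Projective R ((ι → R) ⧸ coordSubmodule b N.toSubmodule) :=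
  Module.Projective.of_equiv (coordQuotientEquiv b N.toSubmodule)

theorem rankAtStalk_coordSubmodule {k : ℕ} (N : Grassmannian R (R ⊗[ℂ] V) k)
    (p : PrimeSpectrum R) :
    rankAtStalk (R := R) ((ι → R) ⧸ coordSubmodule b N.toSubmodule) p = k := by
  rw [← rankAtStalk_eq_of_equiv (coordQuotientEquiv b N.toSubmodule), N.rankAtStalk_eq]

end Coordinates

section LinesAndPlanes

variable {V : Type v} [AddCommGroup V] [Module ℂ V] {R : Type} [CommRing R] [Algebra ℂ R]

theorem comp_cross {R S : Type*} [CommRing R] [CommRing S] (f : R →+* S) (a b : Fin 3 → R) :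
    f ∘ (a ⨯₃ b) = (f ∘ a) ⨯₃ (f ∘ b) := by
  ext i
  fin_cases i <;> simp [cross_apply]

theorem cross_eq_zero_of_mem_span {R : Type*} [CommRing R] {s : Set (Fin 3 → R)}
    (h : ∀ a ∈ s, ∀ b ∈ s, a ⨯₃ b = 0) {v w : Fin 3 → R} (hv : v ∈ Submodule.span R s)
    (hw : w ∈ Submodule.span R s) : v ⨯₃ w = 0 := by
  have hs : Submodule.span R s ≤ LinearMap.ker (crossProduct.flip w) := by
    refine Submodule.span_le.2 fun a ha => ?_
    have hspan : Submodule.span R s ≤ LinearMap.ker (crossProduct a) :=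
      Submodule.span_le.2 fun b hb => h a ha b hb
    exact hspan hw
  exact hs hv

theorem eq_zero_of_forall_isLocalRing {r : R} (h : ∀ (S : Type) [CommRing S] [Algebra ℂ S]
    [IsLocalRing S] (f : R →ₐ[ℂ] S), f r = 0) : r = 0 :=
  eq_zero_of_localization r fun J _ =>
    h (Localization.AtPrime J) (IsScalarTower.toAlgHom ℂ R (Localization.AtPrime J))

theorem span_eq_top_of_forall_field {s : Set R} (h : ∀ (K : Type) [Field K] [Algebra ℂ K]
    (f : R →ₐ[ℂ] K), ¬∀ r ∈ s, f r = 0) : Ideal.span s = ⊤ := by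
  by_contra hs
  obtain ⟨J, hJ, hsJ⟩ := Ideal.exists_le_maximal _ hs
  let : Field (R ⧸ J) := Ideal.Quotient.field J
  exact h (R ⧸ J) (Ideal.Quotient.mkₐ ℂ J) fun r hr =>
    Ideal.Quotient.eq_zero_iff_mem.2 (hsJ (Ideal.subset_span hr))

variable (b : Basis (Fin 3) ℂ V)

theorem exists_coordSubmodule_eq_span [IsLocalRing R] (N : Grassmannian R (R ⊗[ℂ] V) 2) :
    ∃ x ξ : Fin 3 → R, x ⬝ᵥ ξ = 1 ∧ coordSubmodule b N.toSubmodule = Submodule.span R {x} :=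
  have := projective_coordSubmodule b N
  exists_span_singleton_of_isLocalRing _ (rankAtStalk_coordSubmodule b N)

theorem exists_mem_coordSubmodule_iff [IsLocalRing R] (N : Grassmannian R (R ⊗[ℂ] V) 1) :
    ∃ y η : Fin 3 → R, y ⬝ᵥ η = 1 ∧ ∀ v, v ∈ coordSubmodule b N.toSubmodule ↔ v ⬝ᵥ y = 0 :=
  have := projective_coordSubmodule b N
  exists_equation_of_isLocalRing _ (rankAtStalk_coordSubmodule b N)

theorem isLine_coordSubmodule (N : Grassmannian R (R ⊗[ℂ] V) 2) :
    IsLine (coordSubmodule b N.toSubmodule) where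
  cross_eq_zero a ha a' ha' := by
    ext i
    refine eq_zero_of_forall_isLocalRing fun S _ _ _ f => ?_
    obtain ⟨x, ξ, -, hx⟩ := exists_coordSubmodule_eq_span b (Grassmannian.map f N)
    have hspan : ∀ {c}, c ∈ coordSubmodule b N.toSubmodule → f ∘ c ∈ Submodule.span S {x} :=
      fun hc => hx ▸ comp_mem_coordSubmodule_map b f N hc
    have hcross := cross_eq_zero_of_mem_span (s := {x})
      (by rintro _ rfl _ rfl; exact cross_self _) (hspan ha) (hspan ha')
    exact (congr_fun (comp_cross f.toRingHom a a') i).trans (congr_fun hcross i)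
  span_eq_top := by
    refine span_eq_top_of_forall_field fun K _ _ f hf => ?_
    obtain ⟨x, ξ, hxξ, hx⟩ := exists_coordSubmodule_eq_span b (Grassmannian.map f N)
    have hbot : Submodule.span K {x} = ⊥ := by
      rw [← hx, coordSubmodule_map, Submodule.span_eq_bot]
      rintro _ ⟨a, ha, rfl⟩
      exact funext fun i => hf _ ⟨a, ha, i, rfl⟩
    rw [Submodule.span_singleton_eq_bot.1 hbot, zero_dotProduct] at hxξ
    exact zero_ne_one hxξ

theorem isPlane_coordSubmodule (N : Grassmannian R (R ⊗[ℂ] V) 1) :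
    IsPlane (coordSubmodule b N.toSubmodule) where
  triple_product_eq_zero a₁ ha₁ a₂ ha₂ a₃ ha₃ := by
    refine eq_zero_of_forall_isLocalRing fun S _ _ _ f => ?_
    obtain ⟨y, η, hy, hN⟩ := exists_mem_coordSubmodule_iff b (Grassmannian.map f N)
    have hperp : ∀ {c}, c ∈ coordSubmodule b N.toSubmodule → (f ∘ c) ⬝ᵥ y = 0 :=
      fun hc => (hN _).1 (comp_mem_coordSubmodule_map b f N hc)
    have hzero := triple_product_smul_eq_zero (hperp ha₁) (hperp ha₂) (hperp ha₃)
    have hmap : f (a₁ ⬝ᵥ a₂ ⨯₃ a₃) = (f ∘ a₁) ⬝ᵥ (f ∘ a₂) ⨯₃ (f ∘ a₃) :=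
      (RingHom.map_dotProduct f.toRingHom _ _).trans
        (congr_arg _ (comp_cross f.toRingHom a₂ a₃))
    rw [hmap]
    exact eq_zero_of_forall_apply_smul_eq_zero hy fun i => by
      rw [smul_eq_mul, mul_comm]
      exact congr_fun hzero i
  span_eq_top := by
    refine span_eq_top_of_forall_field fun K _ _ f hf => ?_
    obtain ⟨y, η, hy, hN⟩ := exists_mem_coordSubmodule_iff b (Grassmannian.map f N)
    have hmem (i : Fin 3) : y ⨯₃ Pi.single i 1 ∈
        Submodule.span K ((f ∘ ·) '' (coordSubmodule b N.toSubmodule : Set (Fin 3 → R))) := by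
      rw [← coordSubmodule_map, hN, dotProduct_comm, dot_self_cross]
    have hcross : ∀ c ∈ (f ∘ ·) '' (coordSubmodule b N.toSubmodule : Set (Fin 3 → R)),
        ∀ d ∈ (f ∘ ·) '' (coordSubmodule b N.toSubmodule : Set (Fin 3 → R)), c ⨯₃ d = 0 := by
      rintro _ ⟨a, ha, rfl⟩ _ ⟨a', ha', rfl⟩
      refine (comp_cross f.toRingHom a a').symm.trans ?_
      exact funext fun i => hf _ ⟨a, ha, a', ha', i, rfl⟩
    have hy_zero : y = 0 := eq_zero_of_forall_apply_smul_eq_zero hy fun n => by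
      rw [← cross_single_cross_cross_single]
      exact cross_eq_zero_of_mem_span hcross (hmem _) (hmem _)
    rw [hy_zero, zero_dotProduct] at hy
    exact zero_ne_one hy

end LinesAndPlanes

section BaseChangeOfGraph

variable {W : Type v} [AddCommGroup W] [Module ℂ W] {U : Submodule ℂ W}
variable (u : Basis (Fin 3) ℂ U) (e : Basis (Fin 3) ℂ (W ⧸ U)) (R : Type) [CommRing R]
  [Algebra ℂ R]

/-- The basis vectors `uᵢ` of `U`, in the exterior algebra of `R ⊗ W`. -/
def uVecR : Fin 3 → R ⊗[ℂ] ExteriorAlgebra ℂ W := Algebra.TensorProduct.includeRight ∘ uVec u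

/-- The lifts of the basis vectors `eⱼ` of `W / U`, in the exterior algebra of `R ⊗ W`. -/
def eVecR : Fin 3 → R ⊗[ℂ] ExteriorAlgebra ℂ W := Algebra.TensorProduct.includeRight ∘ eVec e

theorem isAnticommuting_uVecR_eVecR : IsAnticommuting (Sum.elim (uVecR u R) (eVecR e R)) := by
  rw [uVecR, eVecR, ← Sum.comp_elim]
  exact (isAnticommuting_uVec_eVec u e).map
    (Algebra.TensorProduct.includeRight : ExteriorAlgebra ℂ W →ₐ[ℂ] R ⊗[ℂ] _).toRingHom

theorem one_tmul_trivector (s₀ : ℂ) (s t : Fin 3 × Fin 3 → ℂ) (t₀ : ℂ) :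
    (1 : R) ⊗ₜ[ℂ] trivector ℂ (uVec u) (eVec e) (s₀, s, t, t₀) =
      trivector R (uVecR u R) (eVecR e R)
        (algebraMap ℂ R s₀, algebraMap ℂ R ∘ s, algebraMap ℂ R ∘ t, algebraMap ℂ R t₀) :=
  map_trivector (S := R) (Algebra.TensorProduct.includeRight : _ →ₐ[ℂ] R ⊗[ℂ] _) s₀ s t t₀

theorem topWedge_uVecR_mul_topWedge_eVecR : topWedge (uVecR u R) * topWedge (eVecR e R) =
    1 ⊗ₜ[ℂ] (topWedge (uVec u) * topWedge (eVec e)) := by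
  simp only [topWedge, uVecR, eVecR, Function.comp_apply,
    Algebra.TensorProduct.includeRight_apply, Algebra.TensorProduct.tmul_mul_tmul, mul_one]

variable {R}

theorem eq_zero_of_smul_topWedge_uVecR_mul_topWedge_eVecR (r : R)
    (hr : r • (topWedge (uVecR u R) * topWedge (eVecR e R)) = 0) : r = 0 := by
  obtain ⟨φ, hφ⟩ := Module.Projective.exists_dual_ne_zero ℂ (topWedge_mul_topWedge_ne_zero u e)
  have hzero := congr_arg (TensorProduct.rid ℂ R ∘ φ.lTensor R) hr
  rw [topWedge_uVecR_mul_topWedge_eVecR, TensorProduct.smul_tmul', smul_eq_mul, mul_one] at hzero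
  simp only [Function.comp_apply, LinearMap.lTensor_tmul, TensorProduct.rid_tmul, map_zero] at hzero
  exact (smul_eq_zero_iff_right hφ).1 hzero

/-- The trivectors with coefficients in the graph of `M`, as a function of the coefficients in
`⋀³ U` and `U ⊗ ⋀² E`. -/
def graphMap {R : Type*} [CommRing R] (M : Matrix (Fin 3 × Fin 3) (Fin 3 × Fin 3) R) :
    R × (Fin 3 × Fin 3 → R) →ₗ[R] R × (Fin 3 × Fin 3 → R) × (Fin 3 × Fin 3 → R) × R :=
  (LinearMap.fst _ _ _).prod ((M.mulVecLin ∘ₗ LinearMap.snd _ _ _).prod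
    ((LinearMap.snd _ _ _).prod 0))

theorem graphMap_apply {R : Type*} [CommRing R] (M : Matrix (Fin 3 × Fin 3) (Fin 3 × Fin 3) R)
    (s₀ : R) (t : Fin 3 × Fin 3 → R) : graphMap M (s₀, t) = (s₀, M *ᵥ t, t, 0) :=
  rfl

variable {u e} {A : Submodule ℂ (ExteriorAlgebra ℂ W)}
  {G : Matrix (Fin 3 × Fin 3) (Fin 3 × Fin 3) ℂ}

variable (u e R G) in
theorem trivector_graphMap_algebraMap (s₀ : ℂ) (t : Fin 3 × Fin 3 → ℂ) :
    trivector R (uVecR u R) (eVecR e R) (graphMap (G.map (algebraMap ℂ R))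
        (algebraMap ℂ R s₀, algebraMap ℂ R ∘ t)) =
      1 ⊗ₜ[ℂ] trivector ℂ (uVec u) (eVec e) (graphMap G (s₀, t)) := by
  have hmap : G.map (algebraMap ℂ R) *ᵥ (algebraMap ℂ R ∘ t) = algebraMap ℂ R ∘ (G *ᵥ t) :=
    funext fun kl => (RingHom.map_mulVec _ _ _ _).symm
  rw [graphMap_apply, graphMap_apply, one_tmul_trivector, hmap, map_zero]

theorem IsGraphOf.baseChange_eq_range (hG : IsGraphOf u e A G) : A.baseChange R =
    LinearMap.range (trivector R (uVecR u R) (eVecR e R) ∘ₗ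
      graphMap (G.map (algebraMap ℂ R))) := by
  set φ := trivector R (uVecR u R) (eVecR e R) ∘ₗ graphMap (G.map (algebraMap ℂ R))
  apply le_antisymm
  · rw [Submodule.baseChange_eq_span, Submodule.span_le]
    rintro _ ⟨a, ha, rfl⟩
    obtain ⟨⟨s₀, s, t, t₀⟩, rfl⟩ := exteriorPower_three_eq_range u e ▸ hG.le_exteriorPower ha
    obtain ⟨rfl, rfl⟩ := (hG.trivector_mem_iff _ _ _ _).1 ha
    exact ⟨(algebraMap ℂ R s₀, algebraMap ℂ R ∘ t), trivector_graphMap_algebraMap u e R G s₀ t⟩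
  · rintro _ ⟨⟨s₀, t⟩, rfl⟩
    have hmem : ∀ s₀ t, φ (algebraMap ℂ R s₀, algebraMap ℂ R ∘ t) ∈ A.baseChange R := by
      intro s₀ t
      refine (trivector_graphMap_algebraMap u e R G s₀ t).symm ▸
        Submodule.tmul_mem_baseChange_of_mem _ ?_
      exact (hG.trivector_mem_iff _ _ _ _).2 ⟨rfl, rfl⟩
    have hinl : φ (s₀, 0) ∈ A.baseChange R := by
      have hone := Submodule.smul_mem _ s₀ (hmem 1 0)
      rwa [← map_smul, map_one, Prod.smul_mk, smul_eq_mul, mul_one, Pi.comp_zero, map_zero,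
        Function.const_zero, smul_zero] at hone
    have hinr : φ (0, t) ∈ A.baseChange R := by
      refine (LinearMap.pi_apply_eq_sum_univ (φ ∘ₗ LinearMap.inr _ _ _) t).symm ▸
        Submodule.sum_mem _ fun ij _ => Submodule.smul_mem _ _ ?_
      have hsingle : (fun kl => if ij = kl then (1 : R) else 0) =
          algebraMap ℂ R ∘ (Pi.single ij 1 : _ → ℂ) := by
        ext kl
        simp [Pi.single_apply, eq_comm (a := kl), apply_ite (algebraMap ℂ R)]
      have hzero := hmem 0 (Pi.single ij 1)
      rwa [map_zero, ← hsingle] at hzero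
    have hsum : φ (s₀, t) = φ (s₀, 0) + φ (0, t) := by
      rw [← map_add, Prod.mk_add_mk, add_zero, zero_add]
    exact hsum ▸ add_mem hinl hinr

theorem IsGraphOf.trivector_mem_baseChange_iff (hG : IsGraphOf u e A G) (s₀ : R)
    (s t : Fin 3 × Fin 3 → R) (t₀ : R) :
    trivector R (uVecR u R) (eVecR e R) (s₀, s, t, t₀) ∈ A.baseChange R ↔
      t₀ = 0 ∧ s = G.map (algebraMap ℂ R) *ᵥ t := by
  have hinj := (isAnticommuting_uVecR_eVecR u e R).trivector_injective
    (eq_zero_of_smul_topWedge_uVecR_mul_topWedge_eVecR u e)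
  rw [hG.baseChange_eq_range]
  constructor
  · rintro ⟨⟨s₀', t'⟩, heq⟩
    obtain ⟨-, rfl, rfl, rfl⟩ := by simpa only [Prod.mk.injEq] using hinj heq
    exact ⟨rfl, rfl⟩
  · rintro ⟨rfl, rfl⟩
    exact ⟨(s₀, t), rfl⟩

end BaseChangeOfGraph

section SplitCoordinates

variable {W : Type v} [AddCommGroup W] [Module ℂ W] {U : Submodule ℂ W}
variable (u : Basis (Fin 3) ℂ U) (e : Basis (Fin 3) ℂ (W ⧸ U))
variable (R : Type) [CommRing R] [Algebra ℂ R]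

/-- The coordinates on `R ⊗ W` with respect to the vectors `uᵢ` and the lifts of the `eⱼ`. -/
def splitCoord : (R ⊗[ℂ] W) ≃ₗ[R] (Fin 3 → R) × (Fin 3 → R) :=
  tensorCoord (adaptedBasis u e) R ≪≫ₗ LinearEquiv.sumArrowLequivProdArrow (Fin 3) (Fin 3) R R

variable {R} {S : Type} [CommRing S] [Algebra ℂ S]

theorem splitCoord_symm_apply (w : (Fin 3 → R) × (Fin 3 → R)) :
    (splitCoord u e R).symm w =
      ∑ i, w.1 i ⊗ₜ[ℂ] (u i : W) + ∑ j, w.2 j ⊗ₜ[ℂ] liftVec e j := by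
  rw [splitCoord, LinearEquiv.symm_trans_apply, tensorCoord_symm_apply, Fintype.sum_sum_type,
    coe_adaptedBasis]
  rfl

theorem splitCoord_rTensor (f : R →ₐ[ℂ] S) (z : R ⊗[ℂ] W) :
    splitCoord u e S (f.toLinearMap.rTensor W z) =
      (f ∘ (splitCoord u e R z).1, f ∘ (splitCoord u e R z).2) := by
  rw [splitCoord, LinearEquiv.trans_apply, tensorCoord_rTensor]
  rfl

theorem mkQ_liftVec (j : Fin 3) : U.mkQ (liftVec e j) = e j :=
  Function.surjInv_eq U.mkQ_surjective (e j)

theorem subtype_tensorCoord_symm (a : Fin 3 → R) :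
    U.subtype.baseChange R ((tensorCoord u R).symm a) = (splitCoord u e R).symm (a, 0) := by
  simp only [tensorCoord_symm_apply, splitCoord_symm_apply, map_sum, LinearMap.baseChange_tmul,
    Submodule.subtype_apply, Pi.zero_apply, TensorProduct.zero_tmul, Finset.sum_const_zero,
    add_zero]

theorem mkQ_splitCoord_symm (w : (Fin 3 → R) × (Fin 3 → R)) :
    U.mkQ.baseChange R ((splitCoord u e R).symm w) = (tensorCoord e R).symm w.2 := by
  have hu : ∀ i, U.mkQ (u i : W) = 0 := fun i => (Submodule.Quotient.mk_eq_zero U).2 (u i).2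
  simp only [tensorCoord_symm_apply, splitCoord_symm_apply, map_add, map_sum,
    LinearMap.baseChange_tmul, mkQ_liftVec, hu, TensorProduct.tmul_zero, Finset.sum_const_zero,
    zero_add]

theorem splitCoord_subtype (z : R ⊗[ℂ] U) :
    splitCoord u e R (U.subtype.baseChange R z) = (tensorCoord u R z, 0) := by
  rw [← LinearEquiv.eq_symm_apply, ← subtype_tensorCoord_symm, LinearEquiv.symm_apply_apply]

theorem tensorCoord_mkQ (z : R ⊗[ℂ] W) :
    tensorCoord e R (U.mkQ.baseChange R z) = (splitCoord u e R z).2 := by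
  rw [← LinearEquiv.eq_symm_apply, ← mkQ_splitCoord_symm u, LinearEquiv.symm_apply_apply]

/-- The coordinates of the elements of a submodule of `R ⊗ W`. -/
def splitSubmodule (N : Submodule R (R ⊗[ℂ] W)) : Submodule R ((Fin 3 → R) × (Fin 3 → R)) :=
  N.map (splitCoord u e R).toLinearMap

theorem mem_splitSubmodule {N : Submodule R (R ⊗[ℂ] W)} {w : (Fin 3 → R) × (Fin 3 → R)} :
    w ∈ splitSubmodule u e N ↔ (splitCoord u e R).symm w ∈ N :=
  Submodule.mem_map_equiv N (e := splitCoord u e R)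

theorem splitSubmodule_le {N N' : Submodule R (R ⊗[ℂ] W)} :
    splitSubmodule u e N ≤ splitSubmodule u e N' ↔ N ≤ N' :=
  Submodule.map_le_map_iff_of_injective (splitCoord u e R).injective N N'

theorem splitSubmodule_injective : Function.Injective (splitSubmodule u e (R := R)) :=
  Submodule.map_injective_of_injective (splitCoord u e R).injective

theorem splitSubmodule_comap_splitCoord (L : Submodule R ((Fin 3 → R) × (Fin 3 → R))) :
    splitSubmodule u e (L.comap (splitCoord u e R).toLinearMap) = L :=
  Submodule.map_comap_eq_of_surjective (splitCoord u e R).surjective L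

theorem splitSubmodule_baseChange :
    splitSubmodule u e (U.baseChange R) =
      LinearMap.range (LinearMap.inl R (Fin 3 → R) (Fin 3 → R)) := by
  ext w
  rw [splitSubmodule, Submodule.mem_map]
  constructor
  · rintro ⟨_, ⟨t, rfl⟩, heq⟩
    exact ⟨_, (splitCoord_subtype u e t).symm.trans heq⟩
  · rintro ⟨a, rfl⟩
    refine ⟨_, ⟨(tensorCoord u R).symm a, rfl⟩, (splitCoord_subtype u e _).trans ?_⟩
    rw [LinearEquiv.apply_symm_apply, LinearMap.inl_apply]

theorem splitSubmodule_map {k : ℕ} (f : R →ₐ[ℂ] S) (N : Grassmannian R (R ⊗[ℂ] W) k) :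
    splitSubmodule u e (Grassmannian.map f N).toSubmodule =
      Submodule.span S ((fun w => (f ∘ w.1, f ∘ w.2)) ''
        (splitSubmodule u e N.toSubmodule : Set ((Fin 3 → R) × (Fin 3 → R)))) :=
  map_toSubmodule_map (splitCoord u e R) (splitCoord u e S) f (splitCoord_rTensor u e f) N

theorem comp_mem_splitSubmodule_map {k : ℕ} (f : R →ₐ[ℂ] S) (N : Grassmannian R (R ⊗[ℂ] W) k)
    {w : (Fin 3 → R) × (Fin 3 → R)} (hw : w ∈ splitSubmodule u e N.toSubmodule) :
    (f ∘ w.1, f ∘ w.2) ∈ splitSubmodule u e (Grassmannian.map f N).toSubmodule := by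
  rw [splitSubmodule_map]
  exact Submodule.subset_span ⟨w, hw, rfl⟩

theorem coordSubmodule_comap (N : Submodule R (R ⊗[ℂ] W)) :
    coordSubmodule u (N.comap (U.subtype.baseChange R)) =
      (splitSubmodule u e N).comap (LinearMap.inl R _ _) := by
  ext a
  rw [mem_coordSubmodule, Submodule.mem_comap, Submodule.mem_comap, mem_splitSubmodule,
    subtype_tensorCoord_symm u e]
  rfl

theorem coordSubmodule_map_mkQ (N : Submodule R (R ⊗[ℂ] W)) :
    coordSubmodule e (N.map (U.mkQ.baseChange R)) =
      (splitSubmodule u e N).map (LinearMap.snd R _ _) := by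
  rw [coordSubmodule, splitSubmodule, ← Submodule.map_comp, ← Submodule.map_comp]
  exact congr_arg (N.map ·) (LinearMap.ext (tensorCoord_mkQ u e))

/-- The coordinates on the quotient of `R ⊗ W` by a submodule. -/
def splitQuotientEquiv (N : Submodule R (R ⊗[ℂ] W)) :
    ((R ⊗[ℂ] W) ⧸ N) ≃ₗ[R] (((Fin 3 → R) × (Fin 3 → R)) ⧸ splitSubmodule u e N) :=
  Submodule.Quotient.equiv N _ (splitCoord u e R) rfl

/-- The point of the Grassmannian given by a submodule of `R ⊗ W`, when the quotient is projective
in coordinates. -/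
def grassmannianOfSplit (N : Submodule R (R ⊗[ℂ] W)) (k : ℕ)
    (hp : Module.Projective R (((Fin 3 → R) × (Fin 3 → R)) ⧸ splitSubmodule u e N))
    (hr : ∀ p, rankAtStalk (R := R) (((Fin 3 → R) × (Fin 3 → R)) ⧸ splitSubmodule u e N) p = k) :
    Grassmannian R (R ⊗[ℂ] W) k where
  toSubmodule := N
  finite_quotient := Module.Finite.equiv (splitQuotientEquiv u e N).symm
  projective_quotient := Module.Projective.of_equiv (splitQuotientEquiv u e N).symm
  rankAtStalk_eq p := by rw [rankAtStalk_eq_of_equiv (splitQuotientEquiv u e N), hr]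

theorem projective_splitSubmodule {k : ℕ} (N : Grassmannian R (R ⊗[ℂ] W) k) :
    Module.Projective R (((Fin 3 → R) × (Fin 3 → R)) ⧸ splitSubmodule u e N.toSubmodule) :=
  Module.Projective.of_equiv (splitQuotientEquiv u e N.toSubmodule)

theorem rankAtStalk_splitSubmodule {k : ℕ} (N : Grassmannian R (R ⊗[ℂ] W) k)
    (p : PrimeSpectrum R) : rankAtStalk (R := R)
      (((Fin 3 → R) × (Fin 3 → R)) ⧸ splitSubmodule u e N.toSubmodule) p = k := by
  rw [← rankAtStalk_eq_of_equiv (splitQuotientEquiv u e N.toSubmodule), N.rankAtStalk_eq]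

theorem ι_baseChange_eq_linearCombination (z : R ⊗[ℂ] W) :
    (ExteriorAlgebra.ι ℂ).baseChange R z =
      Fintype.linearCombination R (uVecR u R) (splitCoord u e R z).1 +
        Fintype.linearCombination R (eVecR e R) (splitCoord u e R z).2 := by
  conv_lhs => rw [← (splitCoord u e R).symm_apply_apply z, splitCoord_symm_apply]
  simp only [map_add, map_sum, LinearMap.baseChange_tmul, uVecR, eVecR, uVec, eVec,
    Fintype.linearCombination_apply, Function.comp_apply,
    Algebra.TensorProduct.includeRight_apply, TensorProduct.smul_tmul', smul_eq_mul, mul_one]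

theorem ι_mul_mul_eq_trivector (z₁ z₂ z₃ : R ⊗[ℂ] W) :
    (ExteriorAlgebra.ι ℂ).baseChange R z₁ * (ExteriorAlgebra.ι ℂ).baseChange R z₂ *
        (ExteriorAlgebra.ι ℂ).baseChange R z₃ =
      trivector R (uVecR u R) (eVecR e R)
        ((splitCoord u e R z₁).1 ⬝ᵥ (splitCoord u e R z₂).1 ⨯₃ (splitCoord u e R z₃).1,
          wedge21 (splitCoord u e R z₁) (splitCoord u e R z₂) (splitCoord u e R z₃),
          wedge12 (splitCoord u e R z₁) (splitCoord u e R z₂) (splitCoord u e R z₃),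
          (splitCoord u e R z₁).2 ⬝ᵥ (splitCoord u e R z₂).2 ⨯₃ (splitCoord u e R z₃).2) := by
  simp only [ι_baseChange_eq_linearCombination u e,
    (isAnticommuting_uVecR_eVecR u e R).mul_mul_eq_trivector]

theorem wedgePow_three_le_iff {N : Submodule R (R ⊗[ℂ] W)}
    {P : Submodule R (R ⊗[ℂ] ExteriorAlgebra ℂ W)} :
    wedgePow R 3 N ≤ P ↔ ∀ w₁ ∈ splitSubmodule u e N, ∀ w₂ ∈ splitSubmodule u e N,
      ∀ w₃ ∈ splitSubmodule u e N, trivector R (uVecR u R) (eVecR e R)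
        (w₁.1 ⬝ᵥ w₂.1 ⨯₃ w₃.1, wedge21 w₁ w₂ w₃, wedge12 w₁ w₂ w₃, w₁.2 ⬝ᵥ w₂.2 ⨯₃ w₃.2) ∈ P := by
  rw [wedgePow, pow_succ, pow_two, mul_mul_le_iff]
  simp only [ι_mul_mul_eq_trivector u e, splitSubmodule, Submodule.mem_map, forall_exists_index,
    and_imp, forall_apply_eq_imp_iff₂, LinearEquiv.coe_coe]

variable {u e}

theorem IsGraphOf.wedgePow_le_iff {A : Submodule ℂ (ExteriorAlgebra ℂ W)}
    {G : Matrix (Fin 3 × Fin 3) (Fin 3 × Fin 3) ℂ} (hG : IsGraphOf u e A G)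
    {N : Submodule R (R ⊗[ℂ] W)} :
    wedgePow R 3 N ≤ A.baseChange R ↔
      InGraph (G.map (algebraMap ℂ R)) (splitSubmodule u e N) := by
  simp only [wedgePow_three_le_iff u e, hG.trivector_mem_baseChange_iff, InGraph]

end SplitCoordinates

section QuotientOfSum

variable {R : Type*} [CommRing R] {L : Submodule R ((Fin 3 → R) × (Fin 3 → R))}

theorem IsPlane.exists_quotient_equiv_prod (hH : IsPlane (L.map (LinearMap.snd R _ _))) :
    Nonempty ((((Fin 3 → R) × (Fin 3 → R)) ⧸ L) ≃ₗ[R]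
      ((Fin 3 → R) ⧸ L.comap (LinearMap.inl R _ _)) ×
        ((Fin 3 → R) ⧸ L.map (LinearMap.snd R _ _))) :=
  have := hH.projective
  Morin.exists_quotient_equiv_prod Prod.snd_surjective Function.Exact.inl_snd L

theorem IsPlane.projective_iff_comap_inl (hH : IsPlane (L.map (LinearMap.snd R _ _))) :
    Module.Projective R (((Fin 3 → R) × (Fin 3 → R)) ⧸ L) ↔
      Module.Projective R ((Fin 3 → R) ⧸ L.comap (LinearMap.inl R _ _)) := by
  obtain ⟨E⟩ := hH.exists_quotient_equiv_prod
  have := hH.projective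
  refine ⟨fun _ => ?_, fun _ => Module.Projective.of_equiv E.symm⟩
  exact Module.Projective.of_split (E.symm.toLinearMap ∘ₗ LinearMap.inl R _ _)
    (LinearMap.fst R _ _ ∘ₗ E.toLinearMap) (LinearMap.ext fun x =>
      congr_arg Prod.fst (E.apply_symm_apply (x, 0)))

theorem IsPlane.rankAtStalk_eq_comap_inl (hH : IsPlane (L.map (LinearMap.snd R _ _)))
    [Module.Projective R ((Fin 3 → R) ⧸ L.comap (LinearMap.inl R _ _))] (p : PrimeSpectrum R) :
    rankAtStalk (R := R) (((Fin 3 → R) × (Fin 3 → R)) ⧸ L) p =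
      rankAtStalk (R := R) ((Fin 3 → R) ⧸ L.comap (LinearMap.inl R _ _)) p + 1 := by
  obtain ⟨E⟩ := hH.exists_quotient_equiv_prod
  have := hH.projective
  rw [rankAtStalk_eq_of_equiv E, rankAtStalk_prod, Pi.add_apply, hH.rankAtStalk_eq]

end QuotientOfSum

section Projection

variable {W : Type v} [AddCommGroup W] [Module ℂ W] {U : Submodule ℂ W}
variable {R S : CommAlgCat.{0} ℂ}

/-- `p = (ℓ, H)` consists of the intersection of `Λ` with `U` and the image of `Λ` in `W / U`. This
is the description of the tangential projection from `u` in terms of `Λ`. -/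
structure IsProjection (Λ : (Gr W 3).obj R) (p : (planeProd U).obj R) : Prop where
  fst_eq : p.1.toSubmodule = Λ.toSubmodule.comap (U.subtype.baseChange R)
  snd_eq : p.2.toSubmodule = Λ.toSubmodule.map (U.mkQ.baseChange R)

theorem IsProjection.unique {Λ : (Gr W 3).obj R} {p p' : (planeProd U).obj R}
    (h : IsProjection Λ p) (h' : IsProjection Λ p') : p = p' :=
  Prod.ext (Grassmannian.ext (h.fst_eq.trans h'.fst_eq.symm))
    (Grassmannian.ext (h.snd_eq.trans h'.snd_eq.symm))

variable (u : Basis (Fin 3) ℂ U) (e : Basis (Fin 3) ℂ (W ⧸ U))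

theorem isProjection_iff {Λ : (Gr W 3).obj R} {p : (planeProd U).obj R} :
    IsProjection Λ p ↔ (splitSubmodule u e Λ.toSubmodule).comap (LinearMap.inl R _ _) =
        coordSubmodule u p.1.toSubmodule ∧
      (splitSubmodule u e Λ.toSubmodule).map (LinearMap.snd R _ _) =
        coordSubmodule e p.2.toSubmodule := by
  rw [← coordSubmodule_comap, ← coordSubmodule_map_mkQ, (coordSubmodule_injective u).eq_iff,
    (coordSubmodule_injective e).eq_iff, eq_comm, eq_comm (a := Λ.toSubmodule.map _)]
  exact ⟨fun h => ⟨h.fst_eq, h.snd_eq⟩, fun h => ⟨h.1, h.2⟩⟩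

theorem finrank_splitSubmodule {K : Type} [Field K] [Algebra ℂ K]
    (N : Grassmannian K (K ⊗[ℂ] W) 3) : finrank K (splitSubmodule u e N.toSubmodule) = 3 := by
  have hquot : finrank K (((Fin 3 → K) × (Fin 3 → K)) ⧸ splitSubmodule u e N.toSubmodule) = 3 := by
    have hrank := rankAtStalk_splitSubmodule u e N (IsLocalRing.closedPoint K)
    rwa [rankAtStalk_eq_finrank_of_free, Pi.natCast_apply, Nat.cast_id] at hrank
  have hadd := Submodule.finrank_quotient_add_finrank (splitSubmodule u e N.toSubmodule)
  rw [finrank_prod, finrank_fin_fun] at hadd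
  lia

theorem InGraph.eq_range_inl {K : Type*} [Field K] {G : Matrix (Fin 3 × Fin 3) (Fin 3 × Fin 3) K}
    {L : Submodule K ((Fin 3 → K) × (Fin 3 → K))} (hL : InGraph G L) (hrank : finrank K L = 3)
    (hcross : ∀ w ∈ L, ∀ w' ∈ L, w.2 ⨯₃ w'.2 = 0) :
    L = LinearMap.range (LinearMap.inl K (Fin 3 → K) (Fin 3 → K)) := by
  refine Submodule.eq_of_le_of_finrank_eq
    (fun w hw => ⟨w.1, Prod.ext rfl (hL.snd_eq_zero hrank hcross hw).symm⟩) ?_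
  rw [hrank, LinearMap.finrank_range_of_inj LinearMap.inl_injective, finrank_fin_fun]

variable {u e}
variable {A : Submodule ℂ (ExteriorAlgebra ℂ W)} {G : Matrix (Fin 3 × Fin 3) (Fin 3 × Fin 3) ℂ}

theorem IsGraphOf.mem_schemeF_iff (hG : IsGraphOf u e A G) {Λ : (Gr W 3).obj R} :
    Λ ∈ (schemeF A).obj R ↔
      InGraph (G.map (algebraMap ℂ R)) (splitSubmodule u e Λ.toSubmodule) :=
  hG.wedgePow_le_iff

theorem IsGraphOf.isPlane (hG : IsGraphOf u e A G) {Λ : (Gr W 3).obj R}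
    (hΛ : Λ ∈ (schemeFMinus A U).obj R) :
    IsPlane ((splitSubmodule u e Λ.toSubmodule).map (LinearMap.snd R _ _)) where
  triple_product_eq_zero := by
    rintro _ ⟨w₁, hw₁, rfl⟩ _ ⟨w₂, hw₂, rfl⟩ _ ⟨w₃, hw₃, rfl⟩
    exact (hG.mem_schemeF_iff.1 hΛ.1 w₁ hw₁ w₂ hw₂ w₃ hw₃).1
  span_eq_top := by
    refine span_eq_top_of_forall_field fun K _ _ f hf => ?_
    let N : Grassmannian K (K ⊗[ℂ] W) 3 := Grassmannian.map f Λ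
    refine hΛ.2 (CommAlgCat.of ℂ K) (CommAlgCat.ofHom f) (Field.toIsField K)
      (splitSubmodule_injective u e ?_)
    have hN : InGraph (G.map (algebraMap ℂ K)) (splitSubmodule u e N.toSubmodule) :=
      hG.wedgePow_le_iff.1 ((schemeF A).map (CommAlgCat.ofHom f) hΛ.1)
    have hsnd : ∀ w ∈ splitSubmodule u e N.toSubmodule, w.2 ∈ Submodule.span K
        ((f ∘ ·) '' ((splitSubmodule u e Λ.toSubmodule).map (LinearMap.snd R _ _) : Set _)) := by
      intro w hw
      have hmap := Submodule.mem_map_of_mem (f := LinearMap.snd K _ _)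
        ((splitSubmodule_map u e f Λ).le hw)
      rw [Submodule.map_span, Set.image_image] at hmap
      rwa [Submodule.map_coe, Set.image_image]
    rw [splitSubmodule_baseChange]
    refine hN.eq_range_inl (finrank_splitSubmodule u e N) fun w hw w' hw' =>
      cross_eq_zero_of_mem_span ?_ (hsnd w hw) (hsnd w' hw')
    rintro _ ⟨a, ha, rfl⟩ _ ⟨a', ha', rfl⟩
    exact (comp_cross f.toRingHom a a').symm.trans
      (funext fun i => hf _ ⟨a, ha, a', ha', i, rfl⟩)

theorem IsGraphOf.exists_isProjection (hG : IsGraphOf u e A G) {Λ : (Gr W 3).obj R}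
    (hΛ : Λ ∈ (schemeFMinus A U).obj R) : ∃ p : (planeProd U).obj R, IsProjection Λ p := by
  have hH := hG.isPlane hΛ
  have hℓ := hH.projective_iff_comap_inl.1 (projective_splitSubmodule u e Λ)
  have hrank (q : PrimeSpectrum R) :=
    (rankAtStalk_splitSubmodule u e Λ q).symm.trans (hH.rankAtStalk_eq_comap_inl q)
  rw [← coordSubmodule_comap] at hℓ hrank
  have hHproj := hH.projective
  have hHrank := hH.rankAtStalk_eq
  rw [← coordSubmodule_map_mkQ] at hHproj hHrank
  exact ⟨(grassmannianOfCoord u _ 2 hℓ fun q => (Nat.succ.inj (hrank q)).symm,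
    grassmannianOfCoord e _ 1 hHproj hHrank), rfl, rfl⟩

theorem IsGraphOf.isProjection_map (hG : IsGraphOf u e A G) {Λ : (Gr W 3).obj R}
    (hΛ : Λ ∈ (schemeFMinus A U).obj R) {p : (planeProd U).obj R} (h : IsProjection Λ p)
    (f : R ⟶ S) : IsProjection ((Gr W 3).map f Λ) ((planeProd U).map f p) := by
  obtain ⟨q, hq⟩ := hG.exists_isProjection ((schemeFMinus A U).map f hΛ)
  suffices hpq : (planeProd U).map f p = q from hpq ▸ hq
  rw [isProjection_iff u e] at h hq
  refine Prod.ext (grassmannian_eq_of_le ((coordSubmodule_le u).1 ?_))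
    (grassmannian_eq_of_le ((coordSubmodule_le e).1 ?_))
  · refine (coordSubmodule_map u f.hom p.1).trans_le ?_
    rw [← hq.1, Submodule.span_le, ← h.1]
    rintro _ ⟨a, ha, rfl⟩
    have hmem := comp_mem_splitSubmodule_map u e f.hom Λ ha
    rwa [LinearMap.inl_apply, Pi.comp_zero, map_zero] at hmem
  · refine (coordSubmodule_map e f.hom p.2).trans_le ?_
    rw [← hq.2, Submodule.span_le, ← h.2]
    rintro _ ⟨_, ⟨w, hw, rfl⟩, rfl⟩
    exact ⟨_, comp_mem_splitSubmodule_map u e f.hom Λ hw, rfl⟩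

theorem IsGraphOf.eq_of_isProjection (hG : IsGraphOf u e A G) {Λ Λ' : (Gr W 3).obj R}
    (hΛ : Λ ∈ (schemeF A).obj R) (hΛ' : Λ' ∈ (schemeF A).obj R)
    {p : (planeProd U).obj R} (h : IsProjection Λ p) (h' : IsProjection Λ' p) : Λ = Λ' := by
  rw [isProjection_iff u e] at h h'
  exact grassmannian_eq_of_le ((splitSubmodule_le u e).1
    ((hG.mem_schemeF_iff.1 hΛ).le (isLine_coordSubmodule u p.1) (isPlane_coordSubmodule e p.2)
      (hG.mem_schemeF_iff.1 hΛ') h.1 h'.1 h.2 h'.2))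

theorem map_toSubmodule_ne_baseChange {Λ : (Gr W 3).obj R}
    (hH : IsPlane ((splitSubmodule u e Λ.toSubmodule).map (LinearMap.snd R _ _))) [Nontrivial S]
    (f : R ⟶ S) : ((Gr W 3).map f Λ).toSubmodule ≠ U.baseChange S := by
  intro hU
  have hzero : ∀ b ∈ (splitSubmodule u e Λ.toSubmodule).map (LinearMap.snd R _ _),
      f.hom ∘ b = 0 := by
    rintro _ ⟨w, hw, rfl⟩
    have hmem := comp_mem_splitSubmodule_map u e f.hom Λ hw
    obtain ⟨a, ha⟩ : (f.hom ∘ w.1, f.hom ∘ w.2) ∈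
        LinearMap.range (LinearMap.inl S (Fin 3 → S) (Fin 3 → S)) := by
      rw [← splitSubmodule_baseChange u e]
      exact hU ▸ hmem
    exact (congr_arg Prod.snd ha).symm
  have hker : Ideal.span {r | ∃ a ∈ (splitSubmodule u e Λ.toSubmodule).map (LinearMap.snd R _ _),
      ∃ b ∈ (splitSubmodule u e Λ.toSubmodule).map (LinearMap.snd R _ _), ∃ i, r = (a ⨯₃ b) i} ≤
        RingHom.ker f.hom.toRingHom := by
    refine Ideal.span_le.2 ?_
    rintro _ ⟨a, ha, b, -, i, rfl⟩
    have hcross : (f.hom ∘ a) ⨯₃ (f.hom ∘ b) = 0 := by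
      rw [hzero a ha, map_zero, LinearMap.zero_apply]
    exact congr_fun ((comp_cross f.hom.toRingHom a b).trans hcross) i
  exact RingHom.ker_ne_top _ (top_le_iff.1 (hH.span_eq_top ▸ hker))

theorem IsGraphOf.exists_mem_schemeFMinus (hG : IsGraphOf u e A G) {p : (planeProd U).obj R}
    (hs : IsSingular (G.map (algebraMap ℂ R)) (coordSubmodule u p.1.toSubmodule)
      (coordSubmodule e p.2.toSubmodule)) :
    ∃ Λ ∈ (schemeFMinus A U).obj R, IsProjection Λ p := by
  have hℓ := isLine_coordSubmodule u p.1
  have hH := isPlane_coordSubmodule e p.2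
  set L := reconstruct (G.map (algebraMap ℂ R)) (coordSubmodule u p.1.toSubmodule)
    (coordSubmodule e p.2.toSubmodule)
  let N : Submodule R (R ⊗[ℂ] W) := L.comap (splitCoord u e R).toLinearMap
  have hN : splitSubmodule u e N = L := splitSubmodule_comap_splitCoord u e L
  have hinl : (splitSubmodule u e N).comap (LinearMap.inl R _ _) =
      coordSubmodule u p.1.toSubmodule := hN ▸ comap_inl_reconstruct hℓ hH
  have hsnd : (splitSubmodule u e N).map (LinearMap.snd R _ _) =
      coordSubmodule e p.2.toSubmodule := hN ▸ map_snd_reconstruct hℓ hH hs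
  have hplane : IsPlane ((splitSubmodule u e N).map (LinearMap.snd R _ _)) := hsnd ▸ hH
  have hproj : Module.Projective R
      ((Fin 3 → R) ⧸ (splitSubmodule u e N).comap (LinearMap.inl R _ _)) :=
    hinl ▸ projective_coordSubmodule u p.1
  let Λ : (Gr W 3).obj R := grassmannianOfSplit u e N 3 (hplane.projective_iff_comap_inl.2 hproj)
    fun q => by
      rw [hplane.rankAtStalk_eq_comap_inl, hinl]
      exact congr_arg (· + 1) (rankAtStalk_coordSubmodule u p.1 q)
  refine ⟨Λ, ⟨hG.mem_schemeF_iff.2 (hN ▸ inGraph_reconstruct hℓ hH hs), fun K f hK => ?_⟩,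
    (isProjection_iff u e).2 ⟨hinl, hsnd⟩⟩
  have := hK.nontrivial
  exact map_toSubmodule_ne_baseChange hplane f

end Projection

section TangentialProjection

variable {W : Type v} [AddCommGroup W] [Module ℂ W] {U : Submodule ℂ W}
variable (u : Basis (Fin 3) ℂ U) (e : Basis (Fin 3) ℂ (W ⧸ U))
variable {R : Type} [CommRing R] [Algebra ℂ R]

theorem trivector_mem_baseChange {P : Submodule ℂ (ExteriorAlgebra ℂ W)} {s : Fin 3 × Fin 3 → ℂ}
    (hone : topWedge (uVec u) ∈ P) (hs : trivector ℂ (uVec u) (eVec e) (0, s, 0, 0) ∈ P)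
    (s₀ r : R) : trivector R (uVecR u R) (eVecR e R) (s₀, r • (algebraMap ℂ R ∘ s), 0, 0) ∈
      P.baseChange R := by
  have hsum : ((s₀, r • (algebraMap ℂ R ∘ s), 0, 0) :
      R × (Fin 3 × Fin 3 → R) × (Fin 3 × Fin 3 → R) × R) =
        s₀ • (1, 0, 0, 0) + r • (0, algebraMap ℂ R ∘ s, 0, 0) := by
    simp only [Prod.smul_mk, Prod.mk_add_mk, smul_eq_mul, mul_one, mul_zero, smul_zero, add_zero,
      zero_add]
  have htop : trivector R (uVecR u R) (eVecR e R) (1, 0, 0, 0) = 1 ⊗ₜ[ℂ] topWedge (uVec u) := by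
    simp only [← topWedge_eq_trivector, topWedge, uVecR, Function.comp_apply,
      Algebra.TensorProduct.includeRight_apply, Algebra.TensorProduct.tmul_mul_tmul, mul_one]
  have htmul := one_tmul_trivector u e R 0 s 0 0
  rw [Pi.comp_zero, map_zero, Function.const_zero] at htmul
  rw [hsum, map_add, map_smul, map_smul, htop, ← htmul]
  exact add_mem (Submodule.smul_mem _ _ (Submodule.tmul_mem_baseChange_of_mem _ hone))
    (Submodule.smul_mem _ _ (Submodule.tmul_mem_baseChange_of_mem _ hs))

theorem trivector_mem_baseChange_filt (s₀ : R) (s : Fin 3 × Fin 3 → R) :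
    trivector R (uVecR u R) (eVecR e R) (s₀, s, 0, 0) ∈ (filt U 2).baseChange R := by
  have htop : topWedge (uVec u) ∈ filt U 2 :=
    (mem_filt_two_iff u e).2 ⟨1, 0, topWedge_eq_trivector _ _⟩
  have hmem (s₀ r : R) (s : Fin 3 × Fin 3 → ℂ) := trivector_mem_baseChange u e htop
    ((mem_filt_two_iff u e).2 ⟨0, s, rfl⟩) s₀ r
  have hs : s = ∑ kl, s kl • (algebraMap ℂ R ∘ (Pi.single kl 1 : Fin 3 × Fin 3 → ℂ)) := by
    ext ij
    simp [Pi.single_apply, apply_ite (algebraMap ℂ R)]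
  have hsum : ((s₀, s, 0, 0) : R × (Fin 3 × Fin 3 → R) × (Fin 3 × Fin 3 → R) × R) =
      (s₀, (0 : R) • (algebraMap ℂ R ∘ (0 : Fin 3 × Fin 3 → ℂ)), 0, 0) +
        ∑ kl, (0, s kl • (algebraMap ℂ R ∘ (Pi.single kl 1 : Fin 3 × Fin 3 → ℂ)), 0, 0) := by
    simp only [Prod.ext_iff, Prod.fst_add, Prod.snd_add, Prod.fst_sum, Prod.snd_sum, zero_smul,
      Finset.sum_const_zero, add_zero, zero_add, ← hs, and_self]
  rw [hsum, map_add, map_sum]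
  exact add_mem (hmem _ _ _) (Submodule.sum_mem _ fun kl _ => hmem _ _ _)

variable {u e}

theorem trivector_mem_iff_of_filt_le {P : Submodule R (R ⊗[ℂ] ExteriorAlgebra ℂ W)}
    (hP : (filt U 2).baseChange R ≤ P) {s₀ : R} {s t : Fin 3 × Fin 3 → R} {t₀ : R} :
    trivector R (uVecR u R) (eVecR e R) (s₀, s, t, t₀) ∈ P ↔
      trivector R (uVecR u R) (eVecR e R) (0, 0, t, t₀) ∈ P := by
  have hsum : ((s₀, s, t, t₀) : R × (Fin 3 × Fin 3 → R) × (Fin 3 × Fin 3 → R) × R) =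
      (s₀, s, 0, 0) + (0, 0, t, t₀) := by
    simp only [Prod.mk_add_mk, add_zero, zero_add]
  rw [hsum, map_add, Submodule.add_mem_iff_right _ (hP (trivector_mem_baseChange_filt u e s₀ s))]

theorem wedgePow_three_le_iff_of_filt_le {N : Submodule R (R ⊗[ℂ] W)}
    {P : Submodule R (R ⊗[ℂ] ExteriorAlgebra ℂ W)} (hP : (filt U 2).baseChange R ≤ P) :
    wedgePow R 3 N ≤ P ↔ ∀ w₁ ∈ splitSubmodule u e N, ∀ w₂ ∈ splitSubmodule u e N,
      ∀ w₃ ∈ splitSubmodule u e N, trivector R (uVecR u R) (eVecR e R)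
        (0, 0, wedge12 w₁ w₂ w₃, w₁.2 ⬝ᵥ w₂.2 ⨯₃ w₃.2) ∈ P := by
  simp only [wedgePow_three_le_iff u e, trivector_mem_iff_of_filt_le hP]

theorem wedgePow_one_mul_wedgePow_two_le_iff_of_filt_le {ℓ : Submodule R (R ⊗[ℂ] U)}
    {H : Submodule R (R ⊗[ℂ] (W ⧸ U))} {P : Submodule R (R ⊗[ℂ] ExteriorAlgebra ℂ W)}
    (hP : (filt U 2).baseChange R ≤ P) :
    wedgePow R 1 (ℓ.map (U.subtype.baseChange R)) *
        wedgePow R 2 (H.comap (U.mkQ.baseChange R)) ≤ P ↔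
      ∀ x ∈ coordSubmodule u ℓ, ∀ h ∈ coordSubmodule e H, ∀ h' ∈ coordSubmodule e H,
        trivector R (uVecR u R) (eVecR e R) (0, 0, segre x (h ⨯₃ h'), 0) ∈ P := by
  have hprod : ∀ z₁ z₂ z₃, (ExteriorAlgebra.ι ℂ).baseChange R (U.subtype.baseChange R z₁) *
      (ExteriorAlgebra.ι ℂ).baseChange R z₂ * (ExteriorAlgebra.ι ℂ).baseChange R z₃ ∈ P ↔
        trivector R (uVecR u R) (eVecR e R) (0, 0, segre (tensorCoord u R z₁)
          (tensorCoord e R (U.mkQ.baseChange R z₂) ⨯₃ tensorCoord e R (U.mkQ.baseChange R z₃)),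
            0) ∈ P := by
    intro z₁ z₂ z₃
    rw [ι_mul_mul_eq_trivector u e, trivector_mem_iff_of_filt_le hP, splitCoord_subtype,
      wedge12_mk_zero, zero_dotProduct, tensorCoord_mkQ u e, tensorCoord_mkQ u e]
  have hsurj : Function.Surjective (U.mkQ.baseChange R) :=
    LinearMap.lTensor_surjective R U.mkQ_surjective
  rw [wedgePow, wedgePow, pow_one, sq, ← mul_assoc, mul_mul_le_iff]
  simp only [coordSubmodule, Submodule.mem_map, Submodule.mem_comap, forall_exists_index, and_imp,
    forall_apply_eq_imp_iff₂, hprod, LinearEquiv.coe_coe]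
  refine forall₂_congr fun x _ => ⟨fun h y hy y' hy' => ?_, fun h z hz z' hz' => h _ hz _ hz'⟩
  obtain ⟨z, rfl⟩ := hsurj y
  obtain ⟨z', rfl⟩ := hsurj y'
  exact h z hy z' hy'

variable {A : Submodule ℂ (ExteriorAlgebra ℂ W)} {G : Matrix (Fin 3 × Fin 3) (Fin 3 × Fin 3) ℂ}

theorem IsGraphOf.isTangentialProjection (hG : IsGraphOf u e A G) {R : CommAlgCat.{0} ℂ}
    {Λ : (Gr W 3).obj R} (hΛ : Λ ∈ (schemeF A).obj R) {p : (planeProd U).obj R}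
    (h : IsProjection Λ p) : IsTangentialProjection Λ p := by
  have hH := isPlane_coordSubmodule e p.2
  have hL := hG.mem_schemeF_iff.1 hΛ
  obtain ⟨hinl, hsnd⟩ := (isProjection_iff u e).1 h
  refine le_antisymm (sup_le ?_ le_sup_right) (sup_le ?_ le_sup_right)
  · refine (wedgePow_three_le_iff_of_filt_le (u := u) (e := e) le_sup_right).2
      fun w₁ hw₁ w₂ hw₂ w₃ hw₃ => ?_
    refine Submodule.mem_of_span_top_of_smul_mem _ _ hH.span_eq_top _ ?_
    rintro ⟨_, b, hb, b', hb', n, rfl⟩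
    obtain ⟨x, hx, hxb⟩ := hL.exists_mem_smul_wedge12 hinl hsnd hH hw₁ hw₂ hw₃ hb hb' n
    have hmem := (wedgePow_one_mul_wedgePow_two_le_iff_of_filt_le (u := u) (e := e)
      le_sup_right).1 le_sup_left x hx b hb b' hb'
    rw [(hL w₁ hw₁ w₂ hw₂ w₃ hw₃).1, ← map_smul]
    simpa only [Prod.smul_mk, smul_zero, hxb] using hmem
  · refine (wedgePow_one_mul_wedgePow_two_le_iff_of_filt_le (u := u) (e := e) le_sup_right).2
      fun x hx h hh h' hh' => ?_
    rw [← hinl] at hx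
    rw [← hsnd] at hh hh'
    obtain ⟨w, hw, rfl⟩ := hh
    obtain ⟨w', hw', rfl⟩ := hh'
    have hmem := (wedgePow_three_le_iff_of_filt_le (u := u) (e := e) le_sup_right).1
      le_sup_left _ hx w hw w' hw'
    rwa [LinearMap.inl_apply, wedge12_mk_zero, zero_dotProduct] at hmem

end TangentialProjection

section Tangent

theorem smul_mulVec_cross_smul_mulVec {R : Type*} [CommRing R] {c : R} (hc : c * c = 0)
    (M : Matrix (Fin 3) (Fin 3) R) (a b : Fin 3 → R) : ((c • M) *ᵥ a) ⨯₃ ((c • M) *ᵥ b) = 0 := by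
  rw [Matrix.smul_mulVec, Matrix.smul_mulVec, map_smul, map_smul, LinearMap.smul_apply, smul_smul,
    hc, zero_smul]

theorem wedge21_graph {R : Type*} [CommRing R] (M : Matrix (Fin 3) (Fin 3) R)
    (a₁ a₂ a₃ : Fin 3 → R) :
    wedge21 (a₁, M *ᵥ a₁) (a₂, M *ᵥ a₂) (a₃, M *ᵥ a₃) =
      (a₁ ⬝ᵥ a₂ ⨯₃ a₃) • fun kl => M kl.2 kl.1 := by
  ext ⟨k, l⟩
  fin_cases k <;>
  · simp [wedge21, segre_apply, cross_apply, Matrix.mulVec, dotProduct, Fin.sum_univ_three]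
    ring

variable {W : Type v} [AddCommGroup W] [Module ℂ W] {U : Submodule ℂ W}
variable (u : Basis (Fin 3) ℂ U) (e : Basis (Fin 3) ℂ (W ⧸ U))
variable {R S : Type} [CommRing R] [Algebra ℂ R] [CommRing S] [Algebra ℂ S]

/-- The point of the Grassmannian over `R` given by the graph of the homomorphism `U → W / U` with
matrix `M`. -/
def graphPlane (M : Matrix (Fin 3) (Fin 3) R) : Grassmannian R (R ⊗[ℂ] W) 3 :=
  have E : (((Fin 3 → R) × (Fin 3 → R)) ⧸ splitSubmodule u e
      (M.mulVecLin.graph.comap (splitCoord u e R).toLinearMap)) ≃ₗ[R] Fin 3 → R :=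
    Submodule.quotEquivOfEq _ _ ((splitSubmodule_comap_splitCoord u e _).trans
      (LinearMap.graph_eq_ker_coprod _)) ≪≫ₗ
        LinearMap.quotKerEquivOfSurjective _ fun b => ⟨(0, b), by simp⟩
  grassmannianOfSplit u e _ 3 (Module.Projective.of_equiv E.symm) fun p => by
    have := p.nontrivial
    rw [rankAtStalk_eq_of_equiv E, rankAtStalk_eq_finrank_of_free, finrank_fin_fun,
      Pi.natCast_apply, Nat.cast_id]

theorem splitSubmodule_graphPlane (M : Matrix (Fin 3) (Fin 3) R) :
    splitSubmodule u e (graphPlane u e M).toSubmodule = M.mulVecLin.graph :=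
  splitSubmodule_comap_splitCoord u e _

theorem graphPlane_zero :
    (graphPlane u e (0 : Matrix (Fin 3) (Fin 3) R)).toSubmodule = U.baseChange R := by
  refine splitSubmodule_injective u e ?_
  rw [splitSubmodule_graphPlane, splitSubmodule_baseChange]
  ext w
  rw [LinearMap.mem_graph_iff, Matrix.mulVecLin_apply, Matrix.zero_mulVec]
  exact ⟨fun h => ⟨w.1, Prod.ext rfl h.symm⟩, by rintro ⟨a, rfl⟩; rfl⟩

theorem map_graphPlane (f : R →ₐ[ℂ] S) (M : Matrix (Fin 3) (Fin 3) R) :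
    Grassmannian.map f (graphPlane u e M) = graphPlane u e (M.map f) := by
  refine grassmannian_eq_of_le ((splitSubmodule_le u e).1 ?_)
  rw [splitSubmodule_map, splitSubmodule_graphPlane, splitSubmodule_graphPlane, Submodule.span_le]
  rintro _ ⟨w, hw, rfl⟩
  rw [SetLike.mem_coe, LinearMap.mem_graph_iff] at hw ⊢
  exact (congr_arg (f ∘ ·) hw).trans (funext fun i => f.toRingHom.map_mulVec M w.1 i)

variable {A : Submodule ℂ (ExteriorAlgebra ℂ W)}

theorem graphPlane_mem_schemeF {R : CommAlgCat.{0} ℂ} {c : R} (hc : c * c = 0)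
    (hone : topWedge (uVec u) ∈ A) {s : Fin 3 × Fin 3 → ℂ}
    (hs : trivector ℂ (uVec u) (eVec e) (0, s, 0, 0) ∈ A) :
    (graphPlane u e (c • Matrix.of fun l k => algebraMap ℂ R (s (k, l))) : (Gr W 3).obj R) ∈
      (schemeF A).obj R := by
  refine (wedgePow_three_le_iff u e).2 ?_
  rw [splitSubmodule_graphPlane]
  set M : Matrix (Fin 3) (Fin 3) R := Matrix.of fun l k => algebraMap ℂ R (s (k, l))
  have hgraph : ∀ w ∈ (c • M).mulVecLin.graph, ∃ a, w = (a, (c • M) *ᵥ a) :=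
    fun w hw => ⟨w.1, Prod.ext rfl hw⟩
  intro w₁ hw₁ w₂ hw₂ w₃ hw₃
  obtain ⟨a₁, rfl⟩ := hgraph _ hw₁
  obtain ⟨a₂, rfl⟩ := hgraph _ hw₂
  obtain ⟨a₃, rfl⟩ := hgraph _ hw₃
  simp only [wedge21_graph, wedge12, smul_mulVec_cross_smul_mulVec hc,
    dotProduct_zero, map_zero, add_zero]
  set d := a₁ ⬝ᵥ a₂ ⨯₃ a₃
  have hcoeff : (d • fun kl : Fin 3 × Fin 3 => (c • M) kl.2 kl.1) =
      (d * c) • (algebraMap ℂ R ∘ s) := funext fun _ => (mul_assoc d c _).symm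
  rw [hcoeff]
  exact trivector_mem_baseChange u e hone hs d (d * c)

theorem TangentZeroAt.isTransversal (hsm : TangentZeroAt A U)
    (huA : U.map (ExteriorAlgebra.ι ℂ) ^ 3 ≤ A) : IsTransversal u e A := by
  intro s hs
  set M : Matrix (Fin 3) (Fin 3) (DualNumber ℂ) :=
    (DualNumber.eps : DualNumber ℂ) • Matrix.of fun l k => algebraMap ℂ _ (s (k, l))
  have hmap : M.map (TrivSqZeroExt.fstHom ℂ ℂ ℂ) = 0 := by
    ext l k
    simp [M]
  have hconst : (graphPlane u e M).toSubmodule = U.baseChange (DualNumber ℂ) := by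
    refine hsm (graphPlane u e M)
      (graphPlane_mem_schemeF u e DualNumber.eps_mul_eps (topWedge_uVec_mem u huA) hs) ?_
    rw [map_graphPlane, hmap, graphPlane_zero]
  have hM : M.mulVecLin.graph = LinearMap.range (LinearMap.inl _ _ _) := by
    rw [← splitSubmodule_graphPlane u e, hconst, splitSubmodule_baseChange]
  ext ⟨k, l⟩
  obtain ⟨a, ha⟩ := hM.le (show (Pi.single k 1, M *ᵥ Pi.single k 1) ∈ M.mulVecLin.graph from rfl)
  have hentry := congr_arg TrivSqZeroExt.snd (congr_fun (congr_arg Prod.snd ha) l)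
  rw [Matrix.mulVec_single_one] at hentry
  simpa [M, TrivSqZeroExt.algebraMap_eq_inl] using hentry.symm

end Tangent

section HomogeneousCoordinates

theorem coordSubmodule_span_singleton {ι : Type*} [Fintype ι] {V : Type v} [AddCommGroup V]
    [Module ℂ V] {R : Type} [CommRing R] [Algebra ℂ R] (b : Basis ι ℂ V) (x : ι → R) :
    coordSubmodule b (Submodule.span R {∑ i, x i ⊗ₜ[ℂ] b i}) = Submodule.span R {x} := by
  rw [coordSubmodule, Submodule.map_span, Set.image_singleton, ← tensorCoord_symm_apply,
    LinearEquiv.coe_coe, LinearEquiv.apply_symm_apply]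

theorem mem_coordSubmodule_ker_constr {ι : Type*} [Fintype ι] {V : Type v} [AddCommGroup V]
    [Module ℂ V] {R : Type} [CommRing R] [Algebra ℂ R] (b : Basis ι ℂ V) (y a : ι → R) :
    a ∈ coordSubmodule b (LinearMap.ker ((b.baseChange R).constr R y)) ↔ a ⬝ᵥ y = 0 := by
  rw [mem_coordSubmodule, LinearMap.mem_ker, Basis.constr_apply_fintype, ← tensorCoord,
    LinearEquiv.apply_symm_apply]
  rfl

theorem contr_map {R S : Type*} [CommRing R] [CommRing S] (f : R →+* S)
    (G : Matrix (Fin 3 × Fin 3) (Fin 3 × Fin 3) R) (x y : Fin 3 → R) :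
    contr (G.map f) (f ∘ x) (f ∘ y) = (contr G x y).map f := by
  ext k l
  have hsegre : segre (f ∘ x) (f ∘ y) = f ∘ segre x y := funext fun kl => by
    simp only [segre_apply, Function.comp_apply, map_mul]
  rw [contr, Matrix.of_apply, hsegre, ← f.map_mulVec]
  rfl

theorem map_contr_map_algebraMap {R S : Type*} [CommRing R] [Algebra ℂ R] [CommRing S] [Algebra ℂ S]
    (f : R →ₐ[ℂ] S) (G : Matrix (Fin 3 × Fin 3) (Fin 3 × Fin 3) ℂ) {x y : Fin 3 → R}
    {x₀ y₀ : Fin 3 → S} {r t : S} (hx : f ∘ x = r • x₀) (hy : f ∘ y = t • y₀) :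
    (contr (G.map (algebraMap ℂ R)) x y).map f =
      (r * t) • contr (G.map (algebraMap ℂ S)) x₀ y₀ := by
  have hGf : (G.map (algebraMap ℂ R)).map f = G.map (algebraMap ℂ S) :=
    Matrix.ext fun i j => f.commutes (G i j)
  rw [← contr_smul_smul, ← hx, ← hy, ← hGf]
  exact (contr_map f.toRingHom _ x y).symm

variable {W : Type v} [AddCommGroup W] [Module ℂ W] {U : Submodule ℂ W}
variable {u : Basis (Fin 3) ℂ U} {e : Basis (Fin 3) ℂ (W ⧸ U)} {R : CommAlgCat.{0} ℂ}

theorem isCoord_iff {p : (planeProd U).obj R} {x y : Fin 3 → R} :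
    IsCoord u e p x y ↔ coordSubmodule u p.1.toSubmodule = Submodule.span R {x} ∧
      (∃ η, y ⬝ᵥ η = 1) ∧ ∀ a, a ∈ coordSubmodule e p.2.toSubmodule ↔ a ⬝ᵥ y = 0 := by
  rw [IsCoord, ← coordSubmodule_span_singleton u, (coordSubmodule_injective u).eq_iff,
    ← (coordSubmodule_injective e).eq_iff, SetLike.ext_iff (p := coordSubmodule e _),
    Ideal.eq_top_iff_one, Ideal.mem_span_range_iff_exists_fun]
  simp only [mem_coordSubmodule_ker_constr, dotProduct, mul_comm]

theorem exists_isCoord [IsLocalRing R] (p : (planeProd U).obj R) : ∃ x y, IsCoord u e p x y := by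
  obtain ⟨x, -, -, hx⟩ := exists_coordSubmodule_eq_span u p.1
  obtain ⟨y, η, hη, hy⟩ := exists_mem_coordSubmodule_iff e p.2
  exact ⟨x, y, isCoord_iff.2 ⟨hx, ⟨η, hη⟩, hy⟩⟩

variable {κ : ℂ} {G : Matrix (Fin 3 × Fin 3) (Fin 3 × Fin 3) ℂ}

theorem mem_singScheme_biquadratic_iff (hκ : κ ≠ 0) (hG : G.IsSymm) {p : (planeProd U).obj R} :
    p ∈ (singScheme u e (biquadratic κ G)).obj R ↔
      ∀ (S : CommAlgCat.{0} ℂ) (h : R ⟶ S) (x y : Fin 3 → S),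
        IsCoord u e ((planeProd U).map h p) x y → IsSingularAt (G.map (algebraMap ℂ S)) x y :=
  forall₅_congr fun _ _ x y _ => (isSingularAt_iff_forall_aeval_addEps hκ hG x y).symm

theorem exists_isSingularAt_of_mem_singScheme (hκ : κ ≠ 0) (hG : G.IsSymm)
    {p : (planeProd U).obj R} (hp : p ∈ (singScheme u e (biquadratic κ G)).obj R)
    {S : Type} [CommRing S] [Algebra ℂ S] [IsLocalRing S] (f : R →ₐ[ℂ] S) :
    ∃ x y : Fin 3 → S, IsSingularAt (G.map (algebraMap ℂ S)) x y ∧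
      (∀ a ∈ coordSubmodule u p.1.toSubmodule, ∃ r : S, f ∘ a = r • x) ∧
      ∀ a ∈ coordSubmodule e p.2.toSubmodule, ∀ b ∈ coordSubmodule e p.2.toSubmodule,
        ∃ r : S, f ∘ (a ⨯₃ b) = r • y := by
  let φ : R ⟶ CommAlgCat.of ℂ S := CommAlgCat.ofHom f
  have : IsLocalRing (CommAlgCat.of ℂ S) := ‹IsLocalRing S›
  obtain ⟨x, y, hxy⟩ := exists_isCoord (u := u) (e := e) ((planeProd U).map φ p)
  obtain ⟨hx, ⟨η, hη⟩, hy⟩ := isCoord_iff.1 hxy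
  refine ⟨x, y, (mem_singScheme_biquadratic_iff hκ hG).1 hp _ φ x y hxy, fun a ha => ?_,
    fun a ha b hb => ?_⟩
  · obtain ⟨r, hr⟩ := Submodule.mem_span_singleton.1
      (hx.le (comp_mem_coordSubmodule_map u f p.1 ha))
    exact ⟨r, hr.symm⟩
  · have hperp : ∀ c ∈ coordSubmodule e p.2.toSubmodule, (f ∘ c) ⬝ᵥ y = 0 :=
      fun c hc => (hy _).1 (comp_mem_coordSubmodule_map e f p.2 hc)
    exact ⟨_, (comp_cross f.toRingHom a b).trans
      (cross_eq_smul_of_dotProduct_eq_zero hη (hperp a ha) (hperp b hb))⟩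

theorem isSingular_of_mem_singScheme (hκ : κ ≠ 0) (hG : G.IsSymm) {p : (planeProd U).obj R}
    (hp : p ∈ (singScheme u e (biquadratic κ G)).obj R) :
    IsSingular (G.map (algebraMap ℂ R)) (coordSubmodule u p.1.toSubmodule)
      (coordSubmodule e p.2.toSubmodule) := by
  constructor
  · intro x hx x' hx' h hh h' hh'
    ext l
    refine eq_zero_of_forall_isLocalRing fun S _ _ _ f => ?_
    obtain ⟨x₀, y₀, hs, hℓ, hH⟩ := exists_isSingularAt_of_mem_singScheme hκ hG hp f
    obtain ⟨r, hr⟩ := hℓ x hx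
    obtain ⟨r', hr'⟩ := hℓ x' hx'
    obtain ⟨t, ht⟩ := hH h hh h' hh'
    refine (f.toRingHom.map_vecMul _ _ l).trans (congr_fun (?_ : _ = (0 : Fin 3 → S)) l)
    change (f ∘ x') ᵥ* (contr _ x (h ⨯₃ h')).map f = 0
    rw [map_contr_map_algebraMap f G hr ht, hr', Matrix.smul_vecMul,
      Matrix.vecMul_smul, hs.vecMul_eq_zero, smul_zero, smul_zero]
  · intro x hx h hh h' hh' g hg g' hg'
    ext k
    refine eq_zero_of_forall_isLocalRing fun S _ _ _ f => ?_
    obtain ⟨x₀, y₀, hs, hℓ, hH⟩ := exists_isSingularAt_of_mem_singScheme hκ hG hp f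
    obtain ⟨r, hr⟩ := hℓ x hx
    obtain ⟨t, ht⟩ := hH h hh h' hh'
    obtain ⟨t', ht'⟩ := hH g hg g' hg'
    refine (f.toRingHom.map_mulVec _ _ k).trans (congr_fun (?_ : _ = (0 : Fin 3 → S)) k)
    change (contr _ x (h ⨯₃ h')).map f *ᵥ (f ∘ (g ⨯₃ g')) = 0
    rw [map_contr_map_algebraMap f G hr ht,
      ht', Matrix.mulVec_smul, Matrix.smul_mulVec,
      hs.mulVec_eq_zero, smul_zero, smul_zero]

theorem IsGraphOf.mem_singScheme {A : Submodule ℂ (ExteriorAlgebra ℂ W)} (hG : IsGraphOf u e A G)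
    (hκ : κ ≠ 0) (hsymm : G.IsSymm) {Λ : (Gr W 3).obj R} (hΛ : Λ ∈ (schemeFMinus A U).obj R)
    {p : (planeProd U).obj R} (h : IsProjection Λ p) :
    p ∈ (singScheme u e (biquadratic κ G)).obj R := by
  rw [mem_singScheme_biquadratic_iff hκ hsymm]
  intro S f x y hxy
  obtain ⟨hx, ⟨η, hη⟩, hy⟩ := isCoord_iff.1 hxy
  obtain ⟨hinl, hsnd⟩ := (isProjection_iff u e).1 (hG.isProjection_map hΛ h f)
  have hL := hG.mem_schemeF_iff.1 ((schemeF A).map f hΛ.1)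
  refine hL.isSingularAt hη (hinl.ge (hx.ge (Submodule.mem_span_singleton_self x))) fun a ha => ?_
  obtain ⟨w, hw, rfl⟩ := hsnd.ge ((hy a).2 ha)
  exact ⟨w.1, hw⟩

end HomogeneousCoordinates

section Isomorphism

theorem exists_coordSubmodule_eq {ι : Type*} [Fintype ι] {V : Type v} [AddCommGroup V] [Module ℂ V]
    (b : Basis ι ℂ V) {K : Type} [Field K] [Algebra ℂ K] {k : ℕ} (L : Submodule K (ι → K))
    (hL : finrank K ((ι → K) ⧸ L) = k) :
    ∃ N : Grassmannian K (K ⊗[ℂ] V) k, coordSubmodule b N.toSubmodule = L := by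
  obtain ⟨N, rfl⟩ : ∃ N, coordSubmodule b N = L :=
    Submodule.map_surjective_of_surjective (f := (tensorCoord b K).toLinearMap)
      (tensorCoord b K).surjective L
  refine ⟨grassmannianOfCoord b N k inferInstance fun p => ?_, rfl⟩
  rw [rankAtStalk_eq_finrank_of_free, Pi.natCast_apply, Nat.cast_id, hL]

theorem infinite_grassmannian_two {V : Type v} [AddCommGroup V] [Module ℂ V]
    (b : Basis (Fin 3) ℂ V) : Infinite (Grassmannian ℂ (ℂ ⊗[ℂ] V) 2) := by
  have hx (t : ℂ) : ![1, t, 0] ≠ (0 : Fin 3 → ℂ) := fun h => one_ne_zero (congr_fun h 0)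
  have hrank (t : ℂ) : finrank ℂ ((Fin 3 → ℂ) ⧸ Submodule.span ℂ {![1, t, 0]}) = 2 := by
    rw [Submodule.finrank_quotient, finrank_span_singleton (hx t), finrank_fin_fun]
  choose N hN using fun t => exists_coordSubmodule_eq b _ (hrank t)
  refine Infinite.of_injective N fun t s hts => ?_
  have hspan : ![1, t, 0] ∈ Submodule.span ℂ {![1, s, 0]} := by
    rw [← hN s, ← hts, hN t]
    exact Submodule.mem_span_singleton_self _
  obtain ⟨r, hr⟩ := Submodule.mem_span_singleton.1 hspan
  have hr_one : r * 1 = 1 := congr_fun hr 0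
  have hrs : r * s = t := congr_fun hr 1
  rw [← hrs, (mul_one r).symm.trans hr_one, one_mul]

theorem nonempty_grassmannian_one {V : Type v} [AddCommGroup V] [Module ℂ V]
    (b : Basis (Fin 3) ℂ V) : Nonempty (Grassmannian ℂ (ℂ ⊗[ℂ] V) 1) := by
  have hrank : finrank ℂ
      ((Fin 3 → ℂ) ⧸ LinearMap.ker (LinearMap.proj (φ := fun _ : Fin 3 => ℂ) 0)) = 1 :=
    ((LinearMap.proj (R := ℂ) (φ := fun _ : Fin 3 => ℂ) 0).quotKerEquivOfSurjective
      (LinearMap.proj_surjective 0)).finrank_eq.trans (finrank_self ℂ)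
  exact (exists_coordSubmodule_eq b _ hrank).nonempty

variable {W : Type v} [AddCommGroup W] [Module ℂ W] {U : Submodule ℂ W}
theorem infinite_planeProd (u : Basis (Fin 3) ℂ U) (e : Basis (Fin 3) ℂ (W ⧸ U)) :
    Infinite ((planeProd U).obj (CommAlgCat.of ℂ ℂ)) :=
  have := infinite_grassmannian_two u
  have := nonempty_grassmannian_one e
  inferInstanceAs (Infinite (Grassmannian ℂ (ℂ ⊗[ℂ] U) 2 × Grassmannian ℂ (ℂ ⊗[ℂ] (W ⧸ U)) 1))

variable {u : Basis (Fin 3) ℂ U} {e : Basis (Fin 3) ℂ (W ⧸ U)}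
variable {A : Submodule ℂ (ExteriorAlgebra ℂ W)}
variable {κ : ℂ} {G : Matrix (Fin 3 × Fin 3) (Fin 3 × Fin 3) ℂ}

/-- The point `(Λ ∩ U, (Λ + U) / U)` of the singular scheme attached to a point `Λ` of
`F_A - {u}`. -/
def toSing (hG : IsGraphOf u e A G) (hκ : κ ≠ 0) (hsymm : G.IsSymm) (R : CommAlgCat.{0} ℂ)
    (Λ : (schemeFMinus A U).toFunctor.obj R) :
    (singScheme u e (biquadratic κ G)).toFunctor.obj R :=
  ⟨(hG.exists_isProjection Λ.2).choose,
    hG.mem_singScheme hκ hsymm Λ.2 (hG.exists_isProjection Λ.2).choose_spec⟩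

variable (hG : IsGraphOf u e A G) (hκ : κ ≠ 0) (hsymm : G.IsSymm)

theorem isProjection_toSing (R : CommAlgCat.{0} ℂ) (Λ : (schemeFMinus A U).toFunctor.obj R) :
    IsProjection Λ.1 (toSing hG hκ hsymm R Λ).1 :=
  (hG.exists_isProjection Λ.2).choose_spec

theorem toSing_bijective (R : CommAlgCat.{0} ℂ) : Function.Bijective (toSing hG hκ hsymm R) := by
  refine ⟨fun Λ Λ' h => Subtype.ext ?_, fun p => ?_⟩
  · have hΛ := isProjection_toSing hG hκ hsymm R Λ
    rw [h] at hΛ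
    exact hG.eq_of_isProjection Λ.2.1 Λ'.2.1 hΛ (isProjection_toSing hG hκ hsymm R Λ')
  · obtain ⟨Λ, hΛ, h⟩ := hG.exists_mem_schemeFMinus (isSingular_of_mem_singScheme hκ hsymm p.2)
    exact ⟨⟨Λ, hΛ⟩, Subtype.ext ((isProjection_toSing hG hκ hsymm R ⟨Λ, hΛ⟩).unique h)⟩

/-- The isomorphism `Λ ↦ (Λ ∩ U, (Λ + U) / U)` from `F_A - {u}` to the singular scheme. -/
def singIso : (schemeFMinus A U).toFunctor ≅ (singScheme u e (biquadratic κ G)).toFunctor :=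
  NatIso.ofComponents (fun R => (Equiv.ofBijective _ (toSing_bijective hG hκ hsymm R)).toIso)
    fun f => by
      ext Λ
      exact Subtype.ext ((isProjection_toSing hG hκ hsymm _ _).unique
        (hG.isProjection_map Λ.2 (isProjection_toSing hG hκ hsymm _ Λ) f))

include hG hκ hsymm in
theorem biquadratic_ne_zero (hfin : FiniteF A) : biquadratic κ G ≠ 0 := by
  intro h
  have : Finite ((schemeFMinus A U).toFunctor.obj (CommAlgCat.of ℂ ℂ)) :=
    (hfin.subset fun _ hΛ => hΛ.1).to_subtype
  have : Finite ((singScheme u e (biquadratic κ G)).obj (CommAlgCat.of ℂ ℂ)) :=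
    Finite.of_surjective _ (toSing_bijective hG hκ hsymm _).2
  have hall (p : (planeProd U).obj (CommAlgCat.of ℂ ℂ)) :
      p ∈ (singScheme u e (biquadratic κ G)).obj (CommAlgCat.of ℂ ℂ) := by
    intro S f x y _ v w
    rw [h, map_zero]
  have : Finite ((planeProd U).obj (CommAlgCat.of ℂ ℂ)) :=
    Finite.of_injective (fun p => (⟨p, hall p⟩ : (singScheme u e (biquadratic κ G)).obj _))
      fun _ _ hpq => congr_arg Subtype.val hpq
  exact not_finite_iff_infinite.2 (infinite_planeProd u e) this

end Isomorphism

end Morin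

end

theorem mainTheorem2 {W : Type*} [AddCommGroup W] [Module ℂ W] (hW : Module.finrank ℂ W = 6)
    (U : Submodule ℂ W) (hU : Module.finrank ℂ U = 3)
    (A : Submodule ℂ (ExteriorAlgebra ℂ W)) (hA : Morin.IsLagrangian A)
    (huA : U.map (ExteriorAlgebra.ι ℂ) ^ 3 ≤ A)
    (hfin : Morin.FiniteF A) (hsm : Morin.TangentZeroAt A U)
    (u : Module.Basis (Fin 3) ℂ U) (e : Module.Basis (Fin 3) ℂ (W ⧸ U))
    (vol : W [⋀^Fin 6]→ₗ[ℂ] ℂ) (hvol : vol ≠ 0) :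
    Morin.verraForm u e A vol ≠ 0 ∧
    Morin.IsBihomogeneous (Morin.verraForm u e A vol) (2, 2) ∧
    Morin.singScheme u e (Morin.verraForm u e A vol) =
      Morin.zeroScheme u e
        (Set.range fun k => MvPolynomial.pderiv k (Morin.verraForm u e A vol)) ∧
    ∃ Φ : (Morin.schemeFMinus A U).toFunctor ≅
        (Morin.singScheme u e (Morin.verraForm u e A vol)).toFunctor,
      ∀ (R : CommAlgCat.{0} ℂ) (Λ : (Morin.schemeFMinus A U).toFunctor.obj R),
        Morin.IsTangentialProjection Λ.1 (Φ.hom.app R Λ).1 := by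
  have hT := hsm.isTransversal u e huA
  obtain ⟨G, hG⟩ := hA.exists_isGraphOf u e huA hT
  have hsymm : G.IsSymm := hG.isSymm hA
  have hκ := Morin.topForm_topWedge_mul_topWedge_ne_zero u e hvol
  rw [hG.verraForm_eq_biquadratic vol]
  exact ⟨Morin.biquadratic_ne_zero hG hκ hsymm hfin, Morin.isBihomogeneous_biquadratic _ G,
    Morin.singScheme_eq_zeroScheme u e (Morin.isHomogeneous_biquadratic _ G) four_ne_zero,
    Morin.singIso hG hκ hsymm,
    fun R Λ => hG.isTangentialProjection Λ.2.1 (Morin.isProjection_toSing hG hκ hsymm R Λ)⟩
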